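/- **Explicit formula in $H^s$, $s>\frac32$.** Let $d\ge 2$ and $0\le k\le d$ be integers, $\mathbb T=\mathbb R/2\pi\mathbb Z$, and let $\mathbb C^{d\times d}$ carry the Frobenius inner product. Let $L^2=L^2(\mathbb T;\mathbb C^{d\times d})$ (with respect to $\frac{d\theta}{2\pi}$), with Fourier coefficients $\widehat F_n=\frac1{2\pi}\int_0^{2\pi}F(\theta)e^{-in\theta}\,d\theta$, and let $H^s$ be the space of $F\in L^2$ with $\|F\|_{H^s}^2=\sum_{n\in\mathbb Z}(1+|n|^{2s})|\widehat F_n|^2<\infty$. Let $L^2_+=\{F\in L^2:\widehat F_n=0\text{ for }n<0\}$, $H^1_+=H^1\cap L^2_+$, and let $\Pi:L^2\to L^2_+$ be the orthogonal (Cauchy–Szegő) projection. An element $F\in L^2_+$ is identified with the holomorphic function $F(z)=\sum_{n\ge0}\widehat F_n z^n$ on the unit disk $\mathbb D$. Put $\mathscr M(F)=\widehat F_0$, let $S^*$ be the adjoint of the shift $SF=e^{i\theta}F$ on $L^2_+$, so that $(S^*F)(z)=\frac{F(z)-F(0)}{z}$, and for a bounded $V:\mathbb T\to\mathbb C^{d\times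 d}$ let $T_VF=\Pi(VF)$ be the Toeplitz operator on $L^2_+$. Let $D=-i\partial_\theta$ and $|D|F=\sum_n|n|\widehat F_ne^{in\theta}$. Let $\mathsf{Gr}_k(\mathbb C^d)=\{A\in\mathbb C^{d\times d}:A^*=A,\ A^2=\mathbb 1_d,\ \operatorname{Tr}A=d-2k\}$. Let $s>\frac32$, let $I\subset\mathbb R$ be an interval with $0\in I$, and let $U\in C(I;H^s)$, with $U(t)\in\mathsf{Gr}_k(\mathbb C^d)$ a.e. on $\mathbb T$ for every $t\in I$, be a solution of the half-wave maps equation $$\partial_tU=-\tfrac i2[U,|D|U]\quad\text{on }I,\qquad U_0:=U(0).$$ Consider the Lax operators $B_{U(t)}=-\frac i2\big(T_{U(t)}D+DT_{U(t)}\big)+\frac i2T_{|D|U(t)}$ on $L^2_+$ with domain $H^1_+$. Then there is exactly one family $\{\mathscr U(t)\}_{t\in I}$ of bounded operators on $L^2_+$ that is strongly continuous in $t$, maps $H^1_+$ into $H^1_+$, and satisfies $\mathscr U(0)=\mathrm{Id}$ and $$\frac{d}{dt}\mathscr U(t)F=B_{U(t)}\mathscr U(t)F\ \text{ in }L^2_+\qquad\text{for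 all }t\in I,\ F\in H^1_+ .$$ Every $\mathscr U(t)$ is unitary. For all $t\in I$ and $z\in\mathbb D$ the operator $\mathrm{Id}-z\,e^{-itT_{U_0}}S^*$ is invertible on $L^2_+$, and $$(\mathscr U(t)F)(z)=\mathscr M\big((\mathrm{Id}-z\,e^{-itT_{U_0}}S^*)^{-1}F\big)\qquad\text{for all }F\in L^2_+.$$ In particular, for all $t\in I$ and $z\in\mathbb D$, $$(\Pi U(t))(z)=\mathscr M\big((\mathrm{Id}-z\,e^{-itT_{U_0}}S^*)^{-1}\,\Pi U_0\big).$$ -/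

import Mathlib

open MeasureTheory Set Filter Topology
open scoped ENNReal Real

noncomputable section

namespace HWM

/-- The circle `𝕋 = ℝ / 2πℤ`. -/
abbrev Circ : Type := AddCircle (2 * π)

instance factTwoPi : Fact (0 < 2 * π) := ⟨Real.two_pi_pos⟩

/-- The normalized measure `dθ / 2π` on the circle. -/
abbrev circMeasure : Measure Circ := AddCircle.haarAddCircle

/-- The Hilbert space `E = ℂ^{d × d}` of complex matrices with the Frobenius norm. -/
abbrev MatE (d : ℕ) : Type := EuclideanSpace ℂ (Fin d × Fin d)

variable {d : ℕ}

/-- An element of `E`, read as a matrix. -/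
def toMat (A : MatE d) : Matrix (Fin d) (Fin d) ℂ := Matrix.of fun i j => A (i, j)

/-- A matrix, read as an element of `E`. -/
def ofMat (A : Matrix (Fin d) (Fin d) ℂ) : MatE d := WithLp.toLp 2 fun p => A p.1 p.2

/-- Matrix multiplication `E × E → E` as a continuous bilinear map. -/
def mulE (d : ℕ) : MatE d →L[ℂ] MatE d →L[ℂ] MatE d :=
  LinearMap.toContinuousLinearMap
    ((LinearMap.toContinuousLinearMap (𝕜 := ℂ) (E := MatE d) (F' := MatE d)).toLinearMap ∘ₗ
      LinearMap.mk₂ ℂ (fun A B : MatE d => ofMat (toMat A * toMat B))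
        (by intro A B C; ext p; simp [ofMat, toMat, Matrix.mul_apply, add_mul, Finset.sum_add_distrib])
        (by intro c A B; ext p; simp [ofMat, toMat, Matrix.mul_apply, Finset.mul_sum, mul_assoc])
        (by intro A B C; ext p; simp [ofMat, toMat, Matrix.mul_apply, mul_add, Finset.sum_add_distrib])
        (by intro c A B; ext p; simp [ofMat, toMat, Matrix.mul_apply, Finset.mul_sum, mul_left_comm]))

/-- The complex Grassmannian `Gr_k(ℂ^d)`, as a set of matrices. -/
def Gr (d k : ℕ) : Set (Matrix (Fin d) (Fin d) ℂ) :=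
  {A | A.conjTranspose = A ∧ A * A = 1 ∧ A.trace = (d : ℂ) - 2 * (k : ℂ)}

/-- `L² = L²(𝕋; ℂ^{d × d})`. -/
abbrev L2 (d : ℕ) : Type := Lp (MatE d) 2 circMeasure

/-- The `n`-th Fourier coefficient `(1/2π) ∫ F(θ) e^{-inθ} dθ`. -/
def coeff (F : L2 d) (n : ℤ) : MatE d := fourierCoeff (F : Circ → MatE d) n

/-- The element `θ ↦ e^{inθ} A` of `L²`. -/
def mono (n : ℤ) (A : MatE d) : L2 d :=
  ContinuousMap.toLp 2 circMeasure ℂ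
    (⟨fun θ => fourier n θ • A, (map_continuous (fourier n)).smul continuous_const⟩ : C(Circ, MatE d))

/-- The `H^s` norm `(∑ (1 + |n|^{2s}) |F̂_n|²)^{1/2}`, with the value `∞` allowed. -/
def hsNorm (s : ℝ) (F : L2 d) : ℝ≥0∞ :=
  (∑' n : ℤ, ENNReal.ofReal (1 + |(n : ℝ)| ^ (2 * s)) * ‖coeff F n‖ₑ ^ 2) ^ (1 / 2 : ℝ)

/-- Membership in the Sobolev space `H^s`. -/
def MemHs (s : ℝ) (F : L2 d) : Prop := hsNorm s F < ∞

/-- The operator `|D|`, given by `|D| F = ∑ |n| F̂_n e^{inθ}`; the series is an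
(unconditionally convergent) sum in `L²` for every `F ∈ H¹`, the domain of `|D|`. -/
def absD (F : L2 d) : L2 d := ∑' n : ℤ, mono n (((|n| : ℤ) : ℂ) • coeff F n)

lemma integrable_L2 (F : L2 d) : Integrable (F : Circ → MatE d) circMeasure :=
  (Lp.memLp F).integrable (by norm_num)

lemma coeff_add (F G : L2 d) (n : ℤ) : coeff (F + G) n = coeff F n + coeff G n := by
  unfold coeff
  rw [fourierCoeff_congr_ae (Lp.coeFn_add F G), fourierCoeff.add (integrable_L2 F) (integrable_L2 G)]
  rfl

lemma coeff_smul (c : ℂ) (F : L2 d) (n : ℤ) : coeff (c • F) n = c • coeff F n := by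
  unfold coeff
  rw [fourierCoeff_congr_ae (Lp.coeFn_smul c F), fourierCoeff.const_smul]

lemma norm_coeff_le (F : L2 d) (n : ℤ) : ‖coeff F n‖ ≤ ‖F‖ := by
  have h1 : ‖coeff F n‖ₑ ≤ eLpNorm (F : Circ → MatE d) 1 circMeasure := by
    unfold coeff fourierCoeff
    refine (enorm_integral_le_lintegral_enorm _).trans ?_
    rw [eLpNorm_one_eq_lintegral_enorm]
    refine lintegral_mono fun t => ?_
    have h : ‖fourier (-n) t‖ₑ = 1 := by
      rw [← ofReal_norm, fourier_apply, Circle.norm_coe, ENNReal.ofReal_one]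
    rw [enorm_smul, h, one_mul]
  have h2 : eLpNorm (F : Circ → MatE d) 1 circMeasure ≤ eLpNorm (F : Circ → MatE d) 2 circMeasure :=
    eLpNorm_le_eLpNorm_of_exponent_le (by norm_num) (Lp.aestronglyMeasurable F)
  rw [Lp.norm_def, ← toReal_enorm]
  exact ENNReal.toReal_mono (Lp.eLpNorm_ne_top F) (h1.trans h2)

/-- The Fourier coefficient as a continuous linear map. -/
def coeffL (d : ℕ) (n : ℤ) : L2 d →L[ℂ] MatE d :=
  LinearMap.mkContinuous
    { toFun := fun F => coeff F n
      map_add' := fun F G => coeff_add F G n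
      map_smul' := fun c F => coeff_smul c F n } 1
    (fun F => by simpa using norm_coeff_le F n)

/-- The Hardy space `L²_+`: all negative Fourier coefficients vanish. -/
def hardy (d : ℕ) : Submodule ℂ (L2 d) where
  carrier := {F | ∀ n : ℤ, n < 0 → coeff F n = 0}
  zero_mem' := fun n _ => map_zero (coeffL d n)
  add_mem' := fun {F G} hF hG n hn => by rw [coeff_add, hF n hn, hG n hn, add_zero]
  smul_mem' := fun c F hF n hn => by rw [coeff_smul, hF n hn, smul_zero]

lemma isClosed_hardy (d : ℕ) : IsClosed (hardy d : Set (L2 d)) := by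
  have : (hardy d : Set (L2 d)) = ⋂ n : ℤ, ⋂ _ : n < 0, {F | coeffL d n F = 0} := by
    ext F
    simp only [mem_iInter]
    exact Iff.rfl
  rw [this]
  exact isClosed_iInter fun n => isClosed_iInter fun _ =>
    isClosed_eq (coeffL d n).continuous continuous_const

instance completeSpace_hardy : CompleteSpace (hardy d) := (isClosed_hardy d).completeSpace_coe

/-- The Cauchy–Szegő projection `Π : L² → L²_+`. -/
def szego (d : ℕ) : L2 d →L[ℂ] hardy d := (hardy d).orthogonalProjectionOnto

open Classical in
/-- The Toeplitz operator `T_V F = Π (V F)` with a bounded symbol `V`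
(the default value `0` is used for unbounded `V` only). -/
def toeplitz (V : L2 d) : hardy d →L[ℂ] hardy d :=
  if h : MemLp (V : Circ → MatE d) ∞ circMeasure then
    szego d ∘L ((mulE d).holderL circMeasure ∞ 2 2 (h.toLp V)) ∘L (hardy d).subtypeL
  else 0

/-- The forward shift `S F = e^{iθ} F` on `L²_+`. -/
def shift (d : ℕ) : hardy d →L[ℂ] hardy d := toeplitz (mono 1 (ofMat 1))

/-- The backward shift `S^*` on `L²_+`. -/
def backShift (d : ℕ) : hardy d →L[ℂ] hardy d := ContinuousLinearMap.adjoint (shift d)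

/-- The mean `ℳ(F) = F̂_0`. -/
def mean (F : hardy d) : MatE d := coeff (F : L2 d) 0

/-- The value at `z` (with `|z| < 1`) of the holomorphic function on the disk that is
identified with `F ∈ L²_+`. -/
def evalDisk (F : hardy d) (z : ℂ) : MatE d := ∑' n : ℕ, z ^ n • coeff (F : L2 d) (n : ℤ)

/-- `D = -i ∂_θ` on `L²_+`, given by `D F = ∑ n F̂_n e^{inθ}`, with domain `H¹_+`. -/
def opD (F : hardy d) : hardy d :=
  szego d (∑' n : ℤ, mono n ((n : ℂ) • coeff (F : L2 d) n))

/-- The Lax operator `B_U = -(i/2)(T_U D + D T_U) + (i/2) T_{|D|U}`, with domain `H¹_+`. -/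
def laxB (U : L2 d) (F : hardy d) : hardy d :=
  (-(Complex.I / 2)) • (toeplitz U (opD F) + opD (toeplitz U F))
    + (Complex.I / 2) • toeplitz (absD U) F

/-- `U ∈ C(I; H^s(𝕋; Gr_k(ℂ^d)))` is a solution of the half-wave maps equation
`∂_t U = -(i/2) [U, |D| U]` on `I`. The time derivative is taken in `L²` (one-sided at end points
of `I`). -/
structure IsSolution (k : ℕ) (s : ℝ) (I : Set ℝ) (U : ℝ → L2 d) : Prop where
  memHs : ∀ t ∈ I, MemHs s (U t)
  mem_gr : ∀ t ∈ I, ∀ᵐ θ ∂circMeasure, toMat (U t θ) ∈ Gr d k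
  continuous_hs : ∀ t₀ ∈ I, Tendsto (fun t => hsNorm s (U t - U t₀)) (𝓝[I] t₀) (𝓝 0)
  equation : ∀ t ∈ I, ∃ V : L2 d,
    (∀ᵐ θ ∂circMeasure, toMat (V θ) = (-(Complex.I / 2)) •
      (toMat (U t θ) * toMat (absD (U t) θ) - toMat (absD (U t) θ) * toMat (U t θ))) ∧
    HasDerivWithinAt U V I t

/-- `𝒰` is a propagator generated by `B_{U(t)}` on `I`: a strongly continuous family of bounded
operators on `L²_+` with `𝒰(0) = 1` that preserves the common domain `H¹_+` of the `B_{U(t)}` and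
solves `∂_t 𝒰(t) F = B_{U(t)} 𝒰(t) F` in `L²_+` for all `F ∈ H¹_+`. -/
structure IsPropagator (I : Set ℝ) (U : ℝ → L2 d) (P : ℝ → hardy d →L[ℂ] hardy d) : Prop where
  initial : P 0 = 1
  strongly_continuous : ∀ F : hardy d, ContinuousOn (fun t => P t F) I
  preserves_domain : ∀ t ∈ I, ∀ F : hardy d, MemHs 1 (F : L2 d) → MemHs 1 (P t F : L2 d)
  equation : ∀ t ∈ I, ∀ F : hardy d, MemHs 1 (F : L2 d) →
    HasDerivWithinAt (fun τ => P τ F) (laxB (U t) (P t F)) I t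

/-- The exponential of a bounded operator. -/
def opExp {H : Type*} [NormedAddCommGroup H] [NormedSpace ℂ H] (A : H →L[ℂ] H) : H →L[ℂ] H :=
  NormedSpace.exp A

/-- The operator `I - z e^{-itT_V} S^*` on `L²_+`. -/
def resolventArg (V : L2 d) (t : ℝ) (z : ℂ) : hardy d →L[ℂ] hardy d :=
  1 - z • (opExp ((-(Complex.I * (t : ℂ))) • toeplitz V) * backShift d)

end HWM

end

set_option linter.unusedSectionVars false

noncomputable section

namespace HWM

/-! ### Kernel operators on `ℓ²(ℕ; E)` -/

/-! On the Fourier side `L²_+` is `ℓ²(ℕ; E)`, the Toeplitz operator `T_U` has kernel `u(n - m)` and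
`D` is multiplication by `n`. Since `n + m - |n - m| = 2 min(n, m)`, the Lax operator `B_U` has
kernel `-i min(n, m) u(n - m)`, and the algebra of the theorem is read off from this kernel. It is
skew because `u(-k) = u(k)^*`. Its row and column of index `0` vanish, so the propagator `P(t)`
preserves the mean and fixes constants. The identity `min(n+1, m+1) = min(n, m) + 1` gives `S^* B =
(B - iT_U) S^*` (`bshift_laxS`). Finally `U² = 1` and the equation give `[B, T_U] = T_{∂_t U}`
(`laxS_toepW`).

Solutions of `y' = By + Ky` with `K` skew are determined by one value (`evolution_unique`). The
commutator relation therefore yields `T_{U(t)} P(t) = P(t) T_{U_0}` (`IsFlow.toep_comm`), and with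
it the shift relation yields `S^* P(t) = P(t) e^{-itT_{U_0}} S^*` (`IsFlow.bshift_comm`). The `n`-th
coefficient of `P(t)F` is the mean of `(S^*)^n P(t) F`, that is, the mean of `(e^{-itT_{U_0}} S^*)^n
F` (`IsFlow.coeff_formula`). Multiplying by `z^n` and summing gives the Neumann series of the
resolvent. The formula for the solution follows from `ΠU(t) = T_{U(t)} 1 = T_{U(t)} P(t) 1 = P(t)
T_{U_0} 1 = P(t) ΠU_0`.

The analytic part is the existence of `P(t)`. For `s > 3/2` there is `p > 1` such that `H^s` embeds
into the Wiener algebra with weight `(1+|k|)^p` (`exists_wiener_le`). Replacing `min(n, m)` by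
`min(n, m, N)` makes the operators bounded, and a Dyson series solves the equation. Conjugation by
`(1+n)^q`, for `q = 1` and `q = p`, changes the truncated kernel by a bounded term uniformly in `N`
(`commutator_bound`), so energy estimates hold in each weighted space. The `q = 1` bound makes the
truncated flows Cauchy in `ℓ²`; interpolation against the `q = p` bound makes them Cauchy in the
domain `H¹_+`. The limit is isometric and solves the equation. It is unitary because the equation
can also be solved from any other initial time.

The unbounded `B` is handled through the bounded operator `laxS = B (1+n)^{-1}`: a domain element is
written `iw 1 a`, and `B` sends it to `laxS u a`. -/

/-- The sequence space `ℓ²(ℕ; E)`. -/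
abbrev Seq (E : Type*) [NormedAddCommGroup E] : Type _ := lp (fun _ : ℕ => E) 2

section Kernel

variable {E : Type*} [NormedAddCommGroup E] [InnerProductSpace ℂ E]

lemma Seq.sum_sq_le (f : Seq E) (s : Finset ℕ) : ∑ n ∈ s, ‖f n‖ ^ 2 ≤ ‖f‖ ^ 2 := by
  have := lp.sum_rpow_le_norm_rpow (p := 2) (by norm_num) f s
  simpa using this

lemma Seq.summable_sq (f : Seq E) : Summable fun n => ‖f n‖ ^ 2 := by
  have := (lp.memℓp f).summable (by norm_num)
  simpa using this

lemma Seq.memℓp_of_sum_sq_le {g : ℕ → E} {C : ℝ} (h : ∀ s : Finset ℕ, ∑ n ∈ s, ‖g n‖ ^ 2 ≤ C) :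
    Memℓp g 2 := memℓp_gen' (C := C) fun s => by simpa using h s

lemma Seq.norm_le_of_sum_sq_le {f : Seq E} {C : ℝ} (hC : 0 ≤ C)
    (h : ∀ s : Finset ℕ, ∑ n ∈ s, ‖f n‖ ^ 2 ≤ C ^ 2) : ‖f‖ ≤ C :=
  lp.norm_le_of_forall_sum_le (p := 2) (by norm_num) hC fun s => by simpa using h s

/-- The function `n ↦ c n (f (n - k))`, read as `0` where `n < k`. -/
def diagFun (k : ℤ) (c : ℕ → E →L[ℂ] E) (f : ℕ → E) (n : ℕ) : E :=
  if k ≤ n then c n (f ((n : ℤ) - k).toNat) else 0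

lemma sum_diagFun_le (k : ℤ) {c : ℕ → E →L[ℂ] E} {K : ℝ} (hc : ∀ n : ℕ, k ≤ n → ‖c n‖ ≤ K)
    (f : Seq E) (s : Finset ℕ) : ∑ n ∈ s, ‖diagFun k c f n‖ ^ 2 ≤ (K * ‖f‖) ^ 2 := by
  have h1 : ∑ n ∈ s, ‖diagFun k c f n‖ ^ 2
      = ∑ n ∈ s.filter (fun n : ℕ => k ≤ n), ‖c n (f ((n : ℤ) - k).toNat)‖ ^ 2 := by
    rw [Finset.sum_filter]
    refine Finset.sum_congr rfl fun n _ => ?_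
    unfold diagFun
    split_ifs <;> simp
  have h2 : ∑ n ∈ s.filter (fun n : ℕ => k ≤ n), ‖f ((n : ℤ) - k).toNat‖ ^ 2 ≤ ‖f‖ ^ 2 := by
    have hinj : Set.InjOn (fun n : ℕ => ((n : ℤ) - k).toNat) (s.filter (fun n : ℕ => k ≤ n)) := by
      intro a ha b hb hab
      simp only [Finset.coe_filter, Set.mem_ofPred_eq] at ha hb hab
      have ha := ha.2
      have hb := hb.2
      omega
    rw [← Finset.sum_image (f := fun m => ‖f m‖ ^ 2) hinj]
    exact Seq.sum_sq_le f _
  rw [h1, mul_pow]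
  calc _ ≤ ∑ n ∈ s.filter (fun n : ℕ => k ≤ n), K ^ 2 * ‖f ((n : ℤ) - k).toNat‖ ^ 2 := by
        refine Finset.sum_le_sum fun n hn => ?_
        rw [← mul_pow]
        have hn := (Finset.mem_filter.1 hn).2
        exact pow_le_pow_left₀ (norm_nonneg _) (((c n).le_opNorm _).trans
          (mul_le_mul_of_nonneg_right (hc n hn) (norm_nonneg _))) 2
    _ ≤ _ := by
        rw [← Finset.mul_sum]
        exact mul_le_mul_of_nonneg_left h2 (sq_nonneg _)

/-- The operator with kernel supported on the `k`-th diagonal. -/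
def diagOp (k : ℤ) (c : ℕ → E →L[ℂ] E) (K : ℝ) (hK : 0 ≤ K) (hc : ∀ n : ℕ, k ≤ n → ‖c n‖ ≤ K) :
    Seq E →L[ℂ] Seq E :=
  LinearMap.mkContinuous
    { toFun := fun f => ⟨diagFun k c f, Seq.memℓp_of_sum_sq_le (sum_diagFun_le k hc f)⟩
      map_add' := fun f g => by
        ext n
        simp only [diagFun, lp.coeFn_add, Pi.add_apply]
        split_ifs <;> simp
      map_smul' := fun a f => by
        ext n
        simp only [diagFun, lp.coeFn_smul, Pi.smul_apply, RingHom.id_apply]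
        split_ifs <;> simp } K
    (fun f => Seq.norm_le_of_sum_sq_le (mul_nonneg hK (norm_nonneg _)) (sum_diagFun_le k hc f))

lemma norm_diagOp_le (k : ℤ) (c : ℕ → E →L[ℂ] E) (K : ℝ) (hK : 0 ≤ K)
    (hc : ∀ n : ℕ, k ≤ n → ‖c n‖ ≤ K) : ‖diagOp k c K hK hc‖ ≤ K :=
  LinearMap.mkContinuous_norm_le _ hK _

/-- The kernel `a` is dominated by the summable convolution kernel `K`. -/
structure Dominated (a : ℕ → ℕ → E →L[ℂ] E) (K : ℤ → ℝ) : Prop where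
  summable : Summable K
  bound : ∀ n m : ℕ, ‖a n m‖ ≤ K ((n : ℤ) - m)

/-- `K` restricted to nonnegative values, which also dominates. -/
lemma Dominated.pos {a : ℕ → ℕ → E →L[ℂ] E} {K : ℤ → ℝ} (h : Dominated a K) (k : ℤ) : 0 ≤ K k := by
  rcases le_total 0 k with hk | hk
  · have := h.bound k.toNat 0
    rw [Int.toNat_of_nonneg hk] at this
    simpa using (norm_nonneg _).trans this
  · have := h.bound 0 (-k).toNat
    rw [Int.toNat_of_nonneg (by omega)] at this
    simpa using (norm_nonneg _).trans this

lemma Dominated.diag {a : ℕ → ℕ → E →L[ℂ] E} {K : ℤ → ℝ} (h : Dominated a K) (k : ℤ) (n : ℕ)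
    (hk : k ≤ n) : ‖a n ((n : ℤ) - k).toNat‖ ≤ K k := by
  have := h.bound n ((n : ℤ) - k).toNat
  rwa [Int.toNat_of_nonneg (by omega), sub_sub_cancel] at this

variable [CompleteSpace E]

open Classical in
/-- The operator on `ℓ²(ℕ; E)` with kernel `a` (and `0` if `a` is not dominated). -/
def kerOp (a : ℕ → ℕ → E →L[ℂ] E) : Seq E →L[ℂ] Seq E :=
  if h : ∃ K, Dominated a K then
    ∑' k : ℤ, diagOp k (fun n => a n ((n : ℤ) - k).toNat) (h.choose k) (h.choose_spec.pos k)
      (fun n hn => h.choose_spec.diag k n hn)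
  else 0

/-- The series of diagonals converges in operator norm. Reading it at the entry `n` and substituting
`k = n - m` gives the row sum; the diagonals `k > n` contribute nothing there. -/
lemma kerOp_hasSum {a : ℕ → ℕ → E →L[ℂ] E} {K : ℤ → ℝ} (h : Dominated a K) (f : Seq E) (n : ℕ) :
    HasSum (fun m => a n m (f m)) (kerOp a f n) := by
  have hex : ∃ K, Dominated a K := ⟨K, h⟩
  have hs : Summable fun k : ℤ => diagOp k (fun n => a n ((n : ℤ) - k).toNat) (hex.choose k)
      (hex.choose_spec.pos k) (fun n hn => hex.choose_spec.diag k n hn) :=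
    Summable.of_norm_bounded hex.choose_spec.summable fun k => norm_diagOp_le _ _ _ _ _
  have h1 := hs.hasSum
  have h2 : kerOp a = ∑' k : ℤ, diagOp k (fun n => a n ((n : ℤ) - k).toNat) (hex.choose k)
      (hex.choose_spec.pos k) (fun n hn => hex.choose_spec.diag k n hn) := by
    unfold kerOp
    rw [dif_pos hex]
  rw [← h2] at h1
  have h3 : HasSum (fun k : ℤ => diagFun k (fun n => a n ((n : ℤ) - k).toNat) f n)
      (kerOp a f n) := by
    have := h1.mapL ((lp.evalCLM ℂ (fun _ : ℕ => E) 2 n) ∘L (ContinuousLinearMap.apply ℂ (Seq E) f))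
    exact this
  have hinj : Function.Injective (fun m : ℕ => (n : ℤ) - m) := fun a b hab => by
    simp only at hab; omega
  rw [← hinj.hasSum_iff] at h3
  · refine h3.congr_fun fun m => ?_
    simp [diagFun]
  · intro k hk
    unfold diagFun
    rw [if_neg]
    intro hkn
    exact hk ⟨((n : ℤ) - k).toNat, by simp only; omega⟩

lemma norm_kerOp_le {a : ℕ → ℕ → E →L[ℂ] E} {K : ℤ → ℝ} (h : Dominated a K) :
    ‖kerOp a‖ ≤ ∑' k, K k := by
  have key : kerOp a = ∑' k : ℤ, diagOp k (fun n => a n ((n : ℤ) - k).toNat) (K k)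
      (h.pos k) (fun n hn => h.diag k n hn) := by
    have hex : ∃ K, Dominated a K := ⟨K, h⟩
    unfold kerOp
    rw [dif_pos hex]
    -- The majorant enters `diagOp` only through proofs, so the series built from the chosen
    -- majorant is definitionally the one built from `K`.
    rfl
  rw [key]
  exact tsum_of_norm_bounded h.summable.hasSum fun k => norm_diagOp_le _ _ _ _ _

lemma kerOp_apply {a : ℕ → ℕ → E →L[ℂ] E} {K : ℤ → ℝ} (h : Dominated a K) (f : Seq E) (n : ℕ) :
    kerOp a f n = ∑' m, a n m (f m) := (kerOp_hasSum h f n).tsum_eq.symm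

/-- The sequence with the single entry `e` in position `m`. -/
abbrev sgl (m : ℕ) (e : E) : Seq E := lp.single 2 m e

lemma sgl_apply (m : ℕ) (e : E) (n : ℕ) : sgl m e n = if n = m then e else 0 := by
  rw [lp.single_apply, Pi.single_apply]

lemma kerOp_sgl {a : ℕ → ℕ → E →L[ℂ] E} {K : ℤ → ℝ} (h : Dominated a K) (m : ℕ) (e : E) (n : ℕ) :
    kerOp a (sgl m e) n = a n m e := by
  rw [kerOp_apply h, tsum_eq_single m]
  · rw [sgl_apply, if_pos rfl]
  · intro j hj
    rw [sgl_apply, if_neg hj, map_zero]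

/-- Finite sums of single entries are dense. Operator identities are checked on them, where a kernel
is evaluated without any series. -/
lemma clm_ext_sgl {F : Type*} [NormedAddCommGroup F] [NormedSpace ℂ F] {A B : Seq E →L[ℂ] F}
    (h : ∀ m e, A (sgl m e) = B (sgl m e)) : A = B := by
  ext f
  have h1 := (lp.hasSum_single (p := 2) (by norm_num) f).mapL A
  have h2 := (lp.hasSum_single (p := 2) (by norm_num) f).mapL B
  exact h1.unique (h2.congr_fun fun m => (h m (f m)))

lemma dense_of_sgl (S : Submodule ℂ (Seq E)) (h : ∀ m e, sgl m e ∈ S) : Dense (S : Set (Seq E)) := by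
  intro f
  have h1 := (lp.hasSum_single (p := 2) (by norm_num) f)
  exact mem_closure_of_tendsto h1 (Eventually.of_forall fun s => S.sum_mem fun m _ => h m (f m))

lemma Dominated.sub {a b : ℕ → ℕ → E →L[ℂ] E} {K L : ℤ → ℝ} (ha : Dominated a K)
    (hb : Dominated b L) : Dominated (fun n m => a n m - b n m) (fun k => K k + L k) :=
  ⟨ha.summable.add hb.summable, fun n m => (norm_sub_le _ _).trans
    (add_le_add (ha.bound n m) (hb.bound n m))⟩

lemma kerOp_sub {a b : ℕ → ℕ → E →L[ℂ] E} {K L : ℤ → ℝ} (ha : Dominated a K)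
    (hb : Dominated b L) : kerOp (fun n m => a n m - b n m) = kerOp a - kerOp b := by
  refine clm_ext_sgl fun m e => ?_
  ext n
  rw [kerOp_sgl (ha.sub hb)]
  simp [kerOp_sgl ha, kerOp_sgl hb]

lemma inner_kerOp {a b : ℕ → ℕ → E →L[ℂ] E} {K L : ℤ → ℝ} (ha : Dominated a K)
    (hb : Dominated b L) (hab : ∀ n m x y, inner ℂ (a n m x) y = inner ℂ x (b m n y))
    (f g : Seq E) : inner ℂ (kerOp a f) g = inner ℂ f (kerOp b g) := by
  have : ContinuousLinearMap.adjoint (kerOp a) = kerOp b := by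
    refine clm_ext_sgl fun m e => ?_
    ext n
    refine ext_inner_left ℂ fun x => ?_
    rw [kerOp_sgl hb, ← lp.inner_single_left (G := fun _ : ℕ => E) n x,
      ContinuousLinearMap.adjoint_inner_right, lp.inner_single_right, kerOp_sgl ha, hab]
  rw [← this, ContinuousLinearMap.adjoint_inner_right]

/-! ### Diagonal operators -/

/-- Multiplication of the `n`-th entry by `w n`. -/
def wtOp (w : ℕ → ℝ) : Seq E →L[ℂ] Seq E :=
  kerOp fun n m => if n = m then ((w n : ℝ) : ℂ) • (1 : E →L[ℂ] E) else 0

lemma dominated_wt {w : ℕ → ℝ} {C : ℝ} (hw : ∀ n, |w n| ≤ C) :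
    Dominated (fun n m => if n = m then ((w n : ℝ) : ℂ) • (1 : E →L[ℂ] E) else 0)
      (fun k => if k = 0 then C else 0) := by
  have hC : 0 ≤ C := (abs_nonneg _).trans (hw 0)
  refine ⟨summable_of_ne_finset_zero (s := {0}) fun k hk => ?_, fun n m => ?_⟩
  · rw [if_neg]; simpa using hk
  · by_cases h : n = m
    · subst h
      rw [if_pos rfl, sub_self, if_pos rfl, norm_smul, Complex.norm_real]
      calc _ ≤ |w n| * 1 := mul_le_mul_of_nonneg_left ContinuousLinearMap.norm_id_le (abs_nonneg _)
        _ ≤ C := by rw [mul_one]; exact hw n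
    · rw [if_neg h, norm_zero]
      split_ifs <;> simp [hC]

lemma wtOp_apply {w : ℕ → ℝ} {C : ℝ} (hw : ∀ n, |w n| ≤ C) (f : Seq E) (n : ℕ) :
    wtOp w f n = ((w n : ℝ) : ℂ) • f n := by
  unfold wtOp
  rw [kerOp_apply (dominated_wt hw), tsum_eq_single n]
  · simp
  · intro m hm
    rw [if_neg (Ne.symm hm)]; simp

lemma wtOp_sgl {w : ℕ → ℝ} {C : ℝ} (hw : ∀ n, |w n| ≤ C) (m : ℕ) (e : E) :
    wtOp w (sgl m e) = sgl m (((w m : ℝ) : ℂ) • e) := by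
  ext n
  rw [wtOp_apply hw, sgl_apply, sgl_apply]
  split_ifs with h
  · rw [h]
  · simp

lemma wtOp_injective {w : ℕ → ℝ} {C : ℝ} (hw : ∀ n, |w n| ≤ C) (h0 : ∀ n, w n ≠ 0) :
    Function.Injective (wtOp w : Seq E →L[ℂ] Seq E) := by
  intro f g hfg
  ext n
  have : wtOp w f n = wtOp w g n := by rw [hfg]
  rw [wtOp_apply hw, wtOp_apply hw] at this
  exact smul_right_injective E (by exact_mod_cast h0 n) this

lemma wtOp_denseRange {w : ℕ → ℝ} {C : ℝ} (hw : ∀ n, |w n| ≤ C) (h0 : ∀ n, w n ≠ 0) :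
    DenseRange (wtOp w : Seq E →L[ℂ] Seq E) := by
  have := dense_of_sgl (LinearMap.range (wtOp w : Seq E →L[ℂ] Seq E).toLinearMap) (fun m e => by
    refine ⟨sgl m ((((w m)⁻¹ : ℝ) : ℂ) • e), ?_⟩
    change wtOp w _ = _
    rw [wtOp_sgl hw, smul_smul, ← Complex.ofReal_mul, mul_inv_cancel₀ (h0 m)]
    simp)
  exact this

lemma inner_wtOp {w : ℕ → ℝ} {C : ℝ} (hw : ∀ n, |w n| ≤ C) (f g : Seq E) :
    inner ℂ (wtOp w f) g = inner ℂ f (wtOp w g) := by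
  refine inner_kerOp (dominated_wt hw) (dominated_wt hw) (fun n m x y => ?_) f g
  by_cases h : n = m
  · subst h
    simp
  · simp [h, Ne.symm h]

/-! ### Multipliers of Toeplitz kernels -/

/-- The kernel `φ(n, m) u(n - m)`. -/
def mker (φ : ℕ → ℕ → ℝ) (u : ℤ → E →L[ℂ] E) (n m : ℕ) : E →L[ℂ] E :=
  ((φ n m : ℝ) : ℂ) • u ((n : ℤ) - m)

/-- The operator with kernel `φ(n, m) u(n - m)`. -/
def mulOp (φ : ℕ → ℕ → ℝ) (u : ℤ → E →L[ℂ] E) : Seq E →L[ℂ] Seq E := kerOp (mker φ u)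

lemma dominated_mker {φ : ℕ → ℕ → ℝ} {κ : ℤ → ℝ} {u : ℤ → E →L[ℂ] E}
    (hφ : ∀ n m : ℕ, |φ n m| ≤ κ ((n : ℤ) - m)) (hu : Summable fun k => κ k * ‖u k‖) :
    Dominated (mker φ u) (fun k => κ k * ‖u k‖) :=
  ⟨hu, fun n m => by
    unfold mker
    rw [norm_smul, Complex.norm_real]
    exact mul_le_mul_of_nonneg_right (hφ n m) (norm_nonneg _)⟩

lemma wtOp_comp_kerOp {a b : ℕ → ℕ → E →L[ℂ] E} {w : ℕ → ℝ} {K L : ℤ → ℝ} {C : ℝ}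
    (hw : ∀ n, |w n| ≤ C) (ha : Dominated a K) (hb : Dominated b L)
    (hab : ∀ n m, ((w n : ℝ) : ℂ) • a n m = b n m) : wtOp w ∘L kerOp a = kerOp b := by
  refine clm_ext_sgl fun m e => ?_
  ext n
  rw [ContinuousLinearMap.comp_apply, wtOp_apply hw, kerOp_sgl ha, kerOp_sgl hb, ← hab]
  rfl

lemma kerOp_comp_wtOp {a b : ℕ → ℕ → E →L[ℂ] E} {w : ℕ → ℝ} {K L : ℤ → ℝ} {C : ℝ}
    (hw : ∀ n, |w n| ≤ C) (ha : Dominated a K) (hb : Dominated b L)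
    (hab : ∀ n m, ((w m : ℝ) : ℂ) • a n m = b n m) : kerOp a ∘L wtOp w = kerOp b := by
  refine clm_ext_sgl fun m e => ?_
  ext n
  rw [ContinuousLinearMap.comp_apply, wtOp_sgl hw, kerOp_sgl ha, kerOp_sgl hb, ← hab, map_smul]
  rfl

end Kernel

/-! ### Linear differential equations with bounded coefficients -/

section LinearODE

variable {R : Type*} [NormedRing R] [NormedAlgebra ℝ R] [CompleteSpace R]

/-- The terms of the Dyson series of `Y' = A Y`, `Y(t₀) = 1`. -/
def dyson (A : ℝ → R) (t₀ : ℝ) : ℕ → ℝ → R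
  | 0 => fun _ => 1
  | k + 1 => fun t => ∫ τ in t₀..t, A τ * dyson A t₀ k τ

lemma continuous_dyson {A : ℝ → R} (hA : Continuous A) (t₀ : ℝ) (k : ℕ) :
    Continuous (dyson A t₀ k) := by
  induction k with
  | zero => exact continuous_const
  | succ k ih =>
    exact intervalIntegral.continuous_primitive (μ := volume)
      (fun a b => (hA.mul ih).intervalIntegrable a b) t₀

lemma hasDerivAt_dyson {A : ℝ → R} (hA : Continuous A) (t₀ : ℝ) (k : ℕ) (t : ℝ) :
    HasDerivAt (dyson A t₀ (k + 1)) (A t * dyson A t₀ k t) t :=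
  intervalIntegral.integral_hasDerivAt_right ((hA.mul (continuous_dyson hA t₀ k)).intervalIntegrable _ _)
    ((hA.mul (continuous_dyson hA t₀ k)).stronglyMeasurableAtFilter _ _)
    (hA.mul (continuous_dyson hA t₀ k)).continuousAt

lemma norm_dyson_le {A : ℝ → R} (hA : Continuous A) {M : ℝ} (hM : ∀ t, ‖A t‖ ≤ M) (t₀ : ℝ)
    (k : ℕ) (t : ℝ) :
    ‖dyson A t₀ k t‖ ≤ ‖(1 : R)‖ * (M ^ k * (|t - t₀| ^ k / k.factorial)) := by
  have hM0 : 0 ≤ M := (norm_nonneg _).trans (hM 0)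
  induction k generalizing t with
  | zero => simp [dyson]
  | succ k ih =>
    calc ‖dyson A t₀ (k + 1) t‖ ≤ ∫ τ in uIoc t₀ t, ‖A τ * dyson A t₀ k τ‖ :=
          intervalIntegral.norm_integral_le_integral_norm_uIoc
      _ ≤ ∫ τ in uIoc t₀ t, (‖(1 : R)‖ * M ^ (k + 1) / k.factorial) * |τ - t₀| ^ k := by
          have hc := (hA.mul (continuous_dyson hA t₀ k)).norm
          have hd : Continuous fun τ : ℝ => (‖(1 : R)‖ * M ^ (k + 1) / k.factorial) * |τ - t₀| ^ k := by
            fun_prop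
          refine setIntegral_mono (hc.integrableOn_uIoc) (hd.integrableOn_uIoc) fun τ => ?_
          calc ‖A τ * dyson A t₀ k τ‖ ≤ ‖A τ‖ * ‖dyson A t₀ k τ‖ := norm_mul_le _ _
            _ ≤ M * (‖(1 : R)‖ * (M ^ k * (|τ - t₀| ^ k / k.factorial))) :=
                mul_le_mul (hM τ) (ih τ) (norm_nonneg _) hM0
            _ = _ := by ring
      _ = _ := by
          rw [integral_const_mul, integral_pow_abs_sub_uIoc, Nat.factorial_succ]
          push_cast
          field_simp

theorem exists_linear_ode {A : ℝ → R} (hA : Continuous A) {M : ℝ} (hM : ∀ t, ‖A t‖ ≤ M) (t₀ : ℝ) :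
    ∃ Y : ℝ → R, Y t₀ = 1 ∧ ∀ t, HasDerivAt Y (A t * Y t) t := by
  have hM0 : 0 ≤ M := (norm_nonneg _).trans (hM 0)
  have hz : ∀ k, dyson A t₀ (k + 1) t₀ = 0 := fun k => by simp [dyson]
  have hsum : ∀ t, Summable fun k => dyson A t₀ k t := fun t => by
    refine Summable.of_norm_bounded (g := fun k => ‖(1 : R)‖ * ((M * |t - t₀|) ^ k / k.factorial))
      ((Real.summable_pow_div_factorial _).mul_left _) fun k => ?_
    refine (norm_dyson_le hA hM t₀ k t).trans (le_of_eq ?_)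
    rw [mul_pow]; ring
  refine ⟨fun t => 1 + ∑' k, dyson A t₀ (k + 1) t, by simp [hz], fun t => ?_⟩
  have key : HasDerivAt (fun t => ∑' k, dyson A t₀ (k + 1) t) (∑' k, A t * dyson A t₀ k t) t := by
    -- Termwise differentiation takes place on the ball of radius `|t - t₀| + 1`, which contains `t`
    -- and on which the factorial majorant is uniform.
    have hr : 0 < |t - t₀| + 1 := by positivity
    have hs : Summable fun k : ℕ =>
        M * (‖(1 : R)‖ * ((M * (|t - t₀| + 1)) ^ k / (k.factorial : ℝ))) :=
      ((Real.summable_pow_div_factorial _).mul_left _).mul_left _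
    have ht : t ∈ Metric.ball t₀ (|t - t₀| + 1) := by
      rw [Metric.mem_ball, Real.dist_eq]; linarith
    have hz' : Summable fun k => dyson A t₀ (k + 1) t₀ := by simp only [hz]; exact summable_zero
    refine hasDerivAt_tsum_of_isPreconnected hs Metric.isOpen_ball
      (convex_ball t₀ (|t - t₀| + 1)).isPreconnected
      (fun k y _ => hasDerivAt_dyson hA t₀ k y) (fun k y hy => ?_)
      (Metric.mem_ball_self hr) hz' ht
    · have hy : |y - t₀| ≤ |t - t₀| + 1 := by
        have := (Metric.mem_ball.1 hy).le
        rwa [Real.dist_eq] at this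
      calc ‖A y * dyson A t₀ k y‖ ≤ ‖A y‖ * ‖dyson A t₀ k y‖ := norm_mul_le _ _
        _ ≤ M * (‖(1 : R)‖ * (M ^ k * (|y - t₀| ^ k / k.factorial))) :=
          mul_le_mul (hM y) (norm_dyson_le hA hM t₀ k y) (norm_nonneg _) hM0
        _ ≤ M * (‖(1 : R)‖ * (M ^ k * ((|t - t₀| + 1) ^ k / k.factorial))) := by gcongr
        _ = _ := by rw [mul_pow]; ring
  have h2 : ∑' k, A t * dyson A t₀ k t = A t * (1 + ∑' k, dyson A t₀ (k + 1) t) := by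
    rw [(hsum t).tsum_mul_left, (hsum t).tsum_eq_zero_add]
    rfl
  rw [← h2]
  exact key.const_add 1

/-- Propagators of bounded, norm continuous families of operators. -/
theorem exists_bounded_propagator {H : Type*} [NormedAddCommGroup H] [NormedSpace ℂ H]
    [CompleteSpace H] {A : ℝ → H →L[ℂ] H} (hA : Continuous A) {M : ℝ} (hM : ∀ t, ‖A t‖ ≤ M)
    (t₀ : ℝ) : ∃ Y : ℝ → H →L[ℂ] H, Y t₀ = 1 ∧
      ∀ t f, HasDerivAt (fun τ => Y τ f) (A t (Y t f)) t := by
  obtain ⟨Y, h0, hY⟩ := exists_linear_ode hA hM t₀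
  refine ⟨Y, h0, fun t f => ?_⟩
  exact ((ContinuousLinearMap.apply ℂ H f).restrictScalars ℝ).hasFDerivAt.comp_hasDerivAt t (hY t)

end LinearODE

/-! ### Energy estimates -/

section Energy

variable {H : Type*} [NormedAddCommGroup H] [InnerProductSpace ℂ H]

lemma hasDerivWithinAt_norm_sq {y : ℝ → H} {y' : H} {s : Set ℝ} {t : ℝ}
    (h : HasDerivWithinAt y y' s t) :
    HasDerivWithinAt (fun τ => ‖y τ‖ ^ 2) (2 * (inner ℂ y' (y t)).re) s t := by
  have h1 := h.inner ℂ h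
  have h2 := Complex.reCLM.hasFDerivAt.comp_hasDerivWithinAt t h1
  have e1 : (fun τ => ‖y τ‖ ^ 2) = Complex.reCLM ∘ fun τ => inner ℂ (y τ) (y τ) := by
    ext τ
    simp only [Function.comp, Complex.reCLM_apply]
    exact (inner_self_eq_norm_sq (𝕜 := ℂ) (y τ)).symm
  rw [e1]
  refine h2.congr_deriv ?_
  have : (inner ℂ (y t) y').re = (inner ℂ y' (y t)).re := inner_re_symm (𝕜 := ℂ) _ _
  rw [Complex.reCLM_apply, Complex.add_re, this]
  ring

lemma eq_of_hasDerivWithinAt_zero {f : ℝ → ℝ} {I : Set ℝ} (hI : I.OrdConnected)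
    (hf : ∀ t ∈ I, HasDerivWithinAt f 0 I t) {a b : ℝ} (ha : a ∈ I) (hb : b ∈ I) : f a = f b := by
  have := hI.convex.norm_image_sub_le_of_norm_hasDerivWithin_le (C := 0) hf (by simp) hb ha
  rw [zero_mul, norm_le_zero_iff, sub_eq_zero] at this
  exact this

/-- The derivative of `‖y‖²` is `2 Re ⟨y', y⟩`. The same fact gives conservation of the norm and,
applied to differences of solutions, uniqueness. -/
lemma norm_eq_of_skew {y y' : ℝ → H} {I : Set ℝ} (hI : I.OrdConnected)
    (hy : ∀ t ∈ I, HasDerivWithinAt y (y' t) I t) (hs : ∀ t ∈ I, (inner ℂ (y' t) (y t)).re = 0)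
    {a b : ℝ} (ha : a ∈ I) (hb : b ∈ I) : ‖y a‖ = ‖y b‖ := by
  have := eq_of_hasDerivWithinAt_zero hI (f := fun t => ‖y t‖ ^ 2) (fun t ht => by
    simpa [hs t ht] using hasDerivWithinAt_norm_sq (hy t ht)) ha hb
  exact (sq_eq_sq₀ (norm_nonneg _) (norm_nonneg _)).1 this

/-- Gronwall in both time directions: `f e^{-ct}` decreases and `f e^{ct}` increases. -/
lemma growth_bound {f f' : ℝ → ℝ} {c : ℝ} (hf : ∀ t, HasDerivAt f (f' t) t)
    (hb : ∀ t, |f' t| ≤ c * f t) (t₀ t : ℝ) :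
    f t ≤ f t₀ * Real.exp (c * |t - t₀|) := by
  rcases le_total t₀ t with h | h
  · have hd : ∀ x, HasDerivAt (fun x => f x * Real.exp (-(c * x)))
        (f' x * Real.exp (-(c * x)) + f x * (Real.exp (-(c * x)) * -(c * 1))) x := fun x =>
      (hf x).mul (((hasDerivAt_id x).const_mul c).neg.exp)
    have hanti := antitone_of_hasDerivAt_nonpos hd (fun x => by
      have := (le_abs_self _).trans (hb x)
      have hp := Real.exp_pos (-(c * x))
      change _ ≤ (0 : ℝ)
      nlinarith)
    have := hanti h
    simp only at this
    rw [abs_of_nonneg (sub_nonneg.2 h), mul_sub, sub_eq_add_neg, Real.exp_add]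
    have hp := Real.exp_pos (c * t)
    calc f t = (f t * Real.exp (-(c * t))) * Real.exp (c * t) := by
          rw [mul_assoc, ← Real.exp_add]; simp
      _ ≤ _ := by
          rw [mul_comm (Real.exp (c * t)), ← mul_assoc]
          exact mul_le_mul_of_nonneg_right this hp.le
  · have hd : ∀ x, HasDerivAt (fun x => f x * Real.exp (c * x))
        (f' x * Real.exp (c * x) + f x * (Real.exp (c * x) * (c * 1))) x := fun x =>
      (hf x).mul (((hasDerivAt_id x).const_mul c).exp)
    have hmono := monotone_of_hasDerivAt_nonneg hd (fun x => by
      have := (neg_le_abs _).trans (hb x)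
      have hp := Real.exp_pos (c * x)
      change (0 : ℝ) ≤ _
      nlinarith)
    have := hmono h
    simp only at this
    rw [abs_of_nonpos (sub_nonpos.2 h), neg_sub, mul_sub, sub_eq_add_neg, Real.exp_add]
    have hp := Real.exp_pos (-(c * t))
    calc f t = (f t * Real.exp (c * t)) * Real.exp (-(c * t)) := by
          rw [mul_assoc, ← Real.exp_add]; simp
      _ ≤ _ := by
          rw [← mul_assoc]
          exact mul_le_mul_of_nonneg_right this hp.le

lemma norm_growth_bound {y y' : ℝ → H} {c : ℝ} (hy : ∀ t, HasDerivAt y (y' t) t)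
    (hb : ∀ t, |(inner ℂ (y' t) (y t)).re| ≤ c * ‖y t‖ ^ 2) (t₀ t : ℝ) :
    ‖y t‖ ≤ ‖y t₀‖ * Real.exp (c * |t - t₀|) := by
  have h := growth_bound (f := fun t => ‖y t‖ ^ 2) (c := 2 * c)
    (fun t => hasDerivWithinAt_univ.1 (hasDerivWithinAt_norm_sq (hy t).hasDerivWithinAt))
    (fun t => by rw [abs_mul, abs_two]; nlinarith [hb t]) t₀ t
  refine (pow_le_pow_iff_left₀ (norm_nonneg _) (by positivity) two_ne_zero).1 ?_
  rw [mul_pow, ← Real.exp_nat_mul]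
  refine h.trans (le_of_eq ?_)
  push_cast
  ring_nf

/-- Only the pairing of `y'` with `y` has to be small, not `y'` itself. This matters for differences
of truncated flows, whose derivative is small only in a negative norm. -/
lemma norm_sq_le_of_deriv {y y' : ℝ → H} {ε T t₀ : ℝ} (hT : 0 ≤ T) (h0 : y t₀ = 0)
    (hy : ∀ t, HasDerivAt y (y' t) t)
    (hb : ∀ t, |t - t₀| ≤ T → |(inner ℂ (y' t) (y t)).re| ≤ ε) {t : ℝ} (ht : |t - t₀| ≤ T) :
    ‖y t‖ ^ 2 ≤ 2 * ε * T := by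
  have hε : 0 ≤ ε := (abs_nonneg _).trans (hb t ht)
  have := (convex_closedBall t₀ T).norm_image_sub_le_of_norm_hasDerivWithin_le
    (f := fun t => ‖y t‖ ^ 2) (C := 2 * ε) (fun x hx => hasDerivWithinAt_norm_sq (hy x).hasDerivWithinAt)
    (fun x hx => by
      rw [Real.norm_eq_abs, abs_mul, abs_two]
      have := hb x (by simpa [Real.dist_eq] using hx)
      linarith) (Metric.mem_closedBall_self hT)
      (show t ∈ Metric.closedBall t₀ T by simpa [Real.dist_eq] using ht)
  simp only [h0, norm_zero] at this
  rw [Real.norm_eq_abs, Real.norm_eq_abs] at this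
  calc ‖y t‖ ^ 2 ≤ |‖y t‖ ^ 2 - 0 ^ 2| := by simp
    _ ≤ 2 * ε * |t - t₀| := this
    _ ≤ _ := by gcongr

end Energy

/-! ### Polynomial weights -/

/-- The weight `(1 + |k|)^p` on `ℤ`. -/
def om (p : ℝ) (k : ℤ) : ℝ := (1 + |(k : ℝ)|) ^ p

/-- The weight `(1 + n)^q` on `ℕ`. -/
def wt (q : ℝ) (n : ℕ) : ℝ := (1 + (n : ℝ)) ^ q

lemma one_le_om {p : ℝ} (hp : 0 ≤ p) (k : ℤ) : 1 ≤ om p k :=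
  Real.one_le_rpow (by linarith [abs_nonneg (k : ℝ)]) hp

lemma om_pos (p : ℝ) (k : ℤ) : 0 < om p k := Real.rpow_pos_of_pos (by positivity) _

lemma wt_pos (q : ℝ) (n : ℕ) : 0 < wt q n := Real.rpow_pos_of_pos (by positivity) _

lemma one_le_wt {q : ℝ} (hq : 0 ≤ q) (n : ℕ) : 1 ≤ wt q n :=
  Real.one_le_rpow (by linarith [(Nat.cast_nonneg n : (0:ℝ) ≤ n)]) hq

lemma wt_zero (n : ℕ) : wt 0 n = 1 := Real.rpow_zero _

lemma wt_one (n : ℕ) : wt 1 n = 1 + n := Real.rpow_one _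

lemma wt_add (q r : ℝ) (n : ℕ) : wt (q + r) n = wt q n * wt r n :=
  Real.rpow_add (by positivity) _ _

lemma abs_inv_wt_le {q : ℝ} (hq : 0 ≤ q) (n : ℕ) : |(wt q n)⁻¹| ≤ 1 := by
  rw [abs_of_pos (inv_pos.2 (wt_pos q n))]
  exact inv_le_one_of_one_le₀ (one_le_wt hq n)

lemma le_mul_one_add_abs {a b : ℝ} (hb : 1 ≤ b) : a ≤ b * (1 + |a - b|) := by
  have h1 := le_abs_self (a - b)
  have h2 := mul_le_mul_of_nonneg_right hb (abs_nonneg (a - b))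
  linarith

lemma cast_sub_eq (n m : ℕ) : (((n : ℤ) - m : ℤ) : ℝ) = (1 + (n : ℝ)) - (1 + m) := by
  push_cast; ring

/-- A Peetre-type inequality: `a ≤ b (1 + |a - b|)` for `b ≥ 1`. It lets a weighted Toeplitz kernel
be dominated by a convolution kernel. -/
lemma wt_div_le {q p : ℝ} (hq : 0 ≤ q) (hqp : q ≤ p) (n m : ℕ) :
    wt q n / wt q m ≤ om p ((n : ℤ) - m) := by
  have hm : (1 : ℝ) ≤ 1 + m := by linarith [(Nat.cast_nonneg m : (0:ℝ) ≤ m)]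
  unfold wt om
  rw [← Real.div_rpow (by positivity) (by positivity), cast_sub_eq]
  calc ((1 + (n : ℝ)) / (1 + m)) ^ q ≤ (1 + |(1 + (n : ℝ)) - (1 + m)|) ^ q := by
        refine Real.rpow_le_rpow (by positivity) ?_ hq
        rw [div_le_iff₀' (by positivity)]
        exact le_mul_one_add_abs hm
    _ ≤ _ := Real.rpow_le_rpow_of_exponent_le (by linarith [abs_nonneg ((1 + (n : ℝ)) - (1 + m))]) hqp

/-- Bernoulli's inequality plays the role of the mean value theorem. For `a ≥ b`, applied to `b /
a`, it gives `(a/b)^q - 1 ≤ (a/b)^q q (a-b)/a`; the factor `b` removes one power of `a/b`, and the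
rest satisfies `(a/b)^(q-1) ≤ (1+|a-b|)^(q-1)`. For `a ≤ b` it is applied to `a / b`. The constant
`2` comes from `q ≤ 2`. -/
lemma abs_rpow_div_sub_one_mul_min_le {q a b : ℝ} (h1 : 1 ≤ q) (h2 : q ≤ 2) (ha : 1 ≤ a)
    (hb : 1 ≤ b) : |(a / b) ^ q - 1| * min a b ≤ 2 * (1 + |a - b|) ^ q := by
  have ha0 : 0 < a := by linarith
  have hb0 : 0 < b := by linarith
  have hq0 : 0 < q := by linarith
  rcases le_total b a with h | h
  · have hr : 1 ≤ a / b := (one_le_div hb0).2 h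
    have hk : |a - b| = a - b := abs_of_nonneg (sub_nonneg.2 h)
    rw [min_eq_right h, abs_of_nonneg (sub_nonneg.2 (Real.one_le_rpow hr hq0.le)), hk]
    have hB := one_add_mul_self_le_rpow_one_add (s := b / a - 1) (by
      have : 0 < b / a := by positivity
      linarith) h1
    rw [add_sub_cancel] at hB
    have hpos : 0 < (a / b) ^ q := Real.rpow_pos_of_pos (by positivity) _
    have hinv : (b / a) ^ q * (a / b) ^ q = 1 := by
      rw [← Real.mul_rpow (by positivity) (by positivity)]
      rw [div_mul_div_comm, mul_comm b a, div_self (by positivity), Real.one_rpow]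
    have hC : (a / b) ^ q - 1 ≤ (a / b) ^ q * (q * (a - b) / a) := by
      have := mul_le_mul_of_nonneg_right hB hpos.le
      rw [hinv] at this
      have e : q * (b / a - 1) = - (q * (a - b) / a) := by field_simp; ring
      rw [e] at this
      linarith
    have hsplit : (a / b) ^ q = (a / b) ^ (q - 1) * (a / b) := by
      rw [← Real.rpow_add_one (by positivity)]; ring_nf
    calc ((a / b) ^ q - 1) * b ≤ (a / b) ^ q * (q * (a - b) / a) * b :=
          mul_le_mul_of_nonneg_right hC hb0.le
      _ = (a / b) ^ (q - 1) * (q * (a - b)) := by rw [hsplit]; field_simp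
      _ ≤ (1 + (a - b)) ^ (q - 1) * (2 * (1 + (a - b))) := by
          have h3 : a / b ≤ 1 + (a - b) := by
            rw [div_le_iff₀' hb0]
            have := le_mul_one_add_abs (a := a) hb
            rwa [hk] at this
          have h4 : 0 ≤ a - b := by linarith
          refine mul_le_mul (Real.rpow_le_rpow (by positivity) h3 (by linarith)) ?_
            (by positivity) (by positivity)
          nlinarith
      _ = 2 * (1 + (a - b)) ^ q := by
          have h4 : 0 < 1 + (a - b) := by linarith
          have : (1 + (a - b)) ^ q = (1 + (a - b)) ^ (q - 1) * (1 + (a - b)) := by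
            rw [← Real.rpow_add_one h4.ne']; ring_nf
          rw [this]; ring
  · have hr : a / b ≤ 1 := (div_le_one hb0).2 h
    have hk : |a - b| = b - a := by rw [abs_of_nonpos (by linarith)]; ring
    rw [min_eq_left h, abs_of_nonpos (sub_nonpos.2 (Real.rpow_le_one (by positivity) hr hq0.le)), hk]
    have hB := one_add_mul_self_le_rpow_one_add (s := a / b - 1) (by
      have : 0 < a / b := by positivity
      linarith) h1
    rw [add_sub_cancel] at hB
    have h4 : 0 ≤ b - a := by linarith
    calc -((a / b) ^ q - 1) * a ≤ (q * (b - a) / b) * a := by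
          refine mul_le_mul_of_nonneg_right ?_ ha0.le
          have e : q * (a / b - 1) = - (q * (b - a) / b) := by field_simp; ring
          rw [e] at hB
          linarith
      _ = q * (b - a) * (a / b) := by ring
      _ ≤ (2 * (b - a)) * 1 := by gcongr
      _ ≤ 2 * (1 + (b - a)) ^ (1 : ℝ) := by rw [Real.rpow_one]; linarith
      _ ≤ 2 * (1 + (b - a)) ^ q := by
          gcongr
          linarith

/-- The truncated minimum `min(n, m, N)`. -/
def tmin (N n m : ℕ) : ℝ := ((min (min n m) N : ℕ) : ℝ)

lemma tmin_nonneg (N n m : ℕ) : 0 ≤ tmin N n m := Nat.cast_nonneg _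

lemma tmin_le (N n m : ℕ) : tmin N n m ≤ N := by
  unfold tmin; exact_mod_cast min_le_right _ _

lemma tmin_le_left (N n m : ℕ) : tmin N n m ≤ n := by
  unfold tmin; exact_mod_cast (min_le_left _ _).trans (min_le_left _ _)

lemma tmin_le_right (N n m : ℕ) : tmin N n m ≤ m := by
  unfold tmin; exact_mod_cast (min_le_left _ _).trans (min_le_right _ _)

/-- The commutator of the first-order kernel with the weight has order zero: the factor `min(n, m)`
is absorbed by the variation of the weight between `n` and `m`. The bound does not depend on `N`,
which makes all weighted energy estimates uniform. -/
lemma commutator_bound {q p : ℝ} (hq : q = 0 ∨ 1 ≤ q) (hqp : q ≤ p) (hp : p ≤ 2) (N n m : ℕ) :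
    |(wt q n / wt q m - 1) * tmin N n m| ≤ 2 * om p ((n : ℤ) - m) := by
  rcases hq with rfl | hq
  · rw [wt_zero, wt_zero]
    simpa using (om_pos p _).le
  · have hn1 : (1 : ℝ) ≤ 1 + n := by linarith [(Nat.cast_nonneg n : (0:ℝ) ≤ n)]
    have hm1 : (1 : ℝ) ≤ 1 + m := by linarith [(Nat.cast_nonneg m : (0:ℝ) ≤ m)]
    rw [abs_mul, abs_of_nonneg (tmin_nonneg N n m)]
    unfold wt om
    rw [← Real.div_rpow (by positivity) (by positivity), cast_sub_eq]
    calc _ ≤ |((1 + (n : ℝ)) / (1 + m)) ^ q - 1| * min (1 + (n : ℝ)) (1 + m) := by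
          refine mul_le_mul_of_nonneg_left (le_min ?_ ?_) (abs_nonneg _)
          · linarith [tmin_le_left N n m]
          · linarith [tmin_le_right N n m]
      _ ≤ 2 * (1 + |(1 + (n : ℝ)) - (1 + m)|) ^ q :=
          abs_rpow_div_sub_one_mul_min_le hq (hqp.trans hp) hn1 hm1
      _ ≤ _ := by
          gcongr
          linarith [abs_nonneg ((1 + (n : ℝ)) - (1 + m))]

/-- The two truncations differ only if both indices exceed `M`. One weight then supplies `1 / (M +
1)`, and the other absorbs the difference of the minima. -/
lemma tmin_diff_bound {M N : ℕ} (hMN : M ≤ N) (n m : ℕ) :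
    |(wt 1 n)⁻¹ * (tmin N n m - tmin M n m) * (wt 1 m)⁻¹| ≤ 1 / (M + 1) := by
  rw [wt_one, wt_one, abs_mul, abs_mul, abs_of_pos (by positivity : (0:ℝ) < (1 + (n : ℝ))⁻¹),
    abs_of_pos (by positivity : (0:ℝ) < (1 + (m : ℝ))⁻¹)]
  by_cases h : n ≤ M ∨ m ≤ M
  · have : tmin N n m = tmin M n m := by
      unfold tmin
      congr 1
      omega
    rw [this, sub_self, abs_zero, mul_zero, zero_mul]
    positivity
  · push Not at h
    have h1 : |tmin N n m - tmin M n m| ≤ 1 + m := by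
      have a1 := tmin_le_right N n m
      have a2 := tmin_le_right M n m
      have a3 := tmin_nonneg N n m
      have a4 := tmin_nonneg M n m
      rw [abs_le]; constructor <;> linarith
    have h2 : (1 + (n : ℝ))⁻¹ ≤ 1 / (M + 1) := by
      rw [inv_eq_one_div]
      have : (M : ℝ) < n := by exact_mod_cast h.1
      exact one_div_le_one_div_of_le (by positivity) (by linarith)
    calc _ ≤ 1 / ((M : ℝ) + 1) * (1 + m) * (1 + (m : ℝ))⁻¹ := by gcongr
      _ = _ := by field_simp

/-! ### Truncated Lax operators and their weighted propagators -/

section Approx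

variable {E : Type*} [NormedAddCommGroup E] [InnerProductSpace ℂ E] [CompleteSpace E]

/-- The weighted Wiener norm `∑ (1 + |k|)^p ‖u k‖`. -/
def wn (p : ℝ) (u : ℤ → E →L[ℂ] E) : ℝ := ∑' k, om p k * ‖u k‖

/-- Finiteness of the weighted Wiener norm. -/
def WFin (p : ℝ) (u : ℤ → E →L[ℂ] E) : Prop := Summable fun k => om p k * ‖u k‖

lemma WFin.sub {p : ℝ} {u v : ℤ → E →L[ℂ] E} (hu : WFin p u) (hv : WFin p v) :
    WFin p (u - v) := by
  refine Summable.of_nonneg_of_le (fun k => mul_nonneg (om_pos p k).le (norm_nonneg _))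
    (fun k => ?_) (hu.add hv)
  rw [← mul_add]
  exact mul_le_mul_of_nonneg_left (norm_sub_le _ _) (om_pos p k).le

lemma wn_nonneg (p : ℝ) (u : ℤ → E →L[ℂ] E) : 0 ≤ wn p u :=
  tsum_nonneg fun k => mul_nonneg (om_pos p k).le (norm_nonneg _)

lemma WFin.dominated {p C : ℝ} {u : ℤ → E →L[ℂ] E} (hu : WFin p u) {φ : ℕ → ℕ → ℝ}
    (hφ : ∀ n m : ℕ, |φ n m| ≤ C * om p ((n : ℤ) - m)) :
    Dominated (mker φ u) (fun k => C * om p k * ‖u k‖) :=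
  dominated_mker (κ := fun k => C * om p k) hφ (by
    simpa only [mul_assoc] using Summable.mul_left C hu)

lemma WFin.norm_mulOp_le {p C : ℝ} {u : ℤ → E →L[ℂ] E} (hu : WFin p u) {φ : ℕ → ℕ → ℝ}
    (hφ : ∀ n m : ℕ, |φ n m| ≤ C * om p ((n : ℤ) - m)) : ‖mulOp φ u‖ ≤ C * wn p u := by
  refine (norm_kerOp_le (hu.dominated hφ)).trans (le_of_eq ?_)
  unfold wn
  simp only [mul_assoc]
  rw [tsum_mul_left]

lemma WFin.mulOp_sub_right {p C : ℝ} {u v : ℤ → E →L[ℂ] E} (hu : WFin p u) (hv : WFin p v)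
    {φ : ℕ → ℕ → ℝ} (hφ : ∀ n m : ℕ, |φ n m| ≤ C * om p ((n : ℤ) - m)) :
    mulOp φ (u - v) = mulOp φ u - mulOp φ v := by
  unfold mulOp
  rw [← kerOp_sub (hu.dominated hφ) (hv.dominated hφ)]
  congr 1
  ext n m : 2
  simp [mker, smul_sub]

lemma WFin.mulOp_sub_left {p C D : ℝ} {u : ℤ → E →L[ℂ] E} (hu : WFin p u)
    {φ ψ : ℕ → ℕ → ℝ} (hφ : ∀ n m : ℕ, |φ n m| ≤ C * om p ((n : ℤ) - m))
    (hψ : ∀ n m : ℕ, |ψ n m| ≤ D * om p ((n : ℤ) - m)) :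
    mulOp (fun n m => φ n m - ψ n m) u = mulOp φ u - mulOp ψ u := by
  unfold mulOp
  rw [← kerOp_sub (hu.dominated hφ) (hu.dominated hψ)]
  congr 1
  ext n m : 2
  simp [mker, sub_smul]

lemma WFin.wtOp_mulOp {p C D B : ℝ} {u : ℤ → E →L[ℂ] E} (hu : WFin p u)
    {φ ψ : ℕ → ℕ → ℝ} {w : ℕ → ℝ} (hw : ∀ n, |w n| ≤ B)
    (hφ : ∀ n m : ℕ, |φ n m| ≤ C * om p ((n : ℤ) - m))
    (hψ : ∀ n m : ℕ, |ψ n m| ≤ D * om p ((n : ℤ) - m)) (h : ∀ n m, w n * φ n m = ψ n m) :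
    wtOp w ∘L mulOp φ u = mulOp ψ u :=
  wtOp_comp_kerOp hw (hu.dominated hφ) (hu.dominated hψ) fun n m => by
    unfold mker
    rw [smul_smul, ← Complex.ofReal_mul, h]

lemma WFin.mulOp_wtOp {p C D B : ℝ} {u : ℤ → E →L[ℂ] E} (hu : WFin p u)
    {φ ψ : ℕ → ℕ → ℝ} {w : ℕ → ℝ} (hw : ∀ n, |w n| ≤ B)
    (hφ : ∀ n m : ℕ, |φ n m| ≤ C * om p ((n : ℤ) - m))
    (hψ : ∀ n m : ℕ, |ψ n m| ≤ D * om p ((n : ℤ) - m)) (h : ∀ n m, φ n m * w m = ψ n m) :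
    mulOp φ u ∘L wtOp w = mulOp ψ u :=
  kerOp_comp_wtOp hw (hu.dominated hφ) (hu.dominated hψ) fun n m => by
    unfold mker
    rw [smul_smul, ← Complex.ofReal_mul, mul_comm, h]

/-- The symmetry `u(-k) = u(k)^*` of the Fourier coefficients of a self-adjoint symbol. -/
def IsSymm (u : ℤ → E →L[ℂ] E) : Prop := ∀ k x y, inner ℂ (u k x) y = inner ℂ x (u (-k) y)

lemma IsSymm.inner_mulOp {p C : ℝ} {u : ℤ → E →L[ℂ] E} (hs : IsSymm u) (hu : WFin p u)
    {φ : ℕ → ℕ → ℝ} (hφ : ∀ n m : ℕ, |φ n m| ≤ C * om p ((n : ℤ) - m))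
    (hsym : ∀ n m, φ n m = φ m n) (f g : Seq E) :
    inner ℂ (mulOp φ u f) g = inner ℂ f (mulOp φ u g) := by
  refine inner_kerOp (hu.dominated hφ) (hu.dominated hφ) (fun n m x y => ?_) f g
  unfold mker
  rw [smul_apply, smul_apply, inner_smul_left,
    inner_smul_right, hs, Complex.conj_ofReal, hsym, neg_sub]

lemma IsSymm.re_inner_mulOp {p C : ℝ} {u : ℤ → E →L[ℂ] E} (hs : IsSymm u) (hu : WFin p u)
    {φ : ℕ → ℕ → ℝ} (hφ : ∀ n m : ℕ, |φ n m| ≤ C * om p ((n : ℤ) - m))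
    (hsym : ∀ n m, φ n m = φ m n) (f : Seq E) :
    (inner ℂ ((-Complex.I) • mulOp φ u f) f).re = 0 := by
  have h1 := hs.inner_mulOp hu hφ hsym f f
  have h2 : (inner ℂ (mulOp φ u f) f).im = 0 := by
    rw [← Complex.conj_eq_iff_im, inner_conj_symm, ← h1]
  rw [inner_smul_left]
  simp [h2]

/-- A bounded continuous curve, defined for all times, of self-adjoint symbols. -/
structure SymCurve (p M : ℝ) (u : ℝ → ℤ → E →L[ℂ] E) : Prop where
  fin : ∀ t, WFin p (u t)
  bound : ∀ t, wn p (u t) ≤ M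
  cont : ∀ t₀, Tendsto (fun t => wn p (u t - u t₀)) (𝓝 t₀) (𝓝 0)
  symm : ∀ t, IsSymm (u t)

lemma continuous_mulOp {p M C : ℝ} {u : ℝ → ℤ → E →L[ℂ] E} (hu : SymCurve p M u)
    {φ : ℕ → ℕ → ℝ} (hφ : ∀ n m : ℕ, |φ n m| ≤ C * om p ((n : ℤ) - m)) :
    Continuous fun t => mulOp φ (u t) := by
  rw [continuous_iff_continuousAt]
  intro t₀
  rw [ContinuousAt, tendsto_iff_norm_sub_tendsto_zero]
  refine squeeze_zero (fun _ => norm_nonneg _) (fun t => ?_)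
    (by simpa using (hu.cont t₀).const_mul C)
  rw [← (hu.fin t).mulOp_sub_right (hu.fin t₀) hφ]
  exact ((hu.fin t).sub (hu.fin t₀)).norm_mulOp_le hφ

/-- The weighted truncated multiplier `(1+n)^q (1+m)^{-q} min(n, m, N)`. -/
def wmin (q : ℝ) (N n m : ℕ) : ℝ := wt q n / wt q m * tmin N n m

/-- The truncated Lax operator `-i (min(n, m, N) u(n - m))`, conjugated by `(1+n)^q`. -/
def apxOp (q : ℝ) (N : ℕ) (u : ℤ → E →L[ℂ] E) : Seq E →L[ℂ] Seq E :=
  (-Complex.I) • mulOp (wmin q N) u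

lemma wmin_zero (N n m : ℕ) : wmin 0 N n m = tmin N n m := by
  simp [wmin, wt_zero]

lemma abs_tmin_le {p : ℝ} (hp : 0 ≤ p) (N n m : ℕ) :
    |tmin N n m| ≤ N * om p ((n : ℤ) - m) := by
  rw [abs_of_nonneg (tmin_nonneg N n m)]
  have h1 := tmin_le N n m
  have h2 := one_le_om hp ((n : ℤ) - m)
  have h3 : (0 : ℝ) ≤ N := Nat.cast_nonneg N
  nlinarith

lemma abs_wmin_le {q p : ℝ} (hq : 0 ≤ q) (hqp : q ≤ p) (N n m : ℕ) :
    |wmin q N n m| ≤ N * om p ((n : ℤ) - m) := by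
  unfold wmin
  have h0 : 0 ≤ wt q n / wt q m := (div_pos (wt_pos q n) (wt_pos q m)).le
  rw [abs_of_nonneg (mul_nonneg h0 (tmin_nonneg N n m)), mul_comm]
  exact mul_le_mul (tmin_le N n m) (wt_div_le hq hqp n m) h0 (Nat.cast_nonneg N)

lemma tmin_symm (N n m : ℕ) : tmin N n m = tmin N m n := by
  unfold tmin; rw [min_comm n m]

lemma re_inner_apxOp_zero {p : ℝ} (hp : 0 ≤ p) {u : ℤ → E →L[ℂ] E} (hu : WFin p u)
    (hs : IsSymm u) (N : ℕ) (f : Seq E) : (inner ℂ (apxOp 0 N u f) f).re = 0 :=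
  hs.re_inner_mulOp hu (abs_wmin_le le_rfl hp N)
    (fun n m => by rw [wmin_zero, wmin_zero, tmin_symm]) f

/-- The conjugated operator is the skew operator with `q = 0` plus a commutator, and only the
commutator contributes to the real part. -/
lemma abs_re_inner_apxOp_le {q p : ℝ} (hq : q = 0 ∨ 1 ≤ q) (hqp : q ≤ p) (hp2 : p ≤ 2)
    {u : ℤ → E →L[ℂ] E} (hu : WFin p u) (hs : IsSymm u) (N : ℕ) (f : Seq E) :
    |(inner ℂ (apxOp q N u f) f).re| ≤ 2 * wn p u * ‖f‖ ^ 2 := by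
  have hq0 : 0 ≤ q := by rcases hq with rfl | hq <;> linarith
  have hp0 : 0 ≤ p := hq0.trans hqp
  have hb := commutator_bound (p := p) hq hqp hp2 N
  have hdec : mulOp (fun n m => (wt q n / wt q m - 1) * tmin N n m) u
      = mulOp (wmin q N) u - mulOp (wmin 0 N) u := by
    rw [← hu.mulOp_sub_left (abs_wmin_le hq0 hqp N) (abs_wmin_le le_rfl hp0 N)]
    congr 1
    ext n m
    rw [wmin_zero, wmin]; ring
  have h1 : apxOp q N u f = apxOp 0 N u f
      + (-Complex.I) • mulOp (fun n m => (wt q n / wt q m - 1) * tmin N n m) u f := by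
    rw [hdec]
    simp only [apxOp, smul_apply, sub_apply, smul_sub]
    abel
  rw [h1, inner_add_left, Complex.add_re, re_inner_apxOp_zero hp0 hu hs, zero_add]
  refine (Complex.abs_re_le_norm _).trans ((norm_inner_le_norm _ _).trans ?_)
  rw [norm_smul, norm_neg, Complex.norm_I, one_mul, sq, ← mul_assoc]
  exact mul_le_mul_of_nonneg_right ((ContinuousLinearMap.le_opNorm _ _).trans
    (mul_le_mul_of_nonneg_right (hu.norm_mulOp_le hb) (norm_nonneg _))) (norm_nonneg _)

/-- The operator `(1+n)^{-q}`. -/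
def iw (q : ℝ) : Seq E →L[ℂ] Seq E := wtOp fun n => (wt q n)⁻¹

lemma iw_apply {q : ℝ} (hq : 0 ≤ q) (f : Seq E) (n : ℕ) :
    iw q f n = (((wt q n)⁻¹ : ℝ) : ℂ) • f n := wtOp_apply (abs_inv_wt_le hq) f n

lemma iw_add {q r : ℝ} (hq : 0 ≤ q) (hr : 0 ≤ r) (f : Seq E) : iw (q + r) f = iw q (iw r f) := by
  ext n
  rw [iw_apply (add_nonneg hq hr), iw_apply hq, iw_apply hr, smul_smul, wt_add, mul_inv,
    Complex.ofReal_mul]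

lemma iw_denseRange {q : ℝ} (hq : 0 ≤ q) : DenseRange (iw q : Seq E →L[ℂ] Seq E) :=
  wtOp_denseRange (abs_inv_wt_le hq) fun n => (inv_pos.2 (wt_pos q n)).ne'

lemma iw_injective {q : ℝ} (hq : 0 ≤ q) : Function.Injective (iw q : Seq E →L[ℂ] Seq E) :=
  wtOp_injective (abs_inv_wt_le hq) fun n => (inv_pos.2 (wt_pos q n)).ne'

/-- Both sides have the multiplier `(1+m)^{-q} min(n, m, N)`. Conjugation by the weight is thus
expressed without its unbounded inverse. -/
lemma iw_apxOp {q p : ℝ} (hq : 0 ≤ q) (hqp : q ≤ p) {u : ℤ → E →L[ℂ] E} (hu : WFin p u)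
    (N : ℕ) (f : Seq E) : iw q (apxOp q N u f) = apxOp 0 N u (iw q f) := by
  have hp0 : 0 ≤ p := hq.trans hqp
  have hb : ∀ n m : ℕ, |(wt q m)⁻¹ * tmin N n m| ≤ N * om p ((n : ℤ) - m) := fun n m => by
    rw [abs_mul]
    have h1 := abs_inv_wt_le hq m
    have h2 := abs_tmin_le hp0 N n m
    nlinarith [abs_nonneg (tmin N n m)]
  have h1 := hu.wtOp_mulOp (abs_inv_wt_le hq) (abs_wmin_le hq hqp N) hb (fun n m => by
    unfold wmin
    have := (wt_pos q n).ne'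
    field_simp)
  have h2 := hu.mulOp_wtOp (abs_inv_wt_le hq) (abs_wmin_le le_rfl hp0 N) hb (fun n m => by
    rw [wmin_zero, mul_comm])
  have h3 := h1.trans h2.symm
  have h4 := congrArg (fun A : Seq E →L[ℂ] Seq E => A f) h3
  simp only [ContinuousLinearMap.comp_apply] at h4
  unfold apxOp iw
  rw [smul_apply, smul_apply, map_smul, h4]

/-- The propagators of the truncated Lax operators, conjugated by `(1+n)^q`. -/
structure IsApx (u : ℝ → ℤ → E →L[ℂ] E) (t₀ : ℝ) (X : ℝ → ℕ → ℝ → Seq E →L[ℂ] Seq E)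
    (q : ℝ) : Prop where
  init : ∀ N, X q N t₀ = 1
  deriv : ∀ N t f, HasDerivAt (fun τ => X q N τ f) (apxOp q N (u t) (X q N t f)) t

lemma exists_apx {p M : ℝ} {u : ℝ → ℤ → E →L[ℂ] E} (hu : SymCurve p M u) (t₀ : ℝ) :
    ∃ X : ℝ → ℕ → ℝ → Seq E →L[ℂ] Seq E, ∀ q, 0 ≤ q → q ≤ p → IsApx u t₀ X q := by
  have : ∀ q : ℝ, ∀ N : ℕ, ∃ Y : ℝ → Seq E →L[ℂ] Seq E, 0 ≤ q → q ≤ p →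
      Y t₀ = 1 ∧ ∀ t f, HasDerivAt (fun τ => Y τ f) (apxOp q N (u t) (Y t f)) t := by
    intro q N
    by_cases h : 0 ≤ q ∧ q ≤ p
    · have hc : Continuous fun t => apxOp q N (u t) :=
        (continuous_mulOp hu (abs_wmin_le h.1 h.2 N)).const_smul (-Complex.I)
      -- The bound `N * M` grows with `N`. It serves only for existence; the uniform estimates come
      -- from the energy method.
      obtain ⟨Y, hY⟩ := exists_bounded_propagator hc (M := N * M) (fun t => by
          unfold apxOp
          rw [norm_smul, norm_neg, Complex.norm_I, one_mul]
          exact ((hu.fin t).norm_mulOp_le (abs_wmin_le h.1 h.2 N)).trans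
            (mul_le_mul_of_nonneg_left (hu.bound t) (Nat.cast_nonneg N))) t₀
      exact ⟨Y, fun _ _ => hY⟩
    · exact ⟨0, fun h1 h2 => (h ⟨h1, h2⟩).elim⟩
  choose X hX using this
  exact ⟨X, fun q h1 h2 => ⟨fun N => (hX q N h1 h2).1, fun N t f => (hX q N h1 h2).2 t f⟩⟩

lemma IsApx.norm_le {p M : ℝ} {u : ℝ → ℤ → E →L[ℂ] E} (hu : SymCurve p M u) {t₀ : ℝ}
    {X : ℝ → ℕ → ℝ → Seq E →L[ℂ] Seq E} {q : ℝ} (hX : IsApx u t₀ X q)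
    (hq : q = 0 ∨ 1 ≤ q) (hqp : q ≤ p) (hp2 : p ≤ 2) (N : ℕ) (t : ℝ) (f : Seq E) :
    ‖X q N t f‖ ≤ ‖f‖ * Real.exp (2 * M * |t - t₀|) := by
  have := norm_growth_bound (c := 2 * M) (hX.deriv N · f) (fun t =>
    (abs_re_inner_apxOp_le hq hqp hp2 (hu.fin t) (hu.symm t) N _).trans (by
      have := hu.bound t
      gcongr)) t₀ t
  simpa [hX.init] using this

lemma IsApx.norm_le_zero {p M : ℝ} (hp : 0 ≤ p) {u : ℝ → ℤ → E →L[ℂ] E} (hu : SymCurve p M u)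
    {t₀ : ℝ} {X : ℝ → ℕ → ℝ → Seq E →L[ℂ] Seq E} (hX : IsApx u t₀ X 0)
    (N : ℕ) (t : ℝ) (f : Seq E) : ‖X 0 N t f‖ = ‖f‖ := by
  have := norm_eq_of_skew (I := univ) ordConnected_univ
    (fun t _ => (hX.deriv N t f).hasDerivWithinAt)
    (fun t _ => re_inner_apxOp_zero hp (hu.fin t) (hu.symm t) N _) (mem_univ t) (mem_univ t₀)
  simpa [hX.init] using this

/-- Both curves solve the skew equation for `q = 0` with the same initial value. Norm bounds on `X
q` are thereby weighted norm bounds on `X 0`. -/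
lemma IsApx.iw_eq {p M : ℝ} {u : ℝ → ℤ → E →L[ℂ] E} (hu : SymCurve p M u) {t₀ : ℝ}
    {X : ℝ → ℕ → ℝ → Seq E →L[ℂ] Seq E} {q : ℝ} (hX : IsApx u t₀ X q) (hX0 : IsApx u t₀ X 0)
    (hq : 0 ≤ q) (hqp : q ≤ p) (N : ℕ) (t : ℝ) (f : Seq E) :
    iw q (X q N t f) = X 0 N t (iw q f) := by
  have hd : ∀ t ∈ univ, HasDerivWithinAt (fun t => iw q (X q N t f) - X 0 N t (iw q f))
      (apxOp 0 N (u t) (iw q (X q N t f) - X 0 N t (iw q f))) univ t := fun t _ => by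
    rw [map_sub, ← iw_apxOp hq hqp (hu.fin t)]
    refine HasDerivAt.hasDerivWithinAt (HasDerivAt.sub ?_ (hX0.deriv N t _))
    exact ((iw q).restrictScalars ℝ).hasFDerivAt.comp_hasDerivAt t (hX.deriv N t f)
  have := norm_eq_of_skew (I := univ) ordConnected_univ hd
    (fun t _ => re_inner_apxOp_zero (hq.trans hqp) (hu.fin t) (hu.symm t) N _)
    (mem_univ t) (mem_univ t₀)
  simp only [hX.init, hX0.init, one_apply_eq_self, sub_self, norm_zero,
    norm_eq_zero, sub_eq_zero] at this
  exact this

end Approx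

/-! ### Strong limits of uniformly bounded families of operators -/

section StrongLimit

variable {H : Type*} [NormedAddCommGroup H] [NormedSpace ℂ H]

lemma uniformCauchySeqOn_of_dense {Z : ℕ → ℝ → H →L[ℂ] H} {s : Set ℝ} {C : ℝ}
    (hC : ∀ N, ∀ t ∈ s, ‖Z N t‖ ≤ C) {D : Set H} (hD : Dense D)
    (h : ∀ x ∈ D, UniformCauchySeqOn (fun N t => Z N t x) atTop s) (x : H) :
    UniformCauchySeqOn (fun N t => Z N t x) atTop s := by
  rw [Metric.uniformCauchySeqOn_iff]
  intro ε hε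
  have hC1 : 0 < |C| + 1 := by positivity
  obtain ⟨y, hy, hxy⟩ := hD.exists_dist_lt x (show 0 < ε / (4 * (|C| + 1)) by positivity)
  obtain ⟨N₀, hN⟩ := Metric.uniformCauchySeqOn_iff.1 (h y hy) (ε / 2) (by positivity)
  have hb : ∀ N, ∀ t ∈ s, dist (Z N t x) (Z N t y) ≤ ε / 4 := fun N t ht => by
    rw [dist_eq_norm, ← map_sub]
    calc ‖Z N t (x - y)‖ ≤ (|C| + 1) * (ε / (4 * (|C| + 1))) := by
          refine (ContinuousLinearMap.le_opNorm _ _).trans (mul_le_mul ?_ ?_ (norm_nonneg _) hC1.le)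
          · linarith [hC N t ht, le_abs_self C]
          · rw [← dist_eq_norm]; exact hxy.le
      _ = ε / 4 := by field_simp
  refine ⟨N₀, fun m hm n hn t ht => ?_⟩
  have h1 := hN m hm n hn t ht
  have h2 := dist_triangle4 (Z m t x) (Z m t y) (Z n t y) (Z n t x)
  have h3 := hb m t ht
  have h4 := hb n t ht
  rw [dist_comm] at h4
  linarith

lemma exists_strong_limit [CompleteSpace H] {Z : ℕ → H →L[ℂ] H} {C : ℝ} (hC : ∀ N x, ‖Z N x‖ ≤ C * ‖x‖)
    (h : ∀ x, CauchySeq fun N => Z N x) :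
    ∃ L : H →L[ℂ] H, (∀ x, ‖L x‖ ≤ C * ‖x‖) ∧ ∀ x, Tendsto (fun N => Z N x) atTop (𝓝 (L x)) := by
  choose f hf using fun x => cauchySeq_tendsto_of_complete (h x)
  have hb : ∀ x, ‖f x‖ ≤ C * ‖x‖ := fun x =>
    le_of_tendsto (hf x).norm (Eventually.of_forall fun N => hC N x)
  refine ⟨LinearMap.mkContinuous
    { toFun := f
      map_add' := fun x y => tendsto_nhds_unique (hf (x + y))
        (by simpa using (hf x).add (hf y))
      map_smul' := fun c x => tendsto_nhds_unique (hf (c • x))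
        (by simpa using (hf x).const_smul c) } C hb, hb, hf⟩

lemma tendsto_apply_of_dense {Z : ℕ → H →L[ℂ] H} {L : H →L[ℂ] H} {C : ℝ} (hC : ∀ N, ‖Z N‖ ≤ C)
    (hL : ‖L‖ ≤ C) {D : Set H} (hD : Dense D)
    (h : ∀ x ∈ D, Tendsto (fun N => Z N x) atTop (𝓝 (L x))) (x : H) :
    Tendsto (fun N => Z N x) atTop (𝓝 (L x)) := by
  rw [Metric.tendsto_atTop]
  intro ε hε
  have hC1 : 0 < |C| + 1 := by positivity
  obtain ⟨y, hy, hxy⟩ := hD.exists_dist_lt x (show 0 < ε / (4 * (|C| + 1)) by positivity)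
  obtain ⟨N₀, hN⟩ := Metric.tendsto_atTop.1 (h y hy) (ε / 2) (by positivity)
  have hb : ∀ A : H →L[ℂ] H, ‖A‖ ≤ C → dist (A x) (A y) ≤ ε / 4 := fun A hA => by
    rw [dist_eq_norm, ← map_sub]
    calc ‖A (x - y)‖ ≤ (|C| + 1) * (ε / (4 * (|C| + 1))) := by
          refine (ContinuousLinearMap.le_opNorm _ _).trans (mul_le_mul ?_ ?_ (norm_nonneg _) hC1.le)
          · linarith [le_abs_self C]
          · rw [← dist_eq_norm]; exact hxy.le
      _ = ε / 4 := by field_simp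
  refine ⟨N₀, fun n hn => ?_⟩
  have h1 := hN n hn
  have h2 := dist_triangle4 (Z n x) (Z n y) (L y) (L x)
  have h3 := hb (Z n) (hC n)
  have h4 := hb L hL
  rw [dist_comm] at h4
  linarith

end StrongLimit

/-! ### Convergence of the truncated propagators -/

section Limit

variable {E : Type*} [NormedAddCommGroup E] [InnerProductSpace ℂ E] [CompleteSpace E]

lemma inner_iw {q : ℝ} (hq : 0 ≤ q) (f g : Seq E) : inner ℂ (iw q f) g = inner ℂ f (iw q g) :=
  inner_wtOp (abs_inv_wt_le hq) f g

/-- The truncation error is small from `H¹` to its dual: with a factor `(1+n)^{-1}` on either side,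
the multiplier is bounded by `1 / (m + 1)`. -/
lemma norm_iw_apxOp_sub_le {p : ℝ} (hp : 0 ≤ p) {u : ℤ → E →L[ℂ] E} (hu : WFin p u) {m N : ℕ}
    (hmN : m ≤ N) (f : Seq E) :
    ‖iw 1 (apxOp 0 N u (iw 1 f) - apxOp 0 m u (iw 1 f))‖ ≤ 1 / (m + 1) * wn p u * ‖f‖ := by
  have hN := fun K : ℕ => abs_wmin_le (q := 0) le_rfl hp K
  have h1 : ∀ n k : ℕ, |wmin 0 N n k - wmin 0 m n k| ≤ ((N : ℝ) + m) * om p ((n : ℤ) - k) :=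
    fun n k => by
      rw [add_mul]
      exact (abs_sub _ _).trans (add_le_add (hN N n k) (hN m n k))
  have h2 : ∀ n k : ℕ, |(wmin 0 N n k - wmin 0 m n k) * (wt 1 k)⁻¹|
      ≤ ((N : ℝ) + m) * om p ((n : ℤ) - k) := fun n k => by
    rw [abs_mul]
    have := abs_inv_wt_le zero_le_one k
    have := h1 n k
    nlinarith [abs_nonneg (wmin 0 N n k - wmin 0 m n k)]
  have h3 : ∀ n k : ℕ, |(wt 1 n)⁻¹ * (tmin N n k - tmin m n k) * (wt 1 k)⁻¹|
      ≤ 1 / ((m : ℝ) + 1) * om p ((n : ℤ) - k) := fun n k =>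
    (tmin_diff_bound hmN n k).trans (le_mul_of_one_le_right (by positivity) (one_le_om hp _))
  have e1 := hu.mulOp_wtOp (abs_inv_wt_le zero_le_one) h1 h2 (fun _ _ => rfl)
  have e2 := hu.wtOp_mulOp (abs_inv_wt_le zero_le_one) h2 h3 (fun n k => by
    rw [wmin_zero, wmin_zero]; ring)
  have e3 : iw 1 (apxOp 0 N u (iw 1 f) - apxOp 0 m u (iw 1 f)) = (-Complex.I) •
      mulOp (fun n k => (wt 1 n)⁻¹ * (tmin N n k - tmin m n k) * (wt 1 k)⁻¹) u f := by
    rw [← e2, ← e1, hu.mulOp_sub_left (hN N) (hN m)]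
    simp only [apxOp, iw, smul_apply, sub_apply, ContinuousLinearMap.comp_apply, ← smul_sub, map_smul]
  rw [e3, norm_smul, norm_neg, Complex.norm_I, one_mul]
  exact (ContinuousLinearMap.le_opNorm _ _).trans
    (mul_le_mul_of_nonneg_right (hu.norm_mulOp_le h3) (norm_nonneg _))

/-- The difference `y` of two truncated flows satisfies `y' = A_N y + (A_N - A_m) X_m`. The first
term is skew. In the second, `X_m` is bounded in `H¹`, and so is `y`, against which it is paired;
one weight is moved across the inner product to use the smallness of `A_N - A_m`. -/
lemma IsApx.norm_sub_sq_le {p M : ℝ} (hp1 : 1 ≤ p) (hp2 : p ≤ 2) {u : ℝ → ℤ → E →L[ℂ] E}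
    (hu : SymCurve p M u) {t₀ : ℝ} {X : ℝ → ℕ → ℝ → Seq E →L[ℂ] Seq E} (hX0 : IsApx u t₀ X 0)
    (hX1 : IsApx u t₀ X 1) {T : ℝ} (hT : 0 ≤ T) (g : Seq E) {m N : ℕ} (hmN : m ≤ N) {t : ℝ}
    (ht : |t - t₀| ≤ T) :
    ‖X 0 N t (iw 1 g) - X 0 m t (iw 1 g)‖ ^ 2
      ≤ 4 * M * (‖g‖ * Real.exp (2 * M * T)) ^ 2 * T / (m + 1) := by
  have hp0 : 0 ≤ p := by linarith
  have hM : 0 ≤ M := (wn_nonneg p (u 0)).trans (hu.bound 0)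
  have hd : ∀ t, HasDerivAt (fun t => X 0 N t (iw 1 g) - X 0 m t (iw 1 g))
      (apxOp 0 N (u t) (X 0 N t (iw 1 g)) - apxOp 0 m (u t) (X 0 m t (iw 1 g))) t := fun t =>
    (hX0.deriv N t _).sub (hX0.deriv m t _)
  have hb : ∀ K τ, |τ - t₀| ≤ T → ‖X 1 K τ g‖ ≤ ‖g‖ * Real.exp (2 * M * T) := fun K τ hτ =>
    (hX1.norm_le hu (Or.inr le_rfl) hp1 hp2 K τ g).trans (by gcongr)
  have := norm_sq_le_of_deriv (y := fun t => X 0 N t (iw 1 g) - X 0 m t (iw 1 g))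
    (ε := 2 * M * (‖g‖ * Real.exp (2 * M * T)) ^ 2 / (m + 1)) hT (by simp [hX0.init]) hd
    (fun τ hτ => ?_) ht
  · refine this.trans (le_of_eq ?_)
    ring
  · set a := X 1 m τ g
    set b := X 1 N τ g
    have ha : X 0 m τ (iw 1 g) = iw 1 a := (hX1.iw_eq hu hX0 zero_le_one hp1 m τ g).symm
    have hb' : X 0 N τ (iw 1 g) = iw 1 b := (hX1.iw_eq hu hX0 zero_le_one hp1 N τ g).symm
    have hw : X 0 N τ (iw 1 g) - X 0 m τ (iw 1 g) = iw 1 (b - a) := by rw [ha, hb', map_sub]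
    have e : apxOp 0 N (u τ) (X 0 N τ (iw 1 g)) - apxOp 0 m (u τ) (X 0 m τ (iw 1 g))
        = apxOp 0 N (u τ) (X 0 N τ (iw 1 g) - X 0 m τ (iw 1 g))
          + (apxOp 0 N (u τ) (iw 1 a) - apxOp 0 m (u τ) (iw 1 a)) := by
      rw [map_sub, ← ha]; abel
    rw [e, inner_add_left, Complex.add_re, re_inner_apxOp_zero hp0 (hu.fin τ) (hu.symm τ), zero_add,
      hw, ← inner_iw zero_le_one]
    refine (Complex.abs_re_le_norm _).trans ((norm_inner_le_norm _ _).trans ?_)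
    have h1 := norm_iw_apxOp_sub_le hp0 (hu.fin τ) hmN a
    have h2 : ‖b - a‖ ≤ 2 * (‖g‖ * Real.exp (2 * M * T)) :=
      (norm_sub_le _ _).trans (by linarith [hb N τ hτ, hb m τ hτ])
    calc _ ≤ (1 / (m + 1) * wn p (u τ) * ‖a‖) * (2 * (‖g‖ * Real.exp (2 * M * T))) :=
          mul_le_mul h1 h2 (norm_nonneg _) ((norm_nonneg _).trans h1)
      _ ≤ (1 / (m + 1) * M * (‖g‖ * Real.exp (2 * M * T))) * (2 * (‖g‖ * Real.exp (2 * M * T))) := by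
          have := hu.bound τ
          have := hb m τ hτ
          have := wn_nonneg p (u τ)
          gcongr
      _ = _ := by ring

lemma IsApx.uniformCauchy_zero {p M : ℝ} (hp1 : 1 ≤ p) (hp2 : p ≤ 2) {u : ℝ → ℤ → E →L[ℂ] E}
    (hu : SymCurve p M u) {t₀ : ℝ} {X : ℝ → ℕ → ℝ → Seq E →L[ℂ] Seq E} (hX0 : IsApx u t₀ X 0)
    (hX1 : IsApx u t₀ X 1) (T : ℝ) (f : Seq E) :
    UniformCauchySeqOn (fun N t => X 0 N t f) atTop (Metric.closedBall t₀ T) := by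
  have hM : 0 ≤ M := (wn_nonneg p (u 0)).trans (hu.bound 0)
  refine uniformCauchySeqOn_of_dense (C := 1) (fun N t _ => ?_) (iw_denseRange zero_le_one) ?_ f
  · refine ContinuousLinearMap.opNorm_le_bound _ zero_le_one fun f => ?_
    rw [hX0.norm_le_zero (by linarith) hu, one_mul]
  rintro _ ⟨g, rfl⟩
  rw [Metric.uniformCauchySeqOn_iff]
  intro ε hε
  -- The radius `T` may be negative, in which case the ball is empty; `|T|` keeps the constant
  -- nonnegative.
  set K := 4 * M * (‖g‖ * Real.exp (2 * M * |T|)) ^ 2 * |T| with hK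
  have hK0 : 0 ≤ K := by positivity
  obtain ⟨N₀, hN₀⟩ := exists_nat_gt (K / ε ^ 2)
  have key : ∀ m N : ℕ, N₀ ≤ m → m ≤ N → ∀ t ∈ Metric.closedBall t₀ T,
      ‖X 0 N t (iw 1 g) - X 0 m t (iw 1 g)‖ < ε := by
    intro m N hm hmN t ht
    rw [Metric.mem_closedBall, Real.dist_eq] at ht
    have h := hX0.norm_sub_sq_le hp1 hp2 hu hX1 (abs_nonneg T) g hmN (ht.trans (le_abs_self T))
    refine lt_of_pow_lt_pow_left₀ 2 hε.le (h.trans_lt ?_)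
    rw [← hK, div_lt_iff₀ (by positivity)]
    rw [div_lt_iff₀ (by positivity)] at hN₀
    have : (N₀ : ℝ) ≤ m := by exact_mod_cast hm
    nlinarith [sq_pos_of_pos hε]
  refine ⟨N₀, fun m hm N hN t ht => ?_⟩
  rcases le_total m N with h | h
  · rw [dist_comm, dist_eq_norm]; exact key m N hm h t ht
  · rw [dist_eq_norm]; exact key N m hN h t ht

/-- With `g = (1+n) f` and `q = (1+n)^r g`, frequencies are split at `1 + n = R`. Below, `‖g‖` is at
most `R ‖f‖`; above, at most `R^{-r} ‖q‖`. First `R` is chosen so that `R^{-r} B < ε / 2`, then `δ =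
ε / (2R)`. -/
lemma interpolation {ε B r : ℝ} (hε : 0 < ε) (hr : 0 < r) : ∃ δ > 0, ∀ f g q : Seq E,
    iw 1 g = f → iw r q = g → ‖q‖ ≤ B → ‖f‖ ≤ δ → ‖g‖ ≤ ε := by
  have hlim : Tendsto (fun R : ℝ => R ^ (-r) * B) atTop (𝓝 (0 * B)) :=
    (tendsto_rpow_neg_atTop hr).mul_const B
  rw [zero_mul] at hlim
  obtain ⟨R, hR, hR1⟩ := ((hlim.eventually (gt_mem_nhds (show 0 < ε / 2 by positivity))).and
    (eventually_ge_atTop (1 : ℝ))).exists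
  have hR0 : 0 < R := by linarith
  refine ⟨ε / (2 * R), by positivity, ?_⟩
  rintro f g q rfl rfl hq hf
  have hpt : ∀ n, ‖iw r q n‖ ^ 2 ≤ R ^ 2 * ‖iw 1 (iw r q) n‖ ^ 2 + (R ^ (-r)) ^ 2 * ‖q n‖ ^ 2 := by
    intro n
    have hRr : 0 < R ^ (-r) := Real.rpow_pos_of_pos hR0 _
    rcases le_total (wt 1 n) R with h | h
    · have h1 : ‖iw r q n‖ ≤ R * ‖iw 1 (iw r q) n‖ := by
        rw [iw_apply zero_le_one, norm_smul, Complex.norm_real, norm_inv, Real.norm_eq_abs,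
          abs_of_pos (wt_pos 1 n), ← mul_assoc, ← div_eq_mul_inv]
        exact le_mul_of_one_le_left (norm_nonneg _) ((one_le_div (wt_pos 1 n)).2 h)
      have := pow_le_pow_left₀ (norm_nonneg _) h1 2
      rw [mul_pow] at this
      have h2 : 0 ≤ (R ^ (-r)) ^ 2 * ‖q n‖ ^ 2 := by positivity
      linarith
    · have h1 : ‖iw r q n‖ ≤ R ^ (-r) * ‖q n‖ := by
        rw [iw_apply hr.le, norm_smul, Complex.norm_real, norm_inv, Real.norm_eq_abs,
          abs_of_pos (wt_pos r n), Real.rpow_neg hR0.le]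
        refine mul_le_mul_of_nonneg_right (inv_anti₀ (Real.rpow_pos_of_pos hR0 _) ?_) (norm_nonneg _)
        rw [wt_one] at h
        exact Real.rpow_le_rpow hR0.le h hr.le
      have := pow_le_pow_left₀ (norm_nonneg _) h1 2
      rw [mul_pow] at this
      have h2 : 0 ≤ R ^ 2 * ‖iw 1 (iw r q) n‖ ^ 2 := by positivity
      linarith
  refine Seq.norm_le_of_sum_sq_le hε.le fun s => ?_
  calc ∑ n ∈ s, ‖iw r q n‖ ^ 2
      ≤ ∑ n ∈ s, (R ^ 2 * ‖iw 1 (iw r q) n‖ ^ 2 + (R ^ (-r)) ^ 2 * ‖q n‖ ^ 2) :=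
        Finset.sum_le_sum fun n _ => hpt n
    _ ≤ R ^ 2 * ‖iw 1 (iw r q)‖ ^ 2 + (R ^ (-r)) ^ 2 * ‖q‖ ^ 2 := by
        rw [Finset.sum_add_distrib, ← Finset.mul_sum, ← Finset.mul_sum]
        have := Seq.sum_sq_le (iw 1 (iw r q)) s
        have := Seq.sum_sq_le q s
        gcongr
    _ = (R * ‖iw 1 (iw r q)‖) ^ 2 + (R ^ (-r) * ‖q‖) ^ 2 := by ring
    _ ≤ (ε / 2) ^ 2 + (ε / 2) ^ 2 := by
        have h1 : R * ‖iw 1 (iw r q)‖ ≤ ε / 2 := by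
          calc _ ≤ R * (ε / (2 * R)) := by gcongr
            _ = ε / 2 := by field_simp
        have h2 : R ^ (-r) * ‖q‖ ≤ ε / 2 :=
          (mul_le_mul_of_nonneg_left hq (Real.rpow_pos_of_pos hR0 _).le).trans hR.le
        have h3 : 0 ≤ R ^ (-r) * ‖q‖ := by positivity
        gcongr
    _ ≤ ε ^ 2 := by nlinarith [sq_pos_of_pos hε]

/-- For data with `p` weights the flows are bounded in the `p`-weighted norm and Cauchy in `ℓ²`,
hence Cauchy in `H¹` by interpolation. The strict inequality `1 < p`, and so `s > 3/2`, is what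
leaves room for it. Density of such data in `H¹` does the rest. -/
lemma IsApx.uniformCauchy_one {p M : ℝ} (hp1 : 1 < p) (hp2 : p ≤ 2) {u : ℝ → ℤ → E →L[ℂ] E}
    (hu : SymCurve p M u) {t₀ : ℝ} {X : ℝ → ℕ → ℝ → Seq E →L[ℂ] Seq E} (hX0 : IsApx u t₀ X 0)
    (hX1 : IsApx u t₀ X 1) (hXp : IsApx u t₀ X p) (T : ℝ) (f : Seq E) :
    UniformCauchySeqOn (fun N t => X 1 N t f) atTop (Metric.closedBall t₀ T) := by
  have hM : 0 ≤ M := (wn_nonneg p (u 0)).trans (hu.bound 0)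
  have hr : 0 < p - 1 := by linarith
  have hexp : ∀ t ∈ Metric.closedBall t₀ T, Real.exp (2 * M * |t - t₀|) ≤ Real.exp (2 * M * |T|) := by
    intro t ht
    rw [Metric.mem_closedBall, Real.dist_eq] at ht
    have := ht.trans (le_abs_self T)
    gcongr
  refine uniformCauchySeqOn_of_dense (C := Real.exp (2 * M * |T|)) (fun N t ht => ?_)
    (iw_denseRange hr.le) ?_ f
  · refine ContinuousLinearMap.opNorm_le_bound _ (Real.exp_pos _).le fun f => ?_
    refine (hX1.norm_le hu (Or.inr le_rfl) hp1.le hp2 N t f).trans ?_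
    rw [mul_comm]
    exact mul_le_mul_of_nonneg_right (hexp t ht) (norm_nonneg _)
  rintro _ ⟨g, rfl⟩
  rw [Metric.uniformCauchySeqOn_iff]
  intro ε hε
  obtain ⟨δ, hδ, hint⟩ := interpolation (E := E) (B := 2 * (‖g‖ * Real.exp (2 * M * |T|)))
    (half_pos hε) hr
  obtain ⟨N₀, hN₀⟩ := Metric.uniformCauchySeqOn_iff.1
    (hX0.uniformCauchy_zero hp1.le hp2 hu hX1 T (iw p g)) δ hδ
  have hg : iw p g = iw 1 (iw (p - 1) g) := by
    rw [← iw_add zero_le_one hr.le, add_sub_cancel]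
  refine ⟨N₀, fun m hm n hn t ht => ?_⟩
  have h := hN₀ m hm n hn t ht
  rw [dist_eq_norm] at h ⊢
  have e1 : ∀ K, iw 1 (X 1 K t (iw (p - 1) g)) = X 0 K t (iw p g) := fun K => by
    rw [hX1.iw_eq hu hX0 zero_le_one hp1.le, hg]
  have e2 : ∀ K, iw (p - 1) (X p K t g) = X 1 K t (iw (p - 1) g) := fun K => by
    refine iw_injective zero_le_one ?_
    rw [e1, ← iw_add zero_le_one hr.le, add_sub_cancel, hXp.iw_eq hu hX0 (by linarith) le_rfl]
  have hq : ‖X p m t g - X p n t g‖ ≤ 2 * (‖g‖ * Real.exp (2 * M * |T|)) := by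
    have hb : ∀ K, ‖X p K t g‖ ≤ ‖g‖ * Real.exp (2 * M * |T|) := fun K =>
      (hXp.norm_le hu (Or.inr hp1.le) le_rfl hp2 K t g).trans
        (mul_le_mul_of_nonneg_left (hexp t ht) (norm_nonneg _))
    refine (norm_sub_le _ _).trans ?_
    linarith [hb m, hb n]
  have := hint (X 0 m t (iw p g) - X 0 n t (iw p g))
    (X 1 m t (iw (p - 1) g) - X 1 n t (iw (p - 1) g)) (X p m t g - X p n t g)
    (by rw [map_sub, e1, e1]) (by rw [map_sub, e2, e2]) hq h.le
  linarith

end Limit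

/-! ### The limiting propagator and its equation -/

section Limit

variable {E : Type*} [NormedAddCommGroup E] [InnerProductSpace ℂ E] [CompleteSpace E]

/-- The multiplier `min(n, m) / (1 + m)`. -/
def bmin (n m : ℕ) : ℝ := ((min n m : ℕ) : ℝ) * (wt 1 m)⁻¹

/-- The operator `B ∘ (1+n)^{-1}`, where `B` is the Lax operator with kernel
`-i min(n, m) u(n - m)`. -/
def laxS (u : ℤ → E →L[ℂ] E) : Seq E →L[ℂ] Seq E := (-Complex.I) • mulOp bmin u

lemma abs_nat_mul_inv_wt_le {j m : ℕ} (h : j ≤ m) : |(j : ℝ) * (wt 1 m)⁻¹| ≤ 1 := by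
  rw [wt_one, abs_of_nonneg (by positivity), ← div_eq_mul_inv, div_le_one (by positivity)]
  have : (j : ℝ) ≤ m := by exact_mod_cast h
  linarith

lemma abs_bmin_le {p : ℝ} (hp : 0 ≤ p) (n m : ℕ) : |bmin n m| ≤ 1 * om p ((n : ℤ) - m) := by
  rw [one_mul]
  exact (abs_nat_mul_inv_wt_le (min_le_right n m)).trans (one_le_om hp _)

lemma abs_tmin_mul_le {p : ℝ} (hp : 0 ≤ p) (N n m : ℕ) :
    |tmin N n m * (wt 1 m)⁻¹| ≤ 1 * om p ((n : ℤ) - m) := by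
  rw [one_mul]
  exact (abs_nat_mul_inv_wt_le ((min_le_left _ _).trans (min_le_right n m))).trans (one_le_om hp _)

lemma apxOp_iw {p : ℝ} (hp : 0 ≤ p) {u : ℤ → E →L[ℂ] E} (hu : WFin p u) (N : ℕ) (f : Seq E) :
    apxOp 0 N u (iw 1 f) = (-Complex.I) • mulOp (fun n m => tmin N n m * (wt 1 m)⁻¹) u f := by
  have e := hu.mulOp_wtOp (abs_inv_wt_le zero_le_one) (abs_wmin_le le_rfl hp N)
    (abs_tmin_mul_le hp N) (fun n m => by rw [wmin_zero])
  rw [← e]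
  rfl

lemma norm_neg_I_smul (x : Seq E) : ‖(-Complex.I) • x‖ = ‖x‖ := by
  rw [norm_smul, norm_neg, Complex.norm_I, one_mul]

/-- On a single entry at `m` the truncated kernel is already the limit kernel once `N ≥ m`. The
operators `B_N (1+n)^{-1}` are uniformly bounded, so this passes to all vectors and also to
converging arguments. -/
lemma tendsto_apxOp {p : ℝ} (hp : 0 ≤ p) {u : ℤ → E →L[ℂ] E} (hu : WFin p u) {f : ℕ → Seq E}
    {g : Seq E} (hf : Tendsto f atTop (𝓝 g)) :
    Tendsto (fun N => apxOp 0 N u (iw 1 (f N))) atTop (𝓝 (laxS u g)) := by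
  have hn : ∀ N, ‖mulOp (fun n m => tmin N n m * (wt 1 m)⁻¹) u‖ ≤ wn p u := fun N => by
    simpa using hu.norm_mulOp_le (abs_tmin_mul_le hp N)
  have h1 : Tendsto (fun N => mulOp (fun n m => tmin N n m * (wt 1 m)⁻¹) u g) atTop
      (𝓝 (mulOp bmin u g)) := by
    let D : Submodule ℂ (Seq E) :=
      { carrier := {g | Tendsto (fun N => mulOp (fun n m => tmin N n m * (wt 1 m)⁻¹) u g) atTop
          (𝓝 (mulOp bmin u g))}
        zero_mem' := by simp
        add_mem' := fun {a b} ha hb => by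
          have ha : Tendsto _ _ _ := ha
          have hb : Tendsto _ _ _ := hb
          simpa using ha.add hb
        smul_mem' := fun c a ha => by
          have ha : Tendsto _ _ _ := ha
          simpa using ha.const_smul c }
    refine tendsto_apply_of_dense hn (by simpa using hu.norm_mulOp_le (abs_bmin_le hp))
      (dense_of_sgl D fun m e => ?_) (fun x hx => hx) g
    refine tendsto_const_nhds.congr' ?_
    filter_upwards [eventually_ge_atTop m] with N hN
    ext n
    unfold mulOp
    rw [kerOp_sgl (hu.dominated (abs_bmin_le hp)), kerOp_sgl (hu.dominated (abs_tmin_mul_le hp N))]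
    unfold mker bmin tmin
    simp only [min_eq_left ((min_le_right n m).trans hN)]
  have h2 : Tendsto (fun N => mulOp (fun n m => tmin N n m * (wt 1 m)⁻¹) u (f N)) atTop
      (𝓝 (mulOp bmin u g)) := by
    have h3 : Tendsto (fun N => mulOp (fun n m => tmin N n m * (wt 1 m)⁻¹) u (f N - g)) atTop
        (𝓝 0) := by
      have := (tendsto_iff_norm_sub_tendsto_zero.1 hf).const_mul (wn p u)
      rw [mul_zero] at this
      refine squeeze_zero_norm (fun N => ?_) this
      exact (ContinuousLinearMap.le_opNorm _ _).trans
        (mul_le_mul_of_nonneg_right (hn N) (norm_nonneg _))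
    simpa using h3.add h1
  simp only [apxOp_iw hp hu]
  exact h2.const_smul _

lemma continuous_laxS {p M : ℝ} (hp : 0 ≤ p) {u : ℝ → ℤ → E →L[ℂ] E} (hu : SymCurve p M u) :
    Continuous fun t => laxS (u t) :=
  (continuous_mulOp hu (abs_bmin_le hp)).const_smul (-Complex.I)

/-- The propagator of the Lax operator, started at time `t₀`. The family `R` is the propagator
conjugated by `1 + n`. -/
theorem exists_isometric_propagator {p M : ℝ} (hp1 : 1 < p) (hp2 : p ≤ 2)
    {u : ℝ → ℤ → E →L[ℂ] E} (hu : SymCurve p M u) (t₀ : ℝ) :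
    ∃ P R : ℝ → Seq E →L[ℂ] Seq E, P t₀ = 1 ∧ (∀ t f, ‖P t f‖ = ‖f‖) ∧
      (∀ t g, iw 1 (R t g) = P t (iw 1 g)) ∧ (∀ f, Continuous fun t => P t f) ∧
      ∀ t g, HasDerivAt (fun τ => P τ (iw 1 g)) (laxS (u t) (R t g)) t := by
  have hp0 : 0 ≤ p := by linarith
  have hM : 0 ≤ M := (wn_nonneg p (u 0)).trans (hu.bound 0)
  obtain ⟨X, hX⟩ := exists_apx hu t₀
  have hX0 := hX 0 le_rfl hp0
  have hX1 := hX 1 zero_le_one hp1.le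
  have hXp := hX p hp0 le_rfl
  have U0 := hX0.uniformCauchy_zero hp1.le hp2 hu hX1
  have U1 := hX0.uniformCauchy_one hp1 hp2 hu hX1 hXp
  have hmem : ∀ t, t ∈ Metric.closedBall t₀ |t - t₀| := fun t => by
    rw [Metric.mem_closedBall, Real.dist_eq]
  choose P hPn hP using fun t => exists_strong_limit (Z := fun N => X 0 N t) (C := 1)
    (fun N f => by rw [hX0.norm_le_zero hp0 hu, one_mul])
    (fun f => (U0 |t - t₀| f).cauchySeq (hmem t))
  choose R hRn hR using fun t => exists_strong_limit (Z := fun N => X 1 N t)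
    (C := Real.exp (2 * M * |t - t₀|))
    (fun N f => by
      rw [mul_comm]
      exact hX1.norm_le hu (Or.inr le_rfl) hp1.le hp2 N t f)
    (fun f => (U1 |t - t₀| f).cauchySeq (hmem t))
  have hcont : ∀ {q : ℝ} {L : ℝ → Seq E →L[ℂ] Seq E} {f : Seq E}, IsApx u t₀ X q →
      (∀ T, UniformCauchySeqOn (fun N t => X q N t f) atTop (Metric.closedBall t₀ T)) →
      (∀ t, Tendsto (fun N => X q N t f) atTop (𝓝 (L t f))) → Continuous fun t => L t f := by
    intro q L f hq hU hL
    rw [continuous_iff_continuousAt]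
    intro t
    -- The enlarged radius makes the ball a neighbourhood of `t`, so uniform convergence on it gives
    -- continuity at `t`.
    have hun := (hU (|t - t₀| + 1)).tendstoUniformlyOn_of_tendsto (fun t _ => hL t)
    refine (hun.continuousOn (Frequently.of_forall fun N => ?_)).continuousAt
      (Metric.closedBall_mem_nhds_of_mem ?_)
    · exact fun τ _ => (hq.deriv N τ f).continuousAt.continuousWithinAt
    · rw [Metric.mem_ball, Real.dist_eq]; linarith
  have hRc : ∀ g, Continuous fun t => R t g := fun g => hcont hX1 (U1 · g) (hR · g)
  have hPR : ∀ t g, iw 1 (R t g) = P t (iw 1 g) := fun t g => by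
    refine tendsto_nhds_unique (((iw 1).continuous.tendsto _).comp (hR t g)) ?_
    simp only [Function.comp_def, hX1.iw_eq hu hX0 zero_le_one hp1.le]
    exact hP t _
  -- The limit is taken in the integral equation, where dominated convergence suffices. The
  -- integrand is continuous in time because `R` is the strong limit in `H¹`, so the derivative is
  -- recovered from the fundamental theorem of calculus.
  have hint : ∀ g t, P t (iw 1 g) = iw 1 g + ∫ τ in t₀..t, laxS (u τ) (R τ g) := by
    intro g t
    have hcA : ∀ N, Continuous fun τ => apxOp 0 N (u τ) (X 0 N τ (iw 1 g)) := fun N => by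
      have hc : Continuous fun t => apxOp 0 N (u t) :=
        (continuous_mulOp hu (abs_wmin_le le_rfl hp0 N)).const_smul (-Complex.I)
      exact hc.clm_apply (continuous_iff_continuousAt.2 fun τ => (hX0.deriv N τ _).continuousAt)
    have h1 : ∀ N, X 0 N t (iw 1 g)
        = iw 1 g + ∫ τ in t₀..t, apxOp 0 N (u τ) (X 0 N τ (iw 1 g)) := fun N => by
      rw [intervalIntegral.integral_eq_sub_of_hasDerivAt (fun τ _ => hX0.deriv N τ (iw 1 g))
        ((hcA N).intervalIntegrable _ _), hX0.init]
      simp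
    have h2 : Tendsto (fun N => ∫ τ in t₀..t, apxOp 0 N (u τ) (X 0 N τ (iw 1 g))) atTop
        (𝓝 (∫ τ in t₀..t, laxS (u τ) (R τ g))) := by
      have hc : Continuous fun τ : ℝ => M * (‖g‖ * Real.exp (2 * M * |τ - t₀|)) := by fun_prop
      refine intervalIntegral.tendsto_integral_filter_of_dominated_convergence
        (fun τ => M * (‖g‖ * Real.exp (2 * M * |τ - t₀|)))
        (Eventually.of_forall fun N => (hcA N).aestronglyMeasurable)
        (Eventually.of_forall fun N => Eventually.of_forall fun τ _ => ?_)
        (hc.intervalIntegrable _ _) (Eventually.of_forall fun τ _ => ?_)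
      · rw [← hX1.iw_eq hu hX0 zero_le_one hp1.le, apxOp_iw hp0 (hu.fin τ), norm_neg_I_smul]
        have := (hu.fin τ).norm_mulOp_le (abs_tmin_mul_le hp0 N)
        rw [one_mul] at this
        exact (ContinuousLinearMap.le_opNorm _ _).trans (mul_le_mul (this.trans (hu.bound τ))
          (hX1.norm_le hu (Or.inr le_rfl) hp1.le hp2 N τ g) (norm_nonneg _) hM)
      · simp only [← hX1.iw_eq hu hX0 zero_le_one hp1.le]
        exact tendsto_apxOp hp0 (hu.fin τ) (hR τ g)
    refine tendsto_nhds_unique (hP t _) ?_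
    simp only [h1]
    exact h2.const_add _
  refine ⟨P, R, ?_, fun t f => ?_, hPR, fun f => hcont hX0 (U0 · f) (hP · f), fun t g => ?_⟩
  · ext1 f
    refine tendsto_nhds_unique (hP t₀ f) ?_
    simp [hX0.init]
  · refine tendsto_nhds_unique (hP t f).norm ?_
    simp only [hX0.norm_le_zero hp0 hu]
    exact tendsto_const_nhds
  · have hc := (continuous_laxS hp0 hu).clm_apply (hRc g)
    have := (intervalIntegral.integral_hasDerivAt_right (hc.intervalIntegrable t₀ t)
      (hc.stronglyMeasurableAtFilter _ _) hc.continuousAt).const_add (iw 1 g)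
    simp only [hint]
    exact this

end Limit

/-! ### Uniqueness, unitarity and propagators on arbitrary intervals -/

section Evolution

variable {E : Type*} [NormedAddCommGroup E] [InnerProductSpace ℂ E] [CompleteSpace E]

/-- Skewness of `B` on its domain. Moving `(1+n)^{-1}` to the left factor produces the symmetric
multiplier `min(n, m) / ((1+n)(1+m))`. -/
lemma re_inner_laxS {p : ℝ} (hp : 0 ≤ p) {u : ℤ → E →L[ℂ] E} (hu : WFin p u) (hs : IsSymm u)
    (f : Seq E) : (inner ℂ (laxS u f) (iw 1 f)).re = 0 := by
  have hb : ∀ n m : ℕ, |(wt 1 n)⁻¹ * bmin n m| ≤ 1 * om p ((n : ℤ) - m) := fun n m => by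
    rw [abs_mul]
    have h1 := abs_inv_wt_le zero_le_one n
    have h2 := abs_bmin_le hp n m
    nlinarith [abs_nonneg (bmin n m)]
  have e := hu.wtOp_mulOp (abs_inv_wt_le zero_le_one) (abs_bmin_le hp) hb (fun _ _ => rfl)
  have e2 : iw 1 (laxS u f)
      = (-Complex.I) • mulOp (fun n m => (wt 1 n)⁻¹ * bmin n m) u f := by
    rw [← e]
    simp only [laxS, iw, smul_apply, ContinuousLinearMap.comp_apply, map_smul]
  rw [← inner_iw zero_le_one, e2]
  exact hs.re_inner_mulOp hu hb (fun n m => by unfold bmin; rw [min_comm]; ring) f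

/-- A continuous curve of self-adjoint symbols on a set of times. -/
structure SymCurveOn (p : ℝ) (I : Set ℝ) (u : ℝ → ℤ → E →L[ℂ] E) : Prop where
  fin : ∀ t ∈ I, WFin p (u t)
  cont : ∀ t₀ ∈ I, Tendsto (fun t => wn p (u t - u t₀)) (𝓝[I] t₀) (𝓝 0)
  symm : ∀ t ∈ I, IsSymm (u t)

lemma SymCurve.on {p M : ℝ} {u : ℝ → ℤ → E →L[ℂ] E} (hu : SymCurve p M u) (I : Set ℝ) :
    SymCurveOn p I u :=
  ⟨fun t _ => hu.fin t, fun t _ => (hu.cont t).mono_left nhdsWithin_le_nhds, fun t _ => hu.symm t⟩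

lemma SymCurveOn.mono {p : ℝ} {I J : Set ℝ} {u : ℝ → ℤ → E →L[ℂ] E} (hu : SymCurveOn p I u)
    (h : J ⊆ I) : SymCurveOn p J u :=
  ⟨fun t ht => hu.fin t (h ht), fun t ht => (hu.cont t (h ht)).mono_left (nhdsWithin_mono t h),
    fun t ht => hu.symm t (h ht)⟩

lemma abs_wn_sub_le {p : ℝ} {u v : ℤ → E →L[ℂ] E} (hu : WFin p u) (hv : WFin p v) :
    |wn p u - wn p v| ≤ wn p (u - v) := by
  unfold wn
  rw [← Summable.tsum_sub hu hv, ← Real.norm_eq_abs]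
  refine tsum_of_norm_bounded (hu.sub hv).hasSum fun k => ?_
  rw [← mul_sub, norm_mul, Real.norm_eq_abs, Real.norm_eq_abs, abs_of_pos (om_pos p k)]
  exact mul_le_mul_of_nonneg_left (abs_norm_sub_norm_le _ _) (om_pos p k).le

/-- Freezing the symbol outside `[a, b]` gives a curve for all times; compactness of `[a, b]`
supplies the uniform bound. -/
lemma SymCurveOn.clamp {p a b : ℝ} (hab : a ≤ b) {u : ℝ → ℤ → E →L[ℂ] E}
    (hu : SymCurveOn p (Icc a b) u) : ∃ M, SymCurve p M fun t => u (projIcc a b hab t) := by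
  have hc : ContinuousOn (fun t => wn p (u t)) (Icc a b) := by
    intro t₀ ht₀
    rw [ContinuousWithinAt, tendsto_iff_norm_sub_tendsto_zero]
    refine squeeze_zero' (Eventually.of_forall fun _ => norm_nonneg _) ?_ (hu.cont t₀ ht₀)
    filter_upwards [self_mem_nhdsWithin] with t ht
    exact abs_wn_sub_le (hu.fin t ht) (hu.fin t₀ ht₀)
  obtain ⟨M, hM⟩ := isCompact_Icc.bddAbove_image hc
  refine ⟨M, fun t => hu.fin _ (projIcc a b hab t).2, fun t => hM ⟨_, (projIcc a b hab t).2, rfl⟩,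
    fun t₀ => ?_, fun t => hu.symm _ (projIcc a b hab t).2⟩
  refine (hu.cont _ (projIcc a b hab t₀).2).comp (tendsto_nhdsWithin_iff.2 ⟨?_, ?_⟩)
  · exact (continuous_subtype_val.comp continuous_projIcc).tendsto t₀
  · exact Eventually.of_forall fun t => (projIcc a b hab t).2

/-- Solutions in the domain of the Lax operator of `y' = B y + K y`, with `K` skew, are determined
by one value. -/
lemma evolution_unique {p : ℝ} (hp : 0 ≤ p) {I : Set ℝ} (hI : I.OrdConnected)
    {u : ℝ → ℤ → E →L[ℂ] E} (hu : SymCurveOn p I u) {K : ℝ → Seq E →L[ℂ] Seq E}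
    (hK : ∀ t ∈ I, ∀ f, (inner ℂ (K t f) f).re = 0) {y z : ℝ → Seq E}
    (hy : ∀ t ∈ I, ∃ a, y t = iw 1 a ∧ HasDerivWithinAt y (laxS (u t) a + K t (y t)) I t)
    (hz : ∀ t ∈ I, ∃ a, z t = iw 1 a ∧ HasDerivWithinAt z (laxS (u t) a + K t (z t)) I t)
    {t₀ t : ℝ} (ht₀ : t₀ ∈ I) (h0 : y t₀ = z t₀) (ht : t ∈ I) : y t = z t := by
  choose! a ha hya using hy
  choose! b hb hzb using hz
  have := norm_eq_of_skew hI (y := fun t => y t - z t) (fun t ht => (hya t ht).sub (hzb t ht))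
    (fun t ht => ?_) ht ht₀
  · simpa [h0, sub_eq_zero] using this
  · have e : laxS (u t) (a t) + K t (y t) - (laxS (u t) (b t) + K t (z t))
        = laxS (u t) (a t - b t) + K t (y t - z t) := by
      rw [map_sub, map_sub]; abel
    rw [e, inner_add_left, Complex.add_re, hK t ht, add_zero]
    rw [ha t ht, hb t ht, ← map_sub]
    exact re_inner_laxS hp (hu.fin t ht) (hu.symm t ht) _

/-- A propagator of the Lax operators on `ℓ²(ℕ; E)`. -/
structure IsEvol (I : Set ℝ) (u : ℝ → ℤ → E →L[ℂ] E) (P : ℝ → Seq E →L[ℂ] Seq E) : Prop where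
  init : P 0 = 1
  cont : ∀ f, ContinuousOn (fun t => P t f) I
  deriv : ∀ t ∈ I, ∀ g, ∃ h, P t (iw 1 g) = iw 1 h ∧
    HasDerivWithinAt (fun τ => P τ (iw 1 g)) (laxS (u t) h) I t

lemma IsEvol.mono {I J : Set ℝ} {u : ℝ → ℤ → E →L[ℂ] E} {P : ℝ → Seq E →L[ℂ] Seq E}
    (hP : IsEvol I u P) (h : J ⊆ I) : IsEvol J u P :=
  ⟨hP.init, fun f => (hP.cont f).mono h, fun t ht g => by
    obtain ⟨k, h1, h2⟩ := hP.deriv t (h ht) g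
    exact ⟨k, h1, h2.mono h⟩⟩

lemma IsEvol.congr {I : Set ℝ} {u v : ℝ → ℤ → E →L[ℂ] E} {P : ℝ → Seq E →L[ℂ] Seq E}
    (hP : IsEvol I u P) (h : ∀ t ∈ I, u t = v t) : IsEvol I v P :=
  ⟨hP.init, hP.cont, fun t ht g => by rw [← h t ht]; exact hP.deriv t ht g⟩

lemma clm_eq_of_iw {A B : Seq E →L[ℂ] Seq E} (h : ∀ g, A (iw 1 g) = B (iw 1 g)) : A = B := by
  have := (iw_denseRange (E := E) zero_le_one).equalizer A.continuous B.continuous (funext h)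
  ext1 f
  exact congrFun this f

lemma IsEvol.unique {p : ℝ} (hp : 0 ≤ p) {I : Set ℝ} (hI : I.OrdConnected) (h0 : (0 : ℝ) ∈ I)
    {u : ℝ → ℤ → E →L[ℂ] E} (hu : SymCurveOn p I u) {P Q : ℝ → Seq E →L[ℂ] Seq E}
    (hP : IsEvol I u P) (hQ : IsEvol I u Q) {t : ℝ} (ht : t ∈ I) : P t = Q t := by
  refine clm_eq_of_iw fun g => ?_
  refine evolution_unique hp hI hu (K := 0) (by simp) (fun t ht => ?_) (fun t ht => ?_) h0
    (y := fun t => P t (iw 1 g)) (z := fun t => Q t (iw 1 g)) (by simp [hP.init, hQ.init]) ht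
  · simpa using hP.deriv t ht g
  · simpa using hQ.deriv t ht g

lemma mem_unitary_of_isometry {H : Type*} [NormedAddCommGroup H] [InnerProductSpace ℂ H]
    [CompleteSpace H] {A : H →L[ℂ] H} (h : ∀ f, ‖A f‖ = ‖f‖) (hd : DenseRange A) :
    A ∈ unitary (H →L[ℂ] H) := by
  have h1 : star A * A = 1 := A.norm_map_iff_adjoint_comp_self.1 h
  refine Unitary.mem_iff.2 ⟨h1, ?_⟩
  ext1 f
  have := hd.equalizer (A * star A).continuous (1 : H →L[ℂ] H).continuous (funext fun g => by
    change A ((star A * A) g) = A g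
    rw [h1]; rfl)
  exact congrFun this f

/-- Isometry comes from the construction. For dense range, the equation is solved from time `t₁`
with data `iw 1 g` back to time `0`; by uniqueness `P t₁` carries the value found there to `iw 1 g`.
-/
theorem exists_unitary_evol {p M : ℝ} (hp1 : 1 < p) (hp2 : p ≤ 2)
    {u : ℝ → ℤ → E →L[ℂ] E} (hu : SymCurve p M u) :
    ∃ P : ℝ → Seq E →L[ℂ] Seq E, IsEvol univ u P ∧ ∀ t, P t ∈ unitary (Seq E →L[ℂ] Seq E) := by
  obtain ⟨P, R, hP0, hPn, hPR, hPc, hPd⟩ := exists_isometric_propagator hp1 hp2 hu 0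
  refine ⟨P, ⟨hP0, fun f => (hPc f).continuousOn, fun t _ g =>
    ⟨R t g, (hPR t g).symm, (hPd t g).hasDerivWithinAt⟩⟩, fun t₁ => ?_⟩
  refine mem_unitary_of_isometry (hPn t₁) ?_
  obtain ⟨Q, S, hQ0, -, hQS, -, hQd⟩ := exists_isometric_propagator hp1 hp2 hu t₁
  refine (iw_denseRange (E := E) zero_le_one).mono ?_
  rintro _ ⟨g, rfl⟩
  refine ⟨iw 1 (S 0 g), ?_⟩
  have := evolution_unique (p := p) (I := univ) (by linarith) ordConnected_univ (hu.on univ)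
    (K := 0) (by simp) (y := fun t => P t (iw 1 (S 0 g))) (z := fun t => Q t (iw 1 g))
    (fun t _ => ⟨R t (S 0 g), (hPR t _).symm, by simpa using (hPd t (S 0 g))⟩)
    (fun t _ => ⟨S t g, (hQS t _).symm, by simpa using (hQd t g)⟩)
    (mem_univ 0) (by simp [hP0, hQS]) (mem_univ t₁)
  simpa [hQ0] using this

/-- Derivatives within `I` are local, so a compact interval containing `0` can replace `I` as soon
as it is a neighbourhood of `t` relative to `I`. If no point of `I` lies beyond both `t` and `0` on
one side, the farther of the two is already an end point of `I` there. -/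
lemma exists_compact_interval {I : Set ℝ} (hI : I.OrdConnected) (h0 : (0 : ℝ) ∈ I) {t : ℝ}
    (ht : t ∈ I) : ∃ a b, a ≤ 0 ∧ 0 ≤ b ∧ Icc a b ⊆ I ∧ t ∈ Icc a b ∧ Icc a b ∈ 𝓝[I] t := by
  have hup : ∃ b ∈ I, 0 ≤ b ∧ t ≤ b ∧ Iic b ∈ 𝓝[I] t := by
    by_cases h : ∃ c ∈ I, max t 0 < c
    · obtain ⟨c, hc, hlt⟩ := h
      exact ⟨c, hc, ((le_max_right _ _).trans_lt hlt).le, ((le_max_left _ _).trans_lt hlt).le,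
        mem_nhdsWithin_of_mem_nhds (Iic_mem_nhds ((le_max_left _ _).trans_lt hlt))⟩
    · push Not at h
      refine ⟨max t 0, by rcases max_choice t 0 with e | e <;> rw [e] <;> assumption,
        le_max_right _ _, le_max_left _ _, ?_⟩
      filter_upwards [self_mem_nhdsWithin] with x hx using h x hx
  have hdn : ∃ a ∈ I, a ≤ 0 ∧ a ≤ t ∧ Ici a ∈ 𝓝[I] t := by
    by_cases h : ∃ c ∈ I, c < min t 0
    · obtain ⟨c, hc, hlt⟩ := h
      exact ⟨c, hc, (hlt.trans_le (min_le_right _ _)).le, (hlt.trans_le (min_le_left _ _)).le,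
        mem_nhdsWithin_of_mem_nhds (Ici_mem_nhds (hlt.trans_le (min_le_left _ _)))⟩
    · push Not at h
      refine ⟨min t 0, by rcases min_choice t 0 with e | e <;> rw [e] <;> assumption,
        min_le_right _ _, min_le_left _ _, ?_⟩
      filter_upwards [self_mem_nhdsWithin] with x hx using h x hx
  obtain ⟨b, hb, hb0, htb, hbn⟩ := hup
  obtain ⟨a, ha, ha0, hta, han⟩ := hdn
  exact ⟨a, b, ha0, hb0, hI.out ha hb, ⟨hta, htb⟩, inter_mem han hbn⟩

/-- Existence of the unitary propagator on an arbitrary interval of times. -/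
theorem exists_evol {p : ℝ} (hp1 : 1 < p) (hp2 : p ≤ 2) {I : Set ℝ} (hI : I.OrdConnected)
    (h0 : (0 : ℝ) ∈ I) {u : ℝ → ℤ → E →L[ℂ] E} (hu : SymCurveOn p I u) :
    ∃ P : ℝ → Seq E →L[ℂ] Seq E, IsEvol I u P ∧ ∀ t ∈ I, P t ∈ unitary (Seq E →L[ℂ] Seq E) := by
  have hp0 : 0 ≤ p := by linarith
  have hex : ∀ a b : ℝ, ∃ P : ℝ → Seq E →L[ℂ] Seq E, a ≤ 0 → 0 ≤ b → Icc a b ⊆ I →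
      IsEvol (Icc a b) u P ∧ ∀ t, P t ∈ unitary (Seq E →L[ℂ] Seq E) := by
    intro a b
    by_cases h : a ≤ 0 ∧ 0 ≤ b ∧ Icc a b ⊆ I
    · obtain ⟨M, hM⟩ := (hu.mono h.2.2).clamp (h.1.trans h.2.1)
      obtain ⟨P, hP, hPu⟩ := exists_unitary_evol hp1 hp2 hM
      exact ⟨P, fun _ _ _ => ⟨(hP.mono (subset_univ _)).congr fun t ht => by
        rw [projIcc_of_mem _ ht], hPu⟩⟩
    · exact ⟨0, fun h1 h2 h3 => (h ⟨h1, h2, h3⟩).elim⟩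
  choose P hP using hex
  have hsub : ∀ t ∈ I, Icc (min t 0) (max t 0) ⊆ I := fun t ht => by
    refine hI.out ?_ ?_
    · rcases min_choice t 0 with e | e <;> rw [e] <;> assumption
    · rcases max_choice t 0 with e | e <;> rw [e] <;> assumption
  have hPt := fun t (ht : t ∈ I) =>
    hP (min t 0) (max t 0) (min_le_right _ _) (le_max_right _ _) (hsub t ht)
  -- Gluing: the value at `t` is taken from the smallest interval containing `0` and `t`, and
  -- uniqueness there identifies it with the propagator of any larger interval. On a relative
  -- neighbourhood of `t` one single propagator can therefore be used.
  have heq : ∀ a b, a ≤ 0 → 0 ≤ b → Icc a b ⊆ I → ∀ t ∈ Icc a b,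
      P (min t 0) (max t 0) t = P a b t := by
    intro a b ha hb hab t ht
    have h1 : Icc (min t 0) (max t 0) ⊆ Icc a b :=
      Icc_subset_Icc (le_min ht.1 ha) (max_le ht.2 hb)
    exact IsEvol.unique hp0 ordConnected_Icc ⟨min_le_right _ _, le_max_right _ _⟩
      (hu.mono (h1.trans hab)) (hPt t (hab ht)).1 ((hP a b ha hb hab).1.mono h1)
      ⟨min_le_left _ _, le_max_left _ _⟩
  refine ⟨fun t => P (min t 0) (max t 0) t, ⟨?_, fun f t ht => ?_, fun t ht g => ?_⟩,
    fun t ht => (hPt t ht).2 t⟩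
  · exact (hPt 0 h0).1.init
  · obtain ⟨a, b, ha, hb, hab, htab, hn⟩ := exists_compact_interval hI h0 ht
    have h1 := ((hP a b ha hb hab).1.cont f t htab).mono_of_mem_nhdsWithin hn
    refine h1.congr_of_eventuallyEq ?_ (by rw [heq a b ha hb hab t htab])
    filter_upwards [hn] with τ hτ
    rw [heq a b ha hb hab τ hτ]
  · obtain ⟨a, b, ha, hb, hab, htab, hn⟩ := exists_compact_interval hI h0 ht
    obtain ⟨k, h1, h2⟩ := (hP a b ha hb hab).1.deriv t htab g
    refine ⟨k, by rw [heq a b ha hb hab t htab, h1], ?_⟩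
    refine (h2.mono_of_mem_nhdsWithin hn).congr_of_eventuallyEq ?_ (by rw [heq a b ha hb hab t htab])
    filter_upwards [hn] with τ hτ
    rw [heq a b ha hb hab τ hτ]

end Evolution

/-! ### Exponentials and a product rule for strongly continuous families -/

section Operators

variable {H : Type*} [NormedAddCommGroup H] [NormedSpace ℂ H] [CompleteSpace H]

lemma opExp_intertwine {A B J : H →L[ℂ] H} (h : A * J = J * B) : opExp A * J = J * opExp B := by
  have hp : ∀ n : ℕ, A ^ n * J = J * B ^ n := fun n => by
    induction n with
    | zero => simp
    | succ n ih => rw [pow_succ, mul_assoc, h, ← mul_assoc, ih, mul_assoc, ← pow_succ]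
  have h1 := (NormedSpace.exp_series_hasSum_exp' (𝕂 := ℂ) A).mul_right J
  have h2 := (NormedSpace.exp_series_hasSum_exp' (𝕂 := ℂ) B).mul_left J
  refine h1.unique (h2.congr_fun fun n => ?_)
  rw [smul_mul_assoc, mul_smul_comm, hp]

lemma hasDerivAt_opExp (T : H →L[ℂ] H) (x : H) (t : ℝ) :
    HasDerivAt (fun τ : ℝ => opExp ((-(Complex.I * (τ : ℂ))) • T) x)
      ((-Complex.I) • T (opExp ((-(Complex.I * (t : ℂ))) • T) x)) t := by
  have h1 : HasDerivAt (fun z : ℂ => NormedSpace.exp (z • T))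
      (T * NormedSpace.exp ((-(Complex.I * (t : ℂ))) • T)) (-(Complex.I * (t : ℂ))) :=
    hasDerivAt_exp_smul_const' T _
  have h2 : HasDerivAt (fun τ : ℝ => -(Complex.I * (τ : ℂ))) (-(Complex.I * 1)) t :=
    ((HasDerivAt.ofReal_comp (hasDerivAt_id t)).const_mul Complex.I).neg
  have h3 := h1.scomp t h2
  have h4 := ((ContinuousLinearMap.apply ℂ H x).restrictScalars ℝ).hasFDerivAt.comp_hasDerivAt t h3
  refine h4.congr_deriv ?_
  simp [opExp]

/-- Write `A(τ)y(τ) = A(τ)(y(τ) - y(t)) + A(τ)y(t)`. The first term needs only local boundedness and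
strong continuity of `A`; differentiability of `A` is required on the single vector `y(t)`. Norm
differentiability is not available for propagators. -/
lemma hasDerivWithinAt_clm_strong {A : ℝ → H →L[ℂ] H} {I : Set ℝ} {t C : ℝ} {y : ℝ → H} {y' a' : H}
    (hC : ∀ᶠ τ in 𝓝[I] t, ‖A τ‖ ≤ C) (hA : ∀ x, Tendsto (fun τ => A τ x) (𝓝[I] t) (𝓝 (A t x)))
    (hy : HasDerivWithinAt y y' I t) (ha : HasDerivWithinAt (fun τ => A τ (y t)) a' I t) :
    HasDerivWithinAt (fun τ => A τ (y τ)) (A t y' + a') I t := by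
  have h1 : HasDerivWithinAt (fun τ => A τ (y τ - y t)) (A t y') I t := by
    rw [hasDerivWithinAt_iff_tendsto_slope] at hy ⊢
    have hle : 𝓝[I \ {t}] t ≤ 𝓝[I] t := nhdsWithin_mono t sdiff_subset
    have e : ∀ τ, slope (fun τ => A τ (y τ - y t)) t τ = A τ (slope y t τ) := fun τ => by
      simp only [slope, sub_self, map_zero, vsub_eq_sub, sub_zero]
      exact (((A τ).restrictScalars ℝ).map_smul _ _).symm
    simp only [funext e]
    have h2 : Tendsto (fun τ => A τ (slope y t τ - y')) (𝓝[I \ {t}] t) (𝓝 0) := by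
      have h3 := (tendsto_iff_norm_sub_tendsto_zero.1 hy).const_mul C
      rw [mul_zero] at h3
      refine squeeze_zero_norm' ?_ h3
      filter_upwards [hC.filter_mono hle] with τ hτ
      exact (ContinuousLinearMap.le_opNorm _ _).trans
        (mul_le_mul_of_nonneg_right hτ (norm_nonneg _))
    simpa using h2.add ((hA y').mono_left hle)
  refine (h1.add ha).congr_of_eventuallyEq (Eventually.of_forall fun τ => ?_) ?_ <;>
  simp

end Operators

/-! ### Algebraic relations between the Lax operator, Toeplitz operators and the backward shift -/

section Lax

variable {E : Type*} [NormedAddCommGroup E] [InnerProductSpace ℂ E] [CompleteSpace E]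

/-- The Toeplitz operator with kernel `u(n - m)`. -/
def toep (u : ℤ → E →L[ℂ] E) : Seq E →L[ℂ] Seq E := mulOp (fun _ _ => 1) u

/-- The Toeplitz operator conjugated by `1 + n`. -/
def toepW (u : ℤ → E →L[ℂ] E) : Seq E →L[ℂ] Seq E := mulOp (fun n m => wt 1 n / wt 1 m) u

/-- The kernel `w(n)` on the first upper diagonal. -/
def upKer (w : ℕ → ℝ) (n m : ℕ) : E →L[ℂ] E := if m = n + 1 then ((w n : ℝ) : ℂ) • 1 else 0

/-- The backward shift. -/
def bshift : Seq E →L[ℂ] Seq E := kerOp (upKer fun _ => 1)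

/-- The backward shift conjugated by `1 + n`. -/
def bshiftW : Seq E →L[ℂ] Seq E := kerOp (upKer fun n => wt 1 n / wt 1 (n + 1))

lemma dominated_up {w : ℕ → ℝ} (hw : ∀ n, |w n| ≤ 1) :
    Dominated (upKer w : ℕ → ℕ → E →L[ℂ] E) (fun k => if k = -1 then 1 else 0) := by
  refine ⟨summable_of_ne_finset_zero (s := {-1}) fun k hk => ?_, fun n m => ?_⟩
  · rw [if_neg]; simpa using hk
  · unfold upKer
    by_cases h : m = n + 1
    · subst h
      rw [if_pos rfl, if_pos (by push_cast; ring), norm_smul, Complex.norm_real]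
      calc _ ≤ |w n| * 1 := mul_le_mul_of_nonneg_left ContinuousLinearMap.norm_id_le (abs_nonneg _)
        _ ≤ 1 := by rw [mul_one]; exact hw n
    · rw [if_neg h, norm_zero]
      split_ifs <;> simp

lemma kerOp_up_apply {w : ℕ → ℝ} (hw : ∀ n, |w n| ≤ 1) (f : Seq E) (n : ℕ) :
    kerOp (upKer w) f n = ((w n : ℝ) : ℂ) • f (n + 1) := by
  rw [kerOp_apply (dominated_up hw), tsum_eq_single (n + 1)]
  · simp [upKer]
  · intro m hm
    simp [upKer, hm]

lemma wt_ratio_le (n : ℕ) : |wt 1 n / wt 1 (n + 1)| ≤ 1 := by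
  rw [abs_of_pos (div_pos (wt_pos 1 n) (wt_pos 1 _)), div_le_one (wt_pos 1 _), wt_one, wt_one]
  push_cast
  linarith

lemma bshift_apply (f : Seq E) (n : ℕ) : bshift f n = f (n + 1) := by
  unfold bshift
  rw [kerOp_up_apply (by simp)]; simp

lemma bshiftW_apply (f : Seq E) (n : ℕ) :
    bshiftW f n = ((wt 1 n / wt 1 (n + 1) : ℝ) : ℂ) • f (n + 1) :=
  kerOp_up_apply wt_ratio_le f n

lemma bshift_iw (f : Seq E) : bshift (iw 1 f) = iw 1 (bshiftW f) := by
  ext n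
  rw [bshift_apply, iw_apply zero_le_one, iw_apply zero_le_one, bshiftW_apply, smul_smul,
    ← Complex.ofReal_mul]
  congr 2
  have := (wt_pos 1 n).ne'
  field_simp

lemma norm_bshift_le (f : Seq E) : ‖bshift f‖ ≤ ‖f‖ := by
  refine Seq.norm_le_of_sum_sq_le (norm_nonneg _) fun s => ?_
  simp only [bshift_apply]
  refine le_trans (le_of_eq ?_) (Seq.sum_sq_le f (s.map ⟨(· + 1), add_left_injective 1⟩))
  simp

lemma abs_one_le_om {p : ℝ} (hp : 0 ≤ p) (n m : ℕ) : |(1 : ℝ)| ≤ 1 * om p ((n : ℤ) - m) := by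
  rw [abs_one, one_mul]; exact one_le_om hp _

lemma abs_ratio_le_om {p : ℝ} (hp : 1 ≤ p) (n m : ℕ) :
    |wt 1 n / wt 1 m| ≤ 1 * om p ((n : ℤ) - m) := by
  rw [one_mul, abs_of_pos (div_pos (wt_pos 1 n) (wt_pos 1 m))]
  exact wt_div_le zero_le_one hp n m

/-- The Toeplitz operator preserves the domain `H¹_+`: the ratio `(1+n)/(1+m)` costs one power of `1
+ |n - m|`, which the weight of order `p ≥ 1` pays for. -/
lemma toep_iw {p : ℝ} (hp : 1 ≤ p) {u : ℤ → E →L[ℂ] E} (hu : WFin p u) (f : Seq E) :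
    toep u (iw 1 f) = iw 1 (toepW u f) := by
  have hp0 : 0 ≤ p := by linarith
  have hb : ∀ n m : ℕ, |(wt 1 m)⁻¹| ≤ 1 * om p ((n : ℤ) - m) := fun n m => by
    rw [one_mul]; exact (abs_inv_wt_le zero_le_one m).trans (one_le_om hp0 _)
  have e1 := hu.mulOp_wtOp (abs_inv_wt_le zero_le_one) (abs_one_le_om hp0) hb (fun n m => one_mul _)
  have e2 := hu.wtOp_mulOp (abs_inv_wt_le zero_le_one) (abs_ratio_le_om hp) hb (fun n m => by
    have := (wt_pos 1 n).ne'
    field_simp)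
  exact congrArg (fun A : Seq E →L[ℂ] Seq E => A f) (e1.trans e2.symm)

lemma toep_sgl {p : ℝ} (hp : 0 ≤ p) {u : ℤ → E →L[ℂ] E} (hu : WFin p u) (m : ℕ) (e : E) (n : ℕ) :
    toep u (sgl m e) n = u ((n : ℤ) - m) e := by
  unfold toep mulOp
  rw [kerOp_sgl (hu.dominated (abs_one_le_om hp))]
  simp [mker]

lemma toep_hasSum {p : ℝ} (hp : 0 ≤ p) {u : ℤ → E →L[ℂ] E} (hu : WFin p u) (f : Seq E) (n : ℕ) :
    HasSum (fun m : ℕ => u ((n : ℤ) - m) (f m)) (toep u f n) := by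
  have := kerOp_hasSum (hu.dominated (abs_one_le_om hp)) f n
  simpa [mker, toep, mulOp] using this

lemma laxS_hasSum {p : ℝ} (hp : 0 ≤ p) {u : ℤ → E →L[ℂ] E} (hu : WFin p u) (f : Seq E) (n : ℕ) :
    HasSum (fun m : ℕ => (-Complex.I * (bmin n m : ℝ)) • u ((n : ℤ) - m) (f m)) (laxS u f n) := by
  have := (kerOp_hasSum (hu.dominated (abs_bmin_le hp)) f n).const_smul (-Complex.I)
  refine this.congr_fun fun m => ?_
  simp only [mker, smul_apply, smul_smul]

lemma laxS_sgl {p : ℝ} (hp : 0 ≤ p) {u : ℤ → E →L[ℂ] E} (hu : WFin p u) (m : ℕ) (e : E) (n : ℕ) :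
    laxS u (sgl m e) n = (-Complex.I * (bmin n m : ℝ)) • u ((n : ℤ) - m) e := by
  unfold laxS mulOp
  rw [smul_apply, lp.coeFn_smul, Pi.smul_apply, kerOp_sgl (hu.dominated (abs_bmin_le hp))]
  simp only [mker, smul_apply, smul_smul]

/-- The row of index `0` vanishes because `min(0, m) = 0`; this is the infinitesimal form of the
conservation of the mean. -/
lemma laxS_apply_zero {p : ℝ} (hp : 0 ≤ p) {u : ℤ → E →L[ℂ] E} (hu : WFin p u) (f : Seq E) :
    laxS u f 0 = 0 := by
  refine (laxS_hasSum hp hu f 0).unique ?_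
  simp [bmin, hasSum_zero]

lemma laxS_sgl_zero {p : ℝ} (hp : 0 ≤ p) {u : ℤ → E →L[ℂ] E} (hu : WFin p u) (e : E) :
    laxS u (sgl 0 e) = 0 := by
  ext n
  rw [laxS_sgl hp hu]
  simp [bmin]

/-- The relation `S^* B = (B - i T) S^*`. -/
lemma bshift_laxS {p : ℝ} (hp : 0 ≤ p) {u : ℤ → E →L[ℂ] E} (hu : WFin p u) (f : Seq E) :
    bshift (laxS u f) = laxS u (bshiftW f) + (-Complex.I) • toep u (bshift (iw 1 f)) := by
  have key : bshift * laxS u = laxS u * bshiftW + (-Complex.I) • (toep u * (bshift * iw 1)) := by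
    refine clm_ext_sgl fun m e => ?_
    ext n
    change bshift (laxS u (sgl m e)) n = (laxS u (bshiftW (sgl m e))
      + (-Complex.I) • toep u (bshift (iw 1 (sgl m e)))) n
    rw [bshift_iw, bshift_apply, laxS_sgl hp hu]
    rcases m with _ | j
    · have : bshiftW (sgl 0 e) = 0 := by
        ext n
        rw [bshiftW_apply, sgl_apply, if_neg (by omega), smul_zero]; rfl
      rw [this]
      simp [bmin]
    · have hb : bshiftW (sgl (j + 1) e) = sgl j (((wt 1 j / wt 1 (j + 1) : ℝ) : ℂ) • e) := by
        ext n
        rw [bshiftW_apply, sgl_apply, sgl_apply]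
        by_cases h : n = j
        · subst h; simp
        · rw [if_neg (by omega), if_neg h, smul_zero]
      have hi : iw 1 (sgl j (((wt 1 j / wt 1 (j + 1) : ℝ) : ℂ) • e))
          = sgl j (((1 / wt 1 (j + 1) : ℝ) : ℂ) • e) := by
        unfold iw
        rw [wtOp_sgl (abs_inv_wt_le zero_le_one), smul_smul, ← Complex.ofReal_mul]
        congr 3
        have := (wt_pos 1 j).ne'
        field_simp
      rw [hb, hi, lp.coeFn_add, Pi.add_apply, lp.coeFn_smul, Pi.smul_apply, laxS_sgl hp hu,
        toep_sgl hp hu, map_smul, map_smul, smul_smul, smul_smul, ← add_smul]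
      have e1 : ((n + 1 : ℕ) : ℤ) - (j + 1 : ℕ) = (n : ℤ) - j := by push_cast; ring
      rw [e1]
      congr 1
      unfold bmin
      rw [mul_assoc, ← mul_add, ← Complex.ofReal_mul, ← Complex.ofReal_add]
      congr 2
      have h1 := (wt_pos 1 j).ne'
      have h2 := (wt_pos 1 (j + 1)).ne'
      -- This is the whole relation: shifting both indices raises the minimum by one, and the extra
      -- one is the term `-iT`.
      have h3 : min (n + 1) (j + 1) = min n j + 1 := by omega
      rw [h3]
      push_cast
      field_simp
  exact congrArg (fun A : Seq E →L[ℂ] Seq E => A f) key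

/-- The commutator relation `[B, T_u] = T_v`, where `u * u = 1` and `v = -(i/2) [u, |D| u]` in terms
of Fourier coefficients. -/
lemma laxS_toepW {p : ℝ} (hp : 1 ≤ p) {u v : ℤ → E →L[ℂ] E} (hu : WFin p u)
    (hsq : ∀ k x, HasSum (fun j : ℤ => u (k - j) (u j x)) (if k = 0 then x else 0))
    (hv : ∀ k x, HasSum (fun j : ℤ => (-(Complex.I / 2) * ((|j| - |k - j| : ℤ) : ℂ)) •
      u (k - j) (u j x)) (v k x))
    {V : Seq E →L[ℂ] Seq E} (hV : ∀ (n m : ℕ) e, V (sgl m e) n = v ((n : ℤ) - m) e) (f : Seq E) :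
    laxS u (toepW u f) = toep u (laxS u f) + V (iw 1 f) := by
  have hp0 : 0 ≤ p := by linarith
  have key : laxS u * toepW u = toep u * laxS u + V * iw 1 := by
    refine clm_ext_sgl fun m e => ?_
    ext n
    change laxS u (toepW u (sgl m e)) n = (toep u (laxS u (sgl m e)) + V (iw 1 (sgl m e))) n
    have hi : iw 1 (sgl m e) = sgl m ((((wt 1 m)⁻¹ : ℝ) : ℂ) • e) := by
      unfold iw
      rw [wtOp_sgl (abs_inv_wt_le zero_le_one)]
    have hT : ∀ j : ℕ, toepW u (sgl m e) j = ((wt 1 j / wt 1 m : ℝ) : ℂ) • u ((j : ℤ) - m) e := by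
      intro j
      unfold toepW mulOp
      rw [kerOp_sgl (hu.dominated (abs_ratio_le_om hp))]
      rfl
    rw [lp.coeFn_add, Pi.add_apply, hi, hV, map_smul, ← sub_eq_iff_eq_add']
    have h1 := (laxS_hasSum hp0 hu (toepW u (sgl m e)) n).sub
      (toep_hasSum hp0 hu (laxS u (sgl m e)) n)
    refine h1.unique ?_
    have h2 : HasSum (fun j : ℤ => (-(Complex.I / 2) * ((|j - m| - |(n : ℤ) - j| : ℤ) : ℂ)) •
        u (n - j) (u (j - m) e)) (v ((n : ℤ) - m) e) := by
      have := (Equiv.subRight (m : ℤ)).hasSum_iff.2 (hv ((n : ℤ) - m) e)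
      refine this.congr_fun fun j => ?_
      simp only [Function.comp, Equiv.subRight_apply, sub_sub_sub_cancel_right]
    -- The difference `min(n, j) - min(j, m)` equals `(|j-m| - |n-j| + (n-m)) / 2`. The surplus
    -- `(n-m) / 2` sums to zero because `u² = 1` has no coefficient off the diagonal and `n - m`
    -- vanishes on it.
    have h3 : HasSum (fun j : ℤ => (-(Complex.I / 2) * (((n : ℤ) - m : ℤ) : ℂ)) •
        u (n - j) (u (j - m) e)) 0 := by
      have := ((Equiv.subRight (m : ℤ)).hasSum_iff.2 (hsq ((n : ℤ) - m) e)).const_smul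
        (-(Complex.I / 2) * (((n : ℤ) - m : ℤ) : ℂ))
      have hz : (-(Complex.I / 2) * (((n : ℤ) - m : ℤ) : ℂ)) •
          (if (n : ℤ) - m = 0 then e else 0) = 0 := by
        split_ifs with h
        · rw [h]; simp
        · simp
      rw [hz] at this
      refine this.congr_fun fun j => ?_
      simp only [Function.comp, Equiv.subRight_apply, sub_sub_sub_cancel_right]
    have h4 := (h2.add h3).const_smul ((((wt 1 m)⁻¹ : ℝ) : ℂ))
    rw [add_zero] at h4
    have hinj : Function.Injective (fun j : ℕ => (j : ℤ)) := Nat.cast_injective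
    rw [← hinj.hasSum_iff] at h4
    · refine h4.congr_fun fun j => ?_
      simp only [Function.comp]
      rw [hT, laxS_sgl hp0 hu, map_smul, map_smul, smul_smul, ← add_smul, ← sub_smul, smul_smul]
      congr 1
      have e1 : (2 * (min n j : ℕ) : ℤ) = n + j - |(n : ℤ) - j| := by
        rcases le_total n j with h | h
        · rw [min_eq_left h, abs_of_nonpos (by omega)]; ring
        · rw [min_eq_right h, abs_of_nonneg (by omega)]; ring
      have e2 : (2 * (min j m : ℕ) : ℤ) = j + m - |(j : ℤ) - m| := by
        rcases le_total j m with h | h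
        · rw [min_eq_left h, abs_of_nonpos (by omega)]; ring
        · rw [min_eq_right h, abs_of_nonneg (by omega)]; ring
      have e3 : (((min n j : ℕ) : ℂ) - (min j m : ℕ)) * 2
          = ((|(j : ℤ) - m| - |(n : ℤ) - j| : ℤ) : ℂ) + (((n : ℤ) - m : ℤ) : ℂ) := by
        have : (((min n j : ℕ) : ℤ) - (min j m : ℕ)) * 2
          = (|(j : ℤ) - m| - |(n : ℤ) - j|) + ((n : ℤ) - m) := by linarith
        exact_mod_cast this
      rw [← mul_add, ← e3]
      unfold bmin
      have hj : ((wt 1 j : ℝ) : ℂ) ≠ 0 := by exact_mod_cast (wt_pos 1 j).ne'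
      have hm : ((wt 1 m : ℝ) : ℂ) ≠ 0 := by exact_mod_cast (wt_pos 1 m).ne'
      generalize min n j = a
      generalize min j m = b
      push_cast
      field_simp
      ring
    -- For `j < 0` the factor `|j-m| - |n-j|` is exactly `-(n-m)` and cancels the surplus. Hence the
    -- sum over `ℤ` for products of functions equals the sum over `ℕ` for products of Toeplitz
    -- operators, with no Hankel correction.
    · intro j hj
      have hneg : j < 0 := by
        by_contra h
        exact hj ⟨j.toNat, Int.toNat_of_nonneg (by omega)⟩
      have : |j - (m : ℤ)| - |(n : ℤ) - j| = -((n : ℤ) - m) := by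
        rw [abs_of_nonpos (by omega), abs_of_nonneg (by omega)]; ring
      have hz : -(Complex.I / 2) * ((-((n : ℤ) - m) : ℤ) : ℂ)
          + -(Complex.I / 2) * (((n : ℤ) - m : ℤ) : ℂ) = 0 := by push_cast; ring
      rw [this, ← add_smul, hz, zero_smul, smul_zero]
  exact congrArg (fun A : Seq E →L[ℂ] Seq E => A f) key

end Lax

/-! ### Intertwining relations along a solution -/

section Flow

variable {E : Type*} [NormedAddCommGroup E] [InnerProductSpace ℂ E] [CompleteSpace E]

/-- A curve of self-adjoint symbols `u` with `u² = 1` which solves `∂ₜ u = -(i/2) [u, |D| u]`,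
in terms of Fourier coefficients. -/
structure IsFlow (p : ℝ) (I : Set ℝ) (u : ℝ → ℤ → E →L[ℂ] E) : Prop extends SymCurveOn p I u where
  sq : ∀ t ∈ I, ∀ k x, HasSum (fun j : ℤ => u t (k - j) (u t j x)) (if k = 0 then x else 0)
  flow : ∀ t ∈ I, ∃ (v : ℤ → E →L[ℂ] E) (V : Seq E →L[ℂ] Seq E),
    (∀ k x, HasSum (fun j : ℤ => (-(Complex.I / 2) * ((|j| - |k - j| : ℤ) : ℂ)) •
      u t (k - j) (u t j x)) (v k x)) ∧
    (∀ (n m : ℕ) e, V (sgl m e) n = v ((n : ℤ) - m) e) ∧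
    ∀ g, HasDerivWithinAt (fun τ => toep (u τ) (iw 1 g)) (V (iw 1 g)) I t

lemma SymCurveOn.tendsto_toep {p : ℝ} (hp : 0 ≤ p) {I : Set ℝ} {u : ℝ → ℤ → E →L[ℂ] E}
    (hu : SymCurveOn p I u) {t : ℝ} (ht : t ∈ I) :
    Tendsto (fun τ => toep (u τ)) (𝓝[I] t) (𝓝 (toep (u t))) := by
  rw [tendsto_iff_norm_sub_tendsto_zero]
  refine squeeze_zero' (Eventually.of_forall fun _ => norm_nonneg _) ?_ (hu.cont t ht)
  filter_upwards [self_mem_nhdsWithin] with τ hτ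
  unfold toep
  rw [← (hu.fin τ hτ).mulOp_sub_right (hu.fin t ht) (abs_one_le_om hp)]
  simpa using ((hu.fin τ hτ).sub (hu.fin t ht)).norm_mulOp_le (abs_one_le_om hp)

lemma re_inner_neg_I_toep {p : ℝ} (hp : 0 ≤ p) {u : ℤ → E →L[ℂ] E} (hu : WFin p u) (hs : IsSymm u)
    (f : Seq E) : (inner ℂ (((-Complex.I) • toep u) f) f).re = 0 :=
  hs.re_inner_mulOp hu (abs_one_le_om hp) (fun _ _ => rfl) f

lemma norm_eq_of_mem_unitary {H : Type*} [NormedAddCommGroup H] [InnerProductSpace ℂ H]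
    [CompleteSpace H] {A : H →L[ℂ] H} (hA : A ∈ unitary (H →L[ℂ] H)) (f : H) : ‖A f‖ = ‖f‖ :=
  A.norm_map_iff_adjoint_comp_self.2 (Unitary.mem_iff.1 hA).1 f

lemma norm_le_one_of_mem_unitary {H : Type*} [NormedAddCommGroup H] [InnerProductSpace ℂ H]
    [CompleteSpace H] {A : H →L[ℂ] H} (hA : A ∈ unitary (H →L[ℂ] H)) : ‖A‖ ≤ 1 :=
  ContinuousLinearMap.opNorm_le_bound _ zero_le_one fun f => by
    rw [norm_eq_of_mem_unitary hA, one_mul]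

/-- The intertwining relation `T_{u(t)} P(t) = P(t) T_{u(0)}`. -/
theorem IsFlow.toep_comm {p : ℝ} (hp : 1 ≤ p) {I : Set ℝ} (hI : I.OrdConnected)
    (h0 : (0 : ℝ) ∈ I) {u : ℝ → ℤ → E →L[ℂ] E} (hu : IsFlow p I u)
    {P : ℝ → Seq E →L[ℂ] Seq E} (hP : IsEvol I u P) {t : ℝ} (ht : t ∈ I) (f : Seq E) :
    toep (u t) (P t f) = P t (toep (u 0) f) := by
  have hp0 : 0 ≤ p := by linarith
  suffices h : toep (u t) * P t = P t * toep (u 0) from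
    congrArg (fun A : Seq E →L[ℂ] Seq E => A f) h
  refine clm_eq_of_iw fun g => ?_
  -- Both curves solve `y' = By`: for `T_u P g` the product rule gives `T_{∂_t u} P g + T_u B P g`,
  -- which is `B T_u P g` by the commutator relation.
  refine evolution_unique hp0 hI hu.toSymCurveOn (K := 0) (by simp)
    (y := fun t => toep (u t) (P t (iw 1 g))) (z := fun t => P t (toep (u 0) (iw 1 g)))
    (fun t ht => ?_) (fun t ht => ?_) h0 (by simp [hP.init]) ht
  · obtain ⟨h, h1, h2⟩ := hP.deriv t ht g
    obtain ⟨v, V, hv, hV, hd⟩ := hu.flow t ht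
    refine ⟨toepW (u t) h, by rw [h1, toep_iw hp (hu.fin t ht)], ?_⟩
    have hT := hu.tendsto_toep hp0 ht
    have hb : ∀ᶠ τ in 𝓝[I] t, ‖toep (u τ)‖ ≤ ‖toep (u t)‖ + 1 := by
      filter_upwards [hT.norm.eventually (gt_mem_nhds (lt_add_one _))] with τ hτ using hτ.le
    have h3 : HasDerivWithinAt (fun τ => toep (u τ) (P t (iw 1 g))) (V (iw 1 h)) I t := by
      rw [h1]; exact hd h
    have h4 := hasDerivWithinAt_clm_strong hb
      (fun x => ((ContinuousLinearMap.apply ℂ (Seq E) x).continuous.tendsto _).comp hT) h2 h3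
    rw [laxS_toepW hp (hu.fin t ht) (hu.sq t ht) hv hV]
    refine h4.congr_deriv ?_
    simp
  · rw [toep_iw hp (hu.fin 0 h0)]
    simpa using hP.deriv t ht (toepW (u 0) g)

/-- The unitary group `e^{-itA}`. -/
abbrev expI {H : Type*} [NormedAddCommGroup H] [NormedSpace ℂ H] (A : H →L[ℂ] H) (t : ℝ) :
    H →L[ℂ] H := opExp ((-(Complex.I * (t : ℂ))) • A)

lemma expI_zero {H : Type*} [NormedAddCommGroup H] [NormedSpace ℂ H] (A : H →L[ℂ] H) :
    expI A 0 = 1 := by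
  simp [expI, opExp]

lemma norm_expI {H : Type*} [NormedAddCommGroup H] [InnerProductSpace ℂ H] [CompleteSpace H]
    {A : H →L[ℂ] H} (hA : ∀ f, (inner ℂ (((-Complex.I) • A) f) f).re = 0) (t : ℝ) (f : H) :
    ‖expI A t f‖ = ‖f‖ := by
  have := norm_eq_of_skew (I := univ) ordConnected_univ (y := fun t => expI A t f)
    (fun t _ => (hasDerivAt_opExp A f t).hasDerivWithinAt) (fun t _ => hA _) (mem_univ t)
    (mem_univ 0)
  simpa [expI_zero] using this

/-- The intertwining relation `S^* P(t) = P(t) e^{-itT_{u(0)}} S^*`. -/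
theorem IsFlow.bshift_comm {p : ℝ} (hp : 1 ≤ p) {I : Set ℝ} (hI : I.OrdConnected)
    (h0 : (0 : ℝ) ∈ I) {u : ℝ → ℤ → E →L[ℂ] E} (hu : IsFlow p I u)
    {P : ℝ → Seq E →L[ℂ] Seq E} (hP : IsEvol I u P)
    (hPu : ∀ t ∈ I, P t ∈ unitary (Seq E →L[ℂ] Seq E)) {t : ℝ} (ht : t ∈ I) (f : Seq E) :
    bshift (P t f) = P t (expI (toep (u 0)) t (bshift f)) := by
  have hp0 : 0 ≤ p := by linarith
  suffices h : bshift * P t = P t * (expI (toep (u 0)) t * bshift) from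
    congrArg (fun A : Seq E →L[ℂ] Seq E => A f) h
  refine clm_eq_of_iw fun g => ?_
  -- The exponential preserves the domain, because `T_{u(0)}` is intertwined with the bounded
  -- operator `toepW` there.
  have hexp : ∀ t x, expI (toep (u 0)) t (iw 1 x) = iw 1 (expI (toepW (u 0)) t x) := fun t x => by
    have := opExp_intertwine (A := (-(Complex.I * (t : ℂ))) • toep (u 0))
      (B := (-(Complex.I * (t : ℂ))) • toepW (u 0)) (J := iw 1) (by
        ext1 y
        change (-(Complex.I * (t : ℂ))) • toep (u 0) (iw 1 y)
          = iw 1 ((-(Complex.I * (t : ℂ))) • toepW (u 0) y)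
        rw [toep_iw hp (hu.fin 0 h0), map_smul])
    exact congrArg (fun A : Seq E →L[ℂ] Seq E => A x) this
  -- Both curves solve `y' = By - iT_{u(t)} y`. For the first this is the shift relation; for the
  -- second the derivative of the exponential gives `P(t)(-iT_{u(0)})`, which `IsFlow.toep_comm`
  -- turns into `-iT_{u(t)} P(t)`.
  refine evolution_unique hp0 hI hu.toSymCurveOn (K := fun t => (-Complex.I) • toep (u t))
    (fun t ht => re_inner_neg_I_toep hp0 (hu.fin t ht) (hu.symm t ht))
    (y := fun t => bshift (P t (iw 1 g)))
    (z := fun t => P t (expI (toep (u 0)) t (bshift (iw 1 g))))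
    (fun t ht => ?_) (fun t ht => ?_) h0 (by simp [hP.init, expI_zero]) ht
  · obtain ⟨h, h1, h2⟩ := hP.deriv t ht g
    refine ⟨bshiftW h, by rw [h1, bshift_iw], ?_⟩
    have h3 := (bshift.restrictScalars ℝ).hasFDerivAt.comp_hasDerivWithinAt t h2
    refine h3.congr_deriv ?_
    change bshift (laxS (u t) h) = _
    rw [bshift_laxS hp0 (hu.fin t ht), h1]
    rfl
  · obtain ⟨h, h1, h2⟩ := hP.deriv t ht (expI (toepW (u 0)) t (bshiftW g))
    have e1 : expI (toep (u 0)) t (bshift (iw 1 g)) = iw 1 (expI (toepW (u 0)) t (bshiftW g)) := by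
      rw [bshift_iw, hexp]
    refine ⟨h, by rw [e1, h1], ?_⟩
    have h3 := hasDerivWithinAt_clm_strong (A := P) (C := 1)
      (y := fun t => expI (toep (u 0)) t (bshift (iw 1 g)))
      (by filter_upwards [self_mem_nhdsWithin] with τ hτ using norm_le_one_of_mem_unitary (hPu τ hτ))
      (fun x => hP.cont x t ht)
      ((hasDerivAt_opExp (toep (u 0)) (bshift (iw 1 g)) t).hasDerivWithinAt) (by rw [e1]; exact h2)
    refine h3.congr_deriv ?_
    rw [map_smul, ← hu.toep_comm hp hI h0 hP ht, add_comm]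
    rfl

/-- The mean is preserved by the propagator. -/
theorem IsEvol.apply_zero {p : ℝ} (hp : 0 ≤ p) {I : Set ℝ} (hI : I.OrdConnected)
    (h0 : (0 : ℝ) ∈ I) {u : ℝ → ℤ → E →L[ℂ] E} (hu : SymCurveOn p I u)
    {P : ℝ → Seq E →L[ℂ] Seq E} (hP : IsEvol I u P) {t : ℝ} (ht : t ∈ I) (f : Seq E) :
    P t f 0 = f 0 := by
  let ev : Seq E →L[ℂ] E := lp.evalCLM ℂ (fun _ : ℕ => E) 2 0
  have hd := (iw_denseRange (E := E) zero_le_one).equalizer (ev ∘L P t).continuous ev.continuous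
    (funext fun g => by
      have hy : ∀ t ∈ I, HasDerivWithinAt (fun t => ev (P t (iw 1 g)) - ev (iw 1 g)) 0 I t := by
        intro t ht
        obtain ⟨h, h1, h2⟩ := hP.deriv t ht g
        have h3 := (ev.restrictScalars ℝ).hasFDerivAt.comp_hasDerivWithinAt t h2
        refine (h3.sub_const (ev (iw 1 g))).congr_deriv ?_
        exact laxS_apply_zero hp (hu.fin t ht) h
      have := norm_eq_of_skew hI hy (fun t _ => by simp) ht h0
      simpa [hP.init, sub_eq_zero] using this)
  exact congrFun hd f

lemma iterate_bshift_apply (f : Seq E) (n : ℕ) : (bshift ^ n) f 0 = f n := by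
  suffices h : ∀ k, (bshift ^ n) f k = f (n + k) by simpa using h 0
  induction n with
  | zero => simp
  | succ n ih =>
    intro k
    rw [pow_succ']
    change bshift ((bshift ^ n) f) k = _
    rw [bshift_apply, ih, show n + (k + 1) = n + 1 + k by omega]

/-- The Fourier coefficients of `P(t) f`. -/
theorem IsFlow.coeff_formula {p : ℝ} (hp : 1 ≤ p) {I : Set ℝ} (hI : I.OrdConnected)
    (h0 : (0 : ℝ) ∈ I) {u : ℝ → ℤ → E →L[ℂ] E} (hu : IsFlow p I u)
    {P : ℝ → Seq E →L[ℂ] Seq E} (hP : IsEvol I u P)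
    (hPu : ∀ t ∈ I, P t ∈ unitary (Seq E →L[ℂ] Seq E)) {t : ℝ} (ht : t ∈ I) (f : Seq E) (n : ℕ) :
    P t f n = ((expI (toep (u 0)) t * bshift) ^ n : Seq E →L[ℂ] Seq E) f 0 := by
  have h : bshift * P t = P t * (expI (toep (u 0)) t * bshift) := by
    ext1 f
    exact hu.bshift_comm hp hI h0 hP hPu ht f
  have hn : bshift ^ n * P t = P t * (expI (toep (u 0)) t * bshift) ^ n := by
    induction n with
    | zero => simp
    | succ n ih => rw [pow_succ, mul_assoc, h, ← mul_assoc, ih, mul_assoc, ← pow_succ]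
  rw [← iterate_bshift_apply, ← hP.apply_zero (by linarith) hI h0 hu.toSymCurveOn ht
    (((expI (toep (u 0)) t * bshift) ^ n : Seq E →L[ℂ] Seq E) f)]
  exact congrArg (fun A : Seq E →L[ℂ] Seq E => A f 0) hn

lemma iw_sgl_zero (e : E) : iw 1 (sgl 0 e) = sgl 0 e := by
  unfold iw
  rw [wtOp_sgl (abs_inv_wt_le zero_le_one), wt_one]
  simp

/-- The propagator fixes constants. -/
theorem IsEvol.apply_const {p : ℝ} (hp : 0 ≤ p) {I : Set ℝ} (hI : I.OrdConnected)
    (h0 : (0 : ℝ) ∈ I) {u : ℝ → ℤ → E →L[ℂ] E} (hu : SymCurveOn p I u)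
    {P : ℝ → Seq E →L[ℂ] Seq E} (hP : IsEvol I u P) {t : ℝ} (ht : t ∈ I) (e : E) :
    P t (sgl 0 e) = sgl 0 e := by
  refine evolution_unique hp hI hu (K := 0) (by simp) (y := fun t => P t (sgl 0 e))
    (z := fun _ => sgl 0 e) (fun t ht => ?_) (fun t ht => ⟨sgl 0 e, (iw_sgl_zero e).symm, ?_⟩) h0
    (by simp [hP.init]) ht
  · have := hP.deriv t ht (sgl 0 e)
    rw [iw_sgl_zero] at this
    simpa using this
  · rw [laxS_sgl_zero hp (hu.fin t ht)]
    exact (hasDerivWithinAt_const t I (sgl 0 e)).congr_deriv (by simp)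

end Flow

section Fourier

variable {d : ℕ}

/-! ### Fourier series in `L²(𝕋; ℂ^{d × d})` -/

/-- The continuous function `θ ↦ e^{inθ} A`. -/
def monoC (n : ℤ) (A : MatE d) : C(Circ, MatE d) :=
  ⟨fun θ => fourier n θ • A, (map_continuous (fourier n)).smul continuous_const⟩

lemma mono_eq (n : ℤ) (A : MatE d) : mono n A = ContinuousMap.toLp 2 circMeasure ℂ (monoC n A) := rfl

lemma mono_coeFn (n : ℤ) (A : MatE d) : mono n A =ᵐ[circMeasure] fun θ => fourier n θ • A :=
  ContinuousMap.coeFn_toLp circMeasure (monoC n A)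

lemma norm_fourier_apply (n : ℤ) (θ : Circ) : ‖fourier n θ‖ = 1 := by
  rw [fourier_apply, Circle.norm_coe]

lemma coeff_mono (n : ℤ) (A : MatE d) (k : ℤ) : coeff (mono n A) k = if k = n then A else 0 := by
  unfold coeff
  rw [fourierCoeff_congr_ae (mono_coeFn n A)]
  have h := congrFun (fourierCoeff_fourier (T := 2 * π) n) k
  unfold fourierCoeff at h ⊢
  simp only [smul_smul]
  simp only [smul_eq_mul] at h
  rw [integral_smul_const, h, Pi.single_apply]
  split_ifs <;> simp

lemma inner_mono_left (n : ℤ) (A : MatE d) (F : L2 d) :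
    inner ℂ (mono n A) F = inner ℂ A (coeff F n) := by
  rw [L2.inner_def]
  unfold coeff fourierCoeff
  rw [← integral_inner (((integrable_L2 F).fourier_smul (-n)))]
  refine integral_congr_ae ?_
  filter_upwards [mono_coeFn n A] with θ hθ
  rw [hθ, inner_smul_left, inner_smul_right, fourier_neg]

lemma mono_add (n : ℤ) (A B : MatE d) : mono n (A + B) = mono n A + mono n B := by
  rw [mono_eq, mono_eq, mono_eq, ← map_add]
  congr 1
  ext θ : 1
  simp [monoC]

lemma mono_smul (n : ℤ) (c : ℂ) (A : MatE d) : mono n (c • A) = c • mono n A := by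
  rw [mono_eq, mono_eq, ← map_smul]
  congr 1
  ext θ : 1
  exact smul_comm (fourier n θ) c A

lemma norm_mono (n : ℤ) (A : MatE d) : ‖mono n A‖ = ‖A‖ := by
  have h : inner ℂ (mono n A) (mono n A) = inner ℂ A A := by
    rw [inner_mono_left, coeff_mono, if_pos rfl]
  rw [inner_self_eq_norm_sq_to_K, inner_self_eq_norm_sq_to_K] at h
  have h2 : ‖mono n A‖ ^ 2 = ‖A‖ ^ 2 := by exact_mod_cast h
  exact (sq_eq_sq₀ (norm_nonneg _) (norm_nonneg _)).1 h2

/-- Each matrix entry is a scalar function, so the claim reduces to completeness of the scalar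
Fourier basis. -/
lemma coeff_ext {F G : L2 d} (h : ∀ n, coeff F n = coeff G n) : F = G := by
  suffices H : ∀ F : L2 d, (∀ n, coeff F n = 0) → F = 0 by
    refine sub_eq_zero.1 (H (F - G) fun n => ?_)
    have := map_sub (coeffL d n) F G
    change coeff (F - G) n = coeff F n - coeff G n at this
    rw [this, h, sub_self]
  intro F hF
  have hp : ∀ p : Fin d × Fin d, ∀ᵐ θ ∂circMeasure, (F θ) p = 0 := by
    intro p
    let L : MatE d →L[ℂ] ℂ := EuclideanSpace.proj p
    let f : Lp ℂ 2 circMeasure := L.compLp F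
    have hf : (f : Circ → ℂ) =ᵐ[circMeasure] fun θ => L (F θ) := L.coeFn_compLp F
    have h0 : fourierBasis.repr f = 0 := by
      ext n
      rw [fourierBasis_repr, fourierCoeff_congr_ae hf]
      have := L.integral_comp_comm ((integrable_L2 F).fourier_smul (-n))
      simp only [map_smul] at this
      unfold fourierCoeff
      rw [this]
      change L (coeff F n) = 0
      rw [hF, map_zero]
    have h1 : f = 0 := by simpa using h0
    have h2 : (f : Circ → ℂ) =ᵐ[circMeasure] 0 := by rw [h1]; exact Lp.coeFn_zero _ _ _
    filter_upwards [hf, h2] with θ a b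
    rw [b] at a
    exact a.symm
  rw [Lp.eq_zero_iff_ae_eq_zero]
  filter_upwards [ae_all_iff.2 hp] with θ hθ
  ext p
  exact hθ p

/-- The isometric embedding `A ↦ e^{inθ} A`. -/
def monoI (d : ℕ) (n : ℤ) : MatE d →ₗᵢ[ℂ] L2 d where
  toFun := mono n
  map_add' := mono_add n
  map_smul' := fun c A => mono_smul n c A
  norm_map' := norm_mono n

lemma orthogonalFamily_mono : OrthogonalFamily ℂ (fun _ : ℤ => MatE d) (monoI d) := by
  intro n m hnm A B
  change inner ℂ (mono n A) (mono m B) = 0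
  rw [inner_mono_left, coeff_mono, if_neg hnm, inner_zero_right]

lemma coeff_of_hasSum {c : ℤ → MatE d} {F : L2 d} (h : HasSum (fun n => mono n (c n)) F) (k : ℤ) :
    coeff F k = c k := by
  have h1 := h.mapL (coeffL d k)
  refine h1.unique ?_
  have h2 : (fun n => (coeffL d k) (mono n (c n))) = fun n => if n = k then c k else 0 := by
    ext1 n
    change coeff (mono n (c n)) k = _
    rw [coeff_mono]
    by_cases h : n = k
    · subst h; simp
    · rw [if_neg (Ne.symm h), if_neg h]
  rw [h2]
  exact hasSum_ite_eq k (c k)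

lemma summable_mono_of_sq {c : ℤ → MatE d} (h : Summable fun n => ‖c n‖ ^ 2) :
    Summable fun n => mono n (c n) := by
  let f : lp (fun _ : ℤ => MatE d) 2 := ⟨c, memℓp_gen (by simpa using h)⟩
  exact (orthogonalFamily_mono (d := d)).summable_of_lp f

lemma summable_mono_of_norm {c : ℤ → MatE d} (h : Summable fun n => ‖c n‖) :
    Summable fun n => mono n (c n) :=
  Summable.of_norm (by simpa only [norm_mono] using h)

/-- An element of `L²` with absolutely summable Fourier coefficients is a continuous function. -/
lemma ae_eq_continuous {G : L2 d} (h : Summable fun k => ‖coeff G k‖) :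
    ∃ g : C(Circ, MatE d), G =ᵐ[circMeasure] g ∧
      ∀ θ, HasSum (fun k : ℤ => fourier k θ • coeff G k) (g θ) := by
  have hs : Summable fun k => monoC k (coeff G k) := by
    refine Summable.of_norm_bounded h fun k => ?_
    refine (ContinuousMap.norm_le _ (norm_nonneg _)).2 fun θ => ?_
    change ‖fourier k θ • coeff G k‖ ≤ _
    rw [norm_smul, norm_fourier_apply, one_mul]
  refine ⟨∑' k, monoC k (coeff G k), ?_, fun θ => ?_⟩
  · have h1 := hs.hasSum.mapL (ContinuousMap.toLp (E := MatE d) 2 circMeasure ℂ)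
    have h2 : G = ContinuousMap.toLp (E := MatE d) 2 circMeasure ℂ (∑' k, monoC k (coeff G k)) :=
      coeff_ext fun n => (coeff_of_hasSum h1 n).symm
    have h3 := ContinuousMap.coeFn_toLp (p := 2) (𝕜 := ℂ) circMeasure (∑' k, monoC k (coeff G k))
    rwa [← h2] at h3
  · exact hs.hasSum.mapL (ContinuousMap.evalCLM ℂ θ)

lemma memLp_top_of_summable {G : L2 d} (h : Summable fun k => ‖coeff G k‖) :
    MemLp (G : Circ → MatE d) ∞ circMeasure := by
  obtain ⟨g, hg, -⟩ := ae_eq_continuous h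
  refine memLp_top_of_bound (Lp.aestronglyMeasurable G) ‖g‖ ?_
  filter_upwards [hg] with θ hθ
  rw [hθ]
  exact g.norm_coe_le_norm θ

/-- Fourier coefficients of a product. -/
lemma coeff_mul_hasSum {G F Q : L2 d} (h : Summable fun k => ‖coeff G k‖)
    (hQ : Q =ᵐ[circMeasure] fun θ => mulE d (G θ) (F θ)) (n : ℤ) :
    HasSum (fun m => mulE d (coeff G (n - m)) (coeff F m)) (coeff Q n) := by
  obtain ⟨g, hg, hsum⟩ := ae_eq_continuous h
  have hint : ∀ k, Integrable (fun θ => mulE d (coeff G k) (fourier (-(n - k)) θ • F θ))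
      circMeasure := fun k =>
    (mulE d (coeff G k)).integrable_comp ((integrable_L2 F).fourier_smul _)
  have hF := integrable_L2 F
  -- Absolute summability of the coefficients of `G` allows the exchange of sum and integral for an
  -- `F` that is merely in `L²`.
  have h1 := hasSum_integral_of_summable_integral_norm hint (by
    refine Summable.of_nonneg_of_le (fun k => integral_nonneg fun θ => norm_nonneg _) (fun k => ?_)
      ((h.mul_left ‖mulE d‖).mul_right (∫ θ, ‖F θ‖ ∂circMeasure))
    rw [← integral_const_mul]
    refine integral_mono (hint k).norm (hF.norm.const_mul _) fun θ => ?_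
    refine ((mulE d (coeff G k)).le_opNorm _).trans ?_
    rw [norm_smul, norm_fourier_apply, one_mul]
    exact mul_le_mul_of_nonneg_right ((mulE d).le_opNorm _) (norm_nonneg _))
  have h2 : ∫ θ, ∑' k, mulE d (coeff G k) (fourier (-(n - k)) θ • F θ) ∂circMeasure = coeff Q n := by
    unfold coeff
    rw [fourierCoeff_congr_ae hQ]
    unfold fourierCoeff
    refine integral_congr_ae ?_
    filter_upwards [hg] with θ hθ
    have h3 := ((hsum θ).mapL ((mulE d).flip (fourier (-n) θ • F θ))).tsum_eq
    simp only [ContinuousLinearMap.flip_apply, map_smul, smul_apply] at h3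
    rw [hθ, ← h3]
    refine tsum_congr fun k => ?_
    rw [map_smul, smul_smul, ← fourier_add, show -(n - k) = k + -n by ring]
    rfl
  rw [h2] at h1
  have h3 := (Equiv.subLeft n).hasSum_iff.2 h1
  refine h3.congr_fun fun m => ?_
  simp only [Function.comp, Equiv.subLeft_apply]
  rw [(mulE d (coeff G (n - m))).integral_comp_comm ((integrable_L2 F).fourier_smul _)]
  simp only [sub_sub_cancel]
  rfl

/-! ### The Hardy space as a sequence space -/

lemma mono_mem_hardy (n : ℕ) (A : MatE d) : mono (n : ℤ) A ∈ hardy d := by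
  intro k hk
  rw [coeff_mono, if_neg (by omega)]

/-- The isometric embedding `A ↦ e^{inθ} A` into the Hardy space. -/
def monoH (d : ℕ) (n : ℕ) : MatE d →ₗᵢ[ℂ] hardy d where
  toFun := fun A => ⟨mono n A, mono_mem_hardy n A⟩
  map_add' := fun A B => Subtype.ext (mono_add n A B)
  map_smul' := fun c A => Subtype.ext (mono_smul n c A)
  norm_map' := norm_mono n

lemma isHilbertSum_monoH (d : ℕ) : IsHilbertSum ℂ (fun _ : ℕ => MatE d) (monoH d) := by
  refine IsHilbertSum.mk (fun n m hnm A B => ?_) ?_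
  · exact orthogonalFamily_mono (d := d) (show (n : ℤ) ≠ m by exact_mod_cast hnm) A B
  · rw [top_le_iff, Submodule.topologicalClosure_eq_top_iff, Submodule.eq_bot_iff]
    intro F hF
    refine Subtype.ext (coeff_ext fun n => ?_)
    have h0 : coeff ((0 : hardy d) : L2 d) n = 0 := map_zero (coeffL d n)
    rw [h0]
    rcases lt_or_ge n 0 with hn | hn
    · exact F.2 n hn
    · refine ext_inner_left ℂ fun A => ?_
      rw [inner_zero_right, ← inner_mono_left]
      have hm : monoH d n.toNat A ∈ ⨆ i, LinearMap.range (monoH d i).toLinearMap :=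
        Submodule.mem_iSup_of_mem n.toNat ⟨A, rfl⟩
      have := Submodule.mem_orthogonal _ F |>.1 hF _ hm
      rw [← Int.toNat_of_nonneg hn]
      exact this

/-- The Fourier transform `L²_+ ≃ ℓ²(ℕ; ℂ^{d × d})`. -/
def four (d : ℕ) : hardy d ≃ₗᵢ[ℂ] Seq (MatE d) := (isHilbertSum_monoH d).linearIsometryEquiv

lemma four_symm_sgl (n : ℕ) (A : MatE d) : (four d).symm (sgl n A) = monoH d n A :=
  (isHilbertSum_monoH d).linearIsometryEquiv_symm_apply_single A

lemma four_apply (F : hardy d) (n : ℕ) : four d F n = coeff (F : L2 d) n := by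
  refine ext_inner_left ℂ fun A => ?_
  rw [← inner_mono_left, ← lp.inner_single_left (G := fun _ : ℕ => MatE d) n A]
  have h := (four d).symm.inner_map_map (sgl n A) (four d F)
  rw [four_symm_sgl, LinearIsometryEquiv.symm_apply_apply] at h
  exact h.symm

lemma coeff_szego (F : L2 d) (n : ℕ) : coeff (szego d F : L2 d) n = coeff F n := by
  refine ext_inner_left ℂ fun A => ?_
  rw [← inner_mono_left, ← inner_mono_left]
  exact Submodule.inner_orthogonalProjectionOnto_eq_of_mem_left
    (⟨mono n A, mono_mem_hardy n A⟩ : hardy d) F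

end Fourier

section Dictionary

variable {d : ℕ}

/-- The Fourier coefficients of `V`, acting by left multiplication. -/
def symb (V : L2 d) (k : ℤ) : MatE d →L[ℂ] MatE d := mulE d (coeff V k)

lemma wfin_symb {p : ℝ} {V : L2 d} (h : Summable fun k => om p k * ‖coeff V k‖) :
    WFin p (symb V) := by
  refine Summable.of_nonneg_of_le (fun k => mul_nonneg (om_pos p k).le (norm_nonneg _)) (fun k => ?_)
    (h.mul_left ‖mulE d‖)
  rw [← mul_assoc, mul_comm ‖mulE d‖, mul_assoc]
  exact mul_le_mul_of_nonneg_left ((mulE d).le_opNorm _) (om_pos p k).le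

lemma summable_coeff_of_om {p : ℝ} (hp : 0 ≤ p) {V : L2 d}
    (h : Summable fun k => om p k * ‖coeff V k‖) : Summable fun k => ‖coeff V k‖ :=
  Summable.of_nonneg_of_le (fun _ => norm_nonneg _)
    (fun k => le_mul_of_one_le_left (norm_nonneg _) (one_le_om hp k)) h

/-! ### Toeplitz operators -/

lemma exists_toeplitz {V : L2 d} (hV : MemLp (V : Circ → MatE d) ∞ circMeasure) (F : hardy d) :
    ∃ Q : L2 d, (Q =ᵐ[circMeasure] fun θ => mulE d (V θ) ((F : L2 d) θ)) ∧
      toeplitz V F = szego d Q := by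
  refine ⟨(mulE d).holder 2 (hV.toLp V) (F : L2 d), ?_, ?_⟩
  · have h1 := (mulE d).coeFn_holder (r := 2) (hV.toLp V) (F : L2 d)
    filter_upwards [h1, hV.coeFn_toLp] with θ a b
    rw [a, b]
  · unfold toeplitz
    rw [dif_pos hV]
    rfl

lemma four_szego_apply (F : L2 d) (n : ℕ) : four d (szego d F) n = coeff F n := by
  rw [four_apply, coeff_szego]

/-- The convolution over `ℤ` collapses to `ℕ` because the negative coefficients of `F` vanish. -/
lemma four_toeplitz {p : ℝ} (hp : 0 ≤ p) {V : L2 d} (h : Summable fun k => om p k * ‖coeff V k‖)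
    (F : hardy d) : four d (toeplitz V F) = toep (symb V) (four d F) := by
  have hs := summable_coeff_of_om hp h
  obtain ⟨Q, hQ, hT⟩ := exists_toeplitz (memLp_top_of_summable hs) F
  ext n : 2
  rw [hT, four_szego_apply]
  have h1 := coeff_mul_hasSum hs hQ n
  have hinj : Function.Injective (fun j : ℕ => (j : ℤ)) := Nat.cast_injective
  rw [← hinj.hasSum_iff] at h1
  · refine h1.unique ((toep_hasSum hp (wfin_symb h) (four d F) n).congr_fun fun m => ?_)
    simp only [Function.comp, four_apply]
    rfl
  · intro j hj
    have hneg : j < 0 := by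
      by_contra h
      exact hj ⟨j.toNat, Int.toNat_of_nonneg (by omega)⟩
    rw [F.2 j hneg, map_zero]

/-- On monomials a bounded symbol suffices, without summable coefficients. It is applied to `∂_t U`,
which is used only as a bounded function. -/
lemma four_toeplitz_mono {V : L2 d} (hV : MemLp (V : Circ → MatE d) ∞ circMeasure) (m : ℕ)
    (A : MatE d) (n : ℕ) : four d (toeplitz V (monoH d m A)) n = symb V ((n : ℤ) - m) A := by
  obtain ⟨Q, hQ, hT⟩ := exists_toeplitz hV (monoH d m A)
  rw [hT, four_szego_apply]
  unfold coeff
  rw [fourierCoeff_congr_ae hQ]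
  have h1 := ((mulE d).flip A).integral_comp_comm
    ((integrable_L2 V).fourier_smul (-((n : ℤ) - m)))
  simp only [ContinuousLinearMap.flip_apply] at h1
  change _ = mulE d (coeff V ((n : ℤ) - m)) A
  unfold coeff fourierCoeff
  rw [← h1]
  refine integral_congr_ae ?_
  filter_upwards [mono_coeFn (m : ℤ) A] with θ hθ
  have hθ' : ((monoH d m A : hardy d) : L2 d) θ = fourier (m : ℤ) θ • A := hθ
  rw [hθ', map_smul, smul_smul, ← fourier_add, map_smul, smul_apply,
    show -((n : ℤ) - m) = -n + m by ring]

lemma four_backShift (F : hardy d) : four d (backShift d F) = bshift (four d F) := by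
  have hone : ∀ A : MatE d, mulE d (ofMat 1) A = A := fun A => by
    change ofMat (toMat (ofMat 1) * toMat A) = A
    have : toMat (ofMat (1 : Matrix (Fin d) (Fin d) ℂ)) = 1 := rfl
    rw [this, one_mul]
    rfl
  have hs : Summable fun k => om 0 k * ‖coeff (mono 1 (ofMat 1) : L2 d) k‖ := by
    refine summable_of_ne_finset_zero (s := {1}) fun k hk => ?_
    rw [coeff_mono, if_neg (by simpa using hk), norm_zero, mul_zero]
  ext n : 2
  refine ext_inner_left ℂ fun A => ?_
  rw [bshift_apply, four_apply, four_apply, ← inner_mono_left, ← inner_mono_left]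
  have h1 : inner ℂ (monoH d n A) (backShift d F) = inner ℂ (shift d (monoH d n A)) F :=
    ContinuousLinearMap.adjoint_inner_right _ _ _
  have h2 : shift d (monoH d n A) = monoH d (n + 1) A := by
    refine (four d).injective ?_
    unfold shift
    ext k : 2
    rw [four_toeplitz_mono (memLp_top_of_summable (summable_coeff_of_om le_rfl hs)), four_apply]
    change mulE d (coeff (mono 1 (ofMat 1)) ((k : ℤ) - n)) A = coeff (mono ((n + 1 : ℕ) : ℤ) A) k
    rw [coeff_mono, coeff_mono]
    by_cases h : k = n + 1
    · subst h
      rw [if_pos (by push_cast; ring), if_pos rfl, hone]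
    · rw [if_neg (by omega), if_neg (by omega), map_zero]; rfl
  rw [h2] at h1
  exact h1

/-! ### Unbounded operators -/

lemma coeff_absD {V : L2 d} (h : Summable fun k => om 1 k * ‖coeff V k‖) (k : ℤ) :
    coeff (absD V) k = ((|k| : ℤ) : ℂ) • coeff V k := by
  refine coeff_of_hasSum (c := fun k : ℤ => ((|k| : ℤ) : ℂ) • coeff V k)
    (Summable.hasSum (summable_mono_of_norm ?_)) k
  refine Summable.of_nonneg_of_le (fun k => norm_nonneg _) (fun k => ?_) h
  rw [norm_smul, Complex.norm_intCast]
  refine mul_le_mul_of_nonneg_right ?_ (norm_nonneg _)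
  unfold om
  rw [Real.rpow_one]
  push_cast
  rw [abs_abs]
  linarith

lemma summable_coeff_absD {p : ℝ} (hp : 1 ≤ p) {V : L2 d}
    (h : Summable fun k => om p k * ‖coeff V k‖) : Summable fun k => om 0 k * ‖coeff (absD V) k‖ := by
  have h1 : Summable fun k => om 1 k * ‖coeff V k‖ :=
    Summable.of_nonneg_of_le (fun k => mul_nonneg (om_pos 1 k).le (norm_nonneg _))
      (fun k => mul_le_mul_of_nonneg_right
        (Real.rpow_le_rpow_of_exponent_le (by linarith [abs_nonneg (k : ℝ)]) hp) (norm_nonneg _)) h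
  refine Summable.of_nonneg_of_le (fun k => mul_nonneg (om_pos 0 k).le (norm_nonneg _))
    (fun k => ?_) h1
  rw [coeff_absD h1, norm_smul, Complex.norm_intCast]
  unfold om
  rw [Real.rpow_one, Real.rpow_zero, one_mul]
  refine mul_le_mul_of_nonneg_right ?_ (norm_nonneg _)
  push_cast
  rw [abs_abs]
  linarith

/-- The hypothesis says that `F` lies in `H¹_+`. This makes the series defining `opD` summable, so
that the `tsum` is not its default value. -/
lemma four_opD {F : hardy d} {g : Seq (MatE d)} (hF : four d F = iw 1 g) (n : ℕ) :
    four d (opD F) n = (n : ℂ) • four d F n := by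
  unfold opD
  rw [four_szego_apply, four_apply]
  have hs : Summable fun k : ℤ => ‖(k : ℂ) • coeff (F : L2 d) k‖ ^ 2 := by
    have hinj : Function.Injective (fun j : ℕ => (j : ℤ)) := Nat.cast_injective
    rw [← hinj.summable_iff]
    · refine Summable.of_nonneg_of_le (fun k => sq_nonneg _) (fun k => ?_) (Seq.summable_sq g)
      simp only [Function.comp]
      rw [← four_apply, hF, iw_apply zero_le_one, smul_smul, norm_smul]
      have h1 : ‖((k : ℤ) : ℂ) * (((wt 1 k)⁻¹ : ℝ) : ℂ)‖ ≤ 1 := by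
        rw [norm_mul, Complex.norm_intCast, Complex.norm_real, Real.norm_eq_abs, ← abs_mul]
        exact_mod_cast abs_nat_mul_inv_wt_le (le_refl k)
      rw [mul_pow]
      exact mul_le_of_le_one_left (sq_nonneg _) (pow_le_one₀ (norm_nonneg _) h1)
    · intro j hj
      have hneg : j < 0 := by
        by_contra h
        exact hj ⟨j.toNat, Int.toNat_of_nonneg (by omega)⟩
      rw [F.2 j hneg]
      simp
  have := coeff_of_hasSum (summable_mono_of_sq hs).hasSum n
  rw [this]
  simp

/-- The kernel is `-(i/2)(n + m - |n - m|) u(n - m)`, which is `-i min(n, m) u(n - m)`. The term `D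
T_V F` makes sense because `T_V` preserves the domain. -/
lemma four_laxB {p : ℝ} (hp : 1 ≤ p) {V : L2 d} (h : Summable fun k => om p k * ‖coeff V k‖)
    {F : hardy d} {g : Seq (MatE d)} (hF : four d F = iw 1 g) :
    four d (laxB V F) = laxS (symb V) g := by
  have hp0 : 0 ≤ p := by linarith
  have hw := wfin_symb h
  have h1 : Summable fun k => om 1 k * ‖coeff V k‖ :=
    Summable.of_nonneg_of_le (fun k => mul_nonneg (om_pos 1 k).le (norm_nonneg _))
      (fun k => mul_le_mul_of_nonneg_right
        (Real.rpow_le_rpow_of_exponent_le (by linarith [abs_nonneg (k : ℝ)]) hp) (norm_nonneg _)) h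
  have hD := summable_coeff_absD hp h
  have hT : four d (toeplitz V F) = iw 1 (toepW (symb V) g) := by
    rw [four_toeplitz hp0 h, hF, toep_iw hp hw]
  ext n : 2
  unfold laxB
  rw [map_add, map_smul, map_smul, map_add, four_toeplitz hp0 h, four_toeplitz le_rfl hD]
  rw [lp.coeFn_add, Pi.add_apply, lp.coeFn_smul, Pi.smul_apply, lp.coeFn_smul, Pi.smul_apply,
    lp.coeFn_add, Pi.add_apply, four_opD hT, four_toeplitz hp0 h]
  have s1 := toep_hasSum hp0 hw (four d (opD F)) n
  have s2 := (toep_hasSum hp0 hw (four d F) n).const_smul (n : ℂ)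
  have s3 := toep_hasSum le_rfl (wfin_symb hD) (four d F) n
  have s := ((s1.add s2).const_smul (-(Complex.I / 2))).add (s3.const_smul (Complex.I / 2))
  refine s.unique ((laxS_hasSum hp0 hw g n).congr_fun fun m => ?_)
  have e : symb (absD V) ((n : ℤ) - m) = ((|(n : ℤ) - m| : ℤ) : ℂ) • symb V ((n : ℤ) - m) := by
    unfold symb
    rw [coeff_absD h1, map_smul]
  rw [e, four_opD hF, hF, iw_apply zero_le_one, map_smul, smul_apply, map_smul, smul_smul,
    smul_smul, smul_smul, smul_add, smul_smul, smul_smul, smul_smul, ← add_smul, ← add_smul]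
  congr 1
  have e1 : (2 * (min n m : ℕ) : ℤ) = n + m - |(n : ℤ) - m| := by
    rcases le_total n m with h | h
    · rw [min_eq_left h, abs_of_nonpos (by omega)]; ring
    · rw [min_eq_right h, abs_of_nonneg (by omega)]; ring
  have e2 : ((|(n : ℤ) - m| : ℤ) : ℂ) = n + m - 2 * (min n m : ℕ) := by
    have : |(n : ℤ) - m| = n + m - 2 * (min n m : ℕ) := by linarith
    exact_mod_cast congrArg (fun z : ℤ => (z : ℂ)) this
  rw [e2]
  unfold bmin
  generalize min n m = a
  push_cast
  ring

end Dictionary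

section Sobolev

variable {d : ℕ}

/-! ### Sobolev spaces -/

/-- The terms of the squared `H^s` norm. -/
def hsTerm (s : ℝ) (F : L2 d) (n : ℤ) : ℝ := (1 + |(n : ℝ)| ^ (2 * s)) * ‖coeff F n‖ ^ 2

lemma one_le_hsWeight (s : ℝ) (n : ℤ) : 1 ≤ 1 + |(n : ℝ)| ^ (2 * s) :=
  le_add_of_nonneg_right (Real.rpow_nonneg (abs_nonneg _) _)

lemma hsTerm_nonneg (s : ℝ) (F : L2 d) (n : ℤ) : 0 ≤ hsTerm s F n :=
  mul_nonneg (zero_le_one.trans (one_le_hsWeight s n)) (sq_nonneg _)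

lemma hsNorm_eq (s : ℝ) (F : L2 d) :
    hsNorm s F = (∑' n, ENNReal.ofReal (hsTerm s F n)) ^ (1 / 2 : ℝ) := by
  unfold hsNorm hsTerm
  congr 1
  refine tsum_congr fun n => ?_
  rw [ENNReal.ofReal_mul (zero_le_one.trans (one_le_hsWeight s n)), ENNReal.ofReal_pow (norm_nonneg _),
    ofReal_norm]

lemma memHs_iff {s : ℝ} {F : L2 d} : MemHs s F ↔ Summable (hsTerm s F) := by
  unfold MemHs
  rw [hsNorm_eq, ENNReal.rpow_lt_top_iff_of_pos (by norm_num)]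
  constructor
  · intro h
    have h1 := ENNReal.summable_toReal h.ne
    simpa only [ENNReal.toReal_ofReal (hsTerm_nonneg s F _)] using h1
  · intro h
    rw [← ENNReal.ofReal_tsum_of_nonneg (hsTerm_nonneg s F) h]
    exact ENNReal.ofReal_lt_top

lemma hsNorm_toReal {s : ℝ} {F : L2 d} (h : MemHs s F) :
    (hsNorm s F).toReal = (∑' n, hsTerm s F n) ^ (1 / 2 : ℝ) := by
  rw [hsNorm_eq, ← ENNReal.ofReal_tsum_of_nonneg (hsTerm_nonneg s F) (memHs_iff.1 h),
    ← ENNReal.toReal_rpow, ENNReal.toReal_ofReal (tsum_nonneg (hsTerm_nonneg s F))]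

lemma summable_om_div {p s : ℝ} (hp : 0 ≤ p) (hs : p + 1 / 2 < s) :
    Summable fun k : ℤ => om p k ^ 2 / (1 + |(k : ℝ)| ^ (2 * s)) := by
  have h1 : Summable fun k : ℤ => (2 : ℝ) ^ (2 * p) * |(k : ℝ)| ^ (-(2 * s - 2 * p)) :=
    (Real.summable_abs_int_rpow (by linarith)).mul_left _
  have h2 : Summable fun k : ℤ => if k = 0 then (1 : ℝ) else 0 := (hasSum_ite_eq 0 1).summable
  refine Summable.of_nonneg_of_le (fun k => div_nonneg (sq_nonneg _)
    (zero_le_one.trans (one_le_hsWeight s k))) (fun k => ?_) (h1.add h2)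
  by_cases hk : k = 0
  · subst hk
    have ha : om p 0 = 1 := by simp [om]
    rw [if_pos rfl, ha, one_pow]
    have h3 : 1 / (1 + |((0 : ℤ) : ℝ)| ^ (2 * s)) ≤ 1 := by
      rw [div_le_one (zero_lt_one.trans_le (one_le_hsWeight s 0))]
      exact one_le_hsWeight s 0
    exact h3.trans (le_add_of_nonneg_left (mul_nonneg (Real.rpow_nonneg (by norm_num) _)
      (Real.rpow_nonneg (abs_nonneg _) _)))
  · rw [if_neg hk, add_zero]
    have hk1 : (1 : ℝ) ≤ |(k : ℝ)| := by exact_mod_cast Int.one_le_abs hk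
    have hk0 : (0 : ℝ) < |(k : ℝ)| := zero_lt_one.trans_le hk1
    have ha : om p k ^ 2 ≤ (2 : ℝ) ^ (2 * p) * |(k : ℝ)| ^ (2 * p) := by
      unfold om
      rw [← Real.rpow_natCast, ← Real.rpow_mul (by positivity), ← Real.mul_rpow (by norm_num) hk0.le,
        show p * ((2 : ℕ) : ℝ) = 2 * p by push_cast; ring]
      exact Real.rpow_le_rpow (by positivity) (by linarith) (by linarith)
    rw [div_le_iff₀ (zero_lt_one.trans_le (one_le_hsWeight s k))]
    refine ha.trans ?_
    rw [mul_assoc]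
    refine mul_le_mul_of_nonneg_left ?_ (Real.rpow_nonneg (by norm_num) _)
    calc |(k : ℝ)| ^ (2 * p) = |(k : ℝ)| ^ (-(2 * s - 2 * p)) * |(k : ℝ)| ^ (2 * s) := by
          rw [← Real.rpow_add hk0]; congr 1; ring
      _ ≤ _ := mul_le_mul_of_nonneg_left (by linarith) (Real.rpow_nonneg hk0.le _)

/-- Sobolev embedding of `H^s` into the weighted Wiener algebra. -/
lemma exists_wiener_le {p s : ℝ} (hp : 0 ≤ p) (hs : p + 1 / 2 < s) :
    ∃ C : ℝ, ∀ F : L2 d, MemHs s F → (Summable fun k => om p k * ‖coeff F k‖) ∧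
      ∑' k, om p k * ‖coeff F k‖ ≤ C * (hsNorm s F).toReal := by
  -- The constant of the Cauchy–Schwarz inequality; the series converges because `2s - 2p > 1`.
  refine ⟨(∑' k : ℤ, om p k ^ 2 / (1 + |(k : ℝ)| ^ (2 * s))) ^ (1 / 2 : ℝ), fun F hF => ?_⟩
  have hpos : ∀ k : ℤ, 0 < 1 + |(k : ℝ)| ^ (2 * s) := fun k =>
    zero_lt_one.trans_le (one_le_hsWeight s k)
  have h2 : Real.HolderConjugate 2 2 := Real.HolderConjugate.two_two
  have ef : ∀ k : ℤ, (om p k / √(1 + |(k : ℝ)| ^ (2 * s))) ^ (2 : ℝ)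
      = om p k ^ 2 / (1 + |(k : ℝ)| ^ (2 * s)) := fun k => by
    rw [Real.rpow_two, div_pow, Real.sq_sqrt (hpos k).le]
  have eg : ∀ k : ℤ, (√(1 + |(k : ℝ)| ^ (2 * s)) * ‖coeff F k‖) ^ (2 : ℝ) = hsTerm s F k := fun k => by
    rw [Real.rpow_two, mul_pow, Real.sq_sqrt (hpos k).le, hsTerm]
  have efg : ∀ k : ℤ, om p k / √(1 + |(k : ℝ)| ^ (2 * s)) * (√(1 + |(k : ℝ)| ^ (2 * s)) * ‖coeff F k‖)
      = om p k * ‖coeff F k‖ := fun k => by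
    have := (Real.sqrt_pos.2 (hpos k)).ne'
    field_simp
  have h := Real.summable_and_inner_le_Lp_mul_Lq_tsum_of_nonneg h2
    (f := fun k : ℤ => om p k / √(1 + |(k : ℝ)| ^ (2 * s)))
    (g := fun k : ℤ => √(1 + |(k : ℝ)| ^ (2 * s)) * ‖coeff F k‖)
    (fun k => div_nonneg (om_pos p k).le (Real.sqrt_nonneg _))
    (fun k => mul_nonneg (Real.sqrt_nonneg _) (norm_nonneg _))
    (by simpa only [ef] using summable_om_div hp hs)
    (by simpa only [eg] using memHs_iff.1 hF)
  simp only [ef, eg, efg] at h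
  rwa [hsNorm_toReal hF]

/-- `H¹_+` on the Fourier side. -/
lemma memHs_one_iff {F : hardy d} : MemHs 1 (F : L2 d) ↔ ∃ g, four d F = iw 1 g := by
  have hinj : Function.Injective (fun j : ℕ => (j : ℤ)) := Nat.cast_injective
  have key : Summable (hsTerm 1 (F : L2 d)) ↔
      Summable fun n : ℕ => (1 + (n : ℝ) ^ 2) * ‖four d F n‖ ^ 2 := by
    rw [← hinj.summable_iff]
    · refine summable_congr fun n => ?_
      simp only [Function.comp, hsTerm]
      rw [four_apply, mul_one, Real.rpow_two, sq_abs, Int.cast_natCast]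
    · intro j hj
      have hneg : j < 0 := by
        by_contra h
        exact hj ⟨j.toNat, Int.toNat_of_nonneg (by omega)⟩
      rw [hsTerm, F.2 j hneg, norm_zero]
      ring
  rw [memHs_iff, key]
  constructor
  · intro h
    have h1 : Summable fun n : ℕ => ‖((wt 1 n : ℝ) : ℂ) • four d F n‖ ^ 2 := by
      refine Summable.of_nonneg_of_le (fun n => sq_nonneg _) (fun n => ?_) (h.mul_left 2)
      rw [norm_smul, mul_pow, Complex.norm_real, Real.norm_eq_abs, sq_abs, wt_one, ← mul_assoc]
      exact mul_le_mul_of_nonneg_right (by nlinarith [sq_nonneg ((n : ℝ) - 1)]) (sq_nonneg _)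
    refine ⟨⟨fun n => ((wt 1 n : ℝ) : ℂ) • four d F n, memℓp_gen (by simpa using h1)⟩, ?_⟩
    ext n : 2
    rw [iw_apply zero_le_one]
    change _ = (((wt 1 n)⁻¹ : ℝ) : ℂ) • ((wt 1 n : ℝ) : ℂ) • four d F n
    rw [smul_smul, ← Complex.ofReal_mul, inv_mul_cancel₀ (wt_pos 1 n).ne', Complex.ofReal_one, one_smul]
  · rintro ⟨g, hg⟩
    refine Summable.of_nonneg_of_le (fun n => by positivity) (fun n => ?_) (Seq.summable_sq g)
    rw [hg, iw_apply zero_le_one, norm_smul, mul_pow, Complex.norm_real, Real.norm_eq_abs, sq_abs,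
      ← mul_assoc, wt_one]
    refine mul_le_of_le_one_left (sq_nonneg _) ?_
    have hn : (0 : ℝ) ≤ n := Nat.cast_nonneg n
    rw [inv_pow, ← div_eq_mul_inv, div_le_one (by positivity)]
    nlinarith

end Sobolev

section HalfWaveMaps

variable {d : ℕ}

/-! ### Solutions of the half-wave maps equation on the Fourier side -/

lemma toMat_mulE (A B : MatE d) : toMat (mulE d A B) = toMat A * toMat B := rfl

lemma toMat_injective {A B : MatE d} (h : toMat A = toMat B) : A = B := by
  ext p
  exact congrFun (congrFun h p.1) p.2

lemma mulE_assoc (A B C : MatE d) : mulE d A (mulE d B C) = mulE d (mulE d A B) C :=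
  toMat_injective (by simp only [toMat_mulE, mul_assoc])

lemma mulE_mulE_eq_of_sq {A : MatE d} (h : toMat A * toMat A = 1) (x : MatE d) :
    mulE d A (mulE d A x) = x :=
  toMat_injective (by rw [mulE_assoc, toMat_mulE, toMat_mulE, h, one_mul])

lemma inner_mulE_left {A B : MatE d} (h : (toMat A).conjTranspose = toMat B) (x y : MatE d) :
    inner ℂ (mulE d A x) y = inner ℂ x (mulE d B y) := by
  have hB : ∀ i l, B (i, l) = star (A (l, i)) := fun i l => (congrFun (congrFun h i) l).symm
  have e1 : ∀ i j, (mulE d A x) (i, j) = ∑ l, A (i, l) * x (l, j) := fun i j => rfl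
  have e2 : ∀ i j, (mulE d B y) (i, j) = ∑ l, B (i, l) * y (l, j) := fun i j => rfl
  rw [PiLp.inner_apply, PiLp.inner_apply, Fintype.sum_prod_type, Fintype.sum_prod_type]
  simp only [RCLike.inner_apply, e1, e2, hB, map_sum, map_mul, Finset.mul_sum, Finset.sum_mul]
  conv_lhs => rw [Finset.sum_comm]
  conv_rhs => rw [Finset.sum_comm]
  refine Finset.sum_congr rfl fun j _ => ?_
  rw [Finset.sum_comm]
  refine Finset.sum_congr rfl fun i _ => Finset.sum_congr rfl fun l _ => ?_
  change y (_, _) * (star (A _) * star (x _)) = _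
  change _ = (star (A _) * y _) * star (x _)
  ring

lemma coeff_apply (V : L2 d) (k : ℤ) (q : Fin d × Fin d) :
    (coeff V k) q = ∫ θ, fourier (-k) θ * (V θ) q ∂circMeasure :=
  ((EuclideanSpace.proj (𝕜 := ℂ) q).integral_comp_comm ((integrable_L2 V).fourier_smul (-k))).symm

lemma coeff_compLp (L : MatE d →L[ℂ] MatE d) (V : L2 d) (k : ℤ) :
    coeff (L.compLp V) k = L (coeff V k) := by
  have h := L.integral_comp_comm ((integrable_L2 V).fourier_smul (-k))
  unfold coeff
  rw [fourierCoeff_congr_ae (L.coeFn_compLp V)]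
  unfold fourierCoeff
  rw [← h]
  simp only [map_smul]

lemma isSymm_symb {V : L2 d} (h : ∀ᵐ θ ∂circMeasure, (toMat (V θ)).conjTranspose = toMat (V θ)) :
    IsSymm (symb V) := by
  refine fun k x y => inner_mulE_left ?_ x y
  ext i j
  change star (coeff V k (j, i)) = coeff V (-k) (i, j)
  rw [coeff_apply, coeff_apply]
  change (starRingEnd ℂ) _ = _
  rw [← integral_conj]
  refine integral_congr_ae ?_
  filter_upwards [h] with θ hθ
  have h1 : star (V θ (j, i)) = V θ (i, j) := congrFun (congrFun hθ i) j
  rw [map_mul, fourier_neg, neg_neg, RingHomCompTriple.comp_apply, RingHom.id_apply, ← h1]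
  rfl

lemma exists_mulE_ae {V : L2 d} (hV : MemLp (V : Circ → MatE d) ∞ circMeasure) (F : L2 d) :
    ∃ Q : L2 d, Q =ᵐ[circMeasure] fun θ => mulE d (V θ) (F θ) := by
  refine ⟨(mulE d).holder 2 (hV.toLp V) F, ?_⟩
  filter_upwards [(mulE d).coeFn_holder (r := 2) (hV.toLp V) F, hV.coeFn_toLp] with θ a b
  rw [a, b]

/-- The Fourier coefficients of `V²` for `V² = 1`. -/
lemma hasSum_symb_sq {V : L2 d} (hs : Summable fun k => ‖coeff V k‖)
    (h : ∀ᵐ θ ∂circMeasure, toMat (V θ) * toMat (V θ) = 1) (k : ℤ) (x : MatE d) :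
    HasSum (fun j : ℤ => symb V (k - j) (symb V j x)) (if k = 0 then x else 0) := by
  rw [← coeff_mono 0 x k]
  have hQ : mono 0 x =ᵐ[circMeasure]
      fun θ => mulE d (V θ) ((((mulE d).flip x).compLp V : L2 d) θ) := by
    filter_upwards [h, ((mulE d).flip x).coeFn_compLp V, mono_coeFn 0 x] with θ h1 h2 h3
    rw [h2, h3, ContinuousLinearMap.flip_apply, mulE_mulE_eq_of_sq h1, fourier_zero, one_smul]
  refine (coeff_mul_hasSum hs hQ k).congr_fun fun j => ?_
  rw [coeff_compLp]
  rfl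

/-- The Fourier coefficients of `-(i/2) [U, |D| U]`. -/
lemma hasSum_symb_comm {U V : L2 d} (hs : Summable fun k => om 1 k * ‖coeff U k‖)
    (h : ∀ᵐ θ ∂circMeasure, V θ = (-(Complex.I / 2)) •
      (mulE d (U θ) (absD U θ) - mulE d (absD U θ) (U θ))) (k : ℤ) (x : MatE d) :
    HasSum (fun j : ℤ => (-(Complex.I / 2) * ((|j| - |k - j| : ℤ) : ℂ)) •
      symb U (k - j) (symb U j x)) (symb V k x) := by
  have hU := summable_coeff_of_om zero_le_one hs
  have hW := summable_coeff_of_om le_rfl (summable_coeff_absD le_rfl hs)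
  obtain ⟨Q₁, hQ₁⟩ := exists_mulE_ae (memLp_top_of_summable hU)
    (((mulE d).flip x).compLp (absD U))
  obtain ⟨Q₂, hQ₂⟩ := exists_mulE_ae (memLp_top_of_summable hW) (((mulE d).flip x).compLp U)
  have h1 := coeff_mul_hasSum hU hQ₁ k
  have h2 := coeff_mul_hasSum hW hQ₂ k
  have hV : ((mulE d).flip x).compLp V = (-(Complex.I / 2)) • (Q₁ - Q₂) := by
    refine Lp.ext ?_
    filter_upwards [hQ₁, hQ₂, h, Lp.coeFn_smul (-(Complex.I / 2)) (Q₁ - Q₂), Lp.coeFn_sub Q₁ Q₂,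
      ((mulE d).flip x).coeFn_compLp V, ((mulE d).flip x).coeFn_compLp U,
      ((mulE d).flip x).coeFn_compLp (absD U)] with θ a₁ a₂ a₃ a₄ a₅ a₆ a₇ a₈
    rw [a₄, Pi.smul_apply, a₅, Pi.sub_apply, a₁, a₂, a₆, a₇, a₈, a₃]
    simp only [ContinuousLinearMap.flip_apply, map_smul, map_sub, mulE_assoc]
  have h3 : symb V k x = (-(Complex.I / 2)) • (coeff Q₁ k - coeff Q₂ k) := by
    change (mulE d).flip x (coeff V k) = _
    rw [← coeff_compLp, hV, coeff_smul]
    congr 1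
    exact map_sub (coeffL d k) Q₁ Q₂
  rw [h3]
  refine ((h1.sub h2).const_smul (-(Complex.I / 2))).congr_fun fun j => ?_
  rw [coeff_compLp, coeff_compLp, coeff_absD hs, coeff_absD hs]
  simp only [ContinuousLinearMap.flip_apply, map_smul, smul_apply, ← sub_smul, smul_smul]
  rw [Int.cast_sub]
  rfl

lemma memLp_top_comm {U V : L2 d} (hs : Summable fun k => om 1 k * ‖coeff U k‖)
    (h : ∀ᵐ θ ∂circMeasure, V θ = (-(Complex.I / 2)) •
      (mulE d (U θ) (absD U θ) - mulE d (absD U θ) (U θ))) :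
    MemLp (V : Circ → MatE d) ∞ circMeasure := by
  have hU := memLp_top_of_summable (summable_coeff_of_om zero_le_one hs)
  have hW := memLp_top_of_summable (summable_coeff_of_om le_rfl (summable_coeff_absD le_rfl hs))
  exact MemLp.ae_eq (EventuallyEq.symm h) ((((mulE d).memLp_of_bilin ∞ hU hW).sub
    ((mulE d).memLp_of_bilin ∞ hW hU)).const_smul (-(Complex.I / 2)))

/-- Transport of an operator on `L²_+` to the Fourier side. -/
def fourConj (A : hardy d →L[ℂ] hardy d) : Seq (MatE d) →L[ℂ] Seq (MatE d) :=
  (four d).toContinuousLinearEquiv.toContinuousLinearMap ∘L A ∘L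
    (four d).symm.toContinuousLinearEquiv.toContinuousLinearMap

lemma fourConj_apply (A : hardy d →L[ℂ] hardy d) (f : Seq (MatE d)) :
    fourConj A f = four d (A ((four d).symm f)) := rfl

/-- One-dimensional Sobolev embedding: `‖g n‖ / (1+n)` is at most `(1+n)^{-2} + ‖g n‖²`, so the
Fourier series of `F` converges absolutely. -/
lemma memLp_top_of_iw {F : hardy d} {g : Seq (MatE d)} (hF : four d F = iw 1 g) :
    MemLp ((F : L2 d) : Circ → MatE d) ∞ circMeasure := by
  refine memLp_top_of_summable ?_
  have hinj : Function.Injective (fun j : ℕ => (j : ℤ)) := Nat.cast_injective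
  rw [← hinj.summable_iff]
  · have h1 : Summable fun n : ℕ => ((wt 1 n)⁻¹) ^ 2 := by
      have h2 := (summable_nat_add_iff 1).2 (Real.summable_nat_pow_inv.2 one_lt_two)
      refine h2.congr fun n => ?_
      rw [wt_one, inv_pow]
      push_cast
      rw [add_comm]
    refine Summable.of_nonneg_of_le (fun n => norm_nonneg _) (fun n => ?_)
      (h1.add (Seq.summable_sq g))
    simp only [Function.comp]
    rw [← four_apply, hF, iw_apply zero_le_one, norm_smul, Complex.norm_real, Real.norm_eq_abs,
      abs_of_pos (inv_pos.2 (wt_pos 1 n))]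
    nlinarith [sq_nonneg ((wt 1 n)⁻¹ - ‖g n‖), sq_nonneg ((wt 1 n)⁻¹), sq_nonneg ‖g n‖]
  · intro j hj
    have hneg : j < 0 := by
      by_contra h
      exact hj ⟨j.toNat, Int.toNat_of_nonneg (by omega)⟩
    rw [F.2 j hneg, norm_zero]

/-- For bounded `F`, the map `V ↦ Π (V F)` is bounded on `L²`. -/
lemma exists_toeplitz_flip {F : hardy d} (hF : MemLp ((F : L2 d) : Circ → MatE d) ∞ circMeasure) :
    ∃ M : L2 d →L[ℂ] hardy d, ∀ V : L2 d, MemLp (V : Circ → MatE d) ∞ circMeasure →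
      M V = toeplitz V F := by
  refine ⟨szego d ∘L ((mulE d).holderL circMeasure 2 ∞ 2).flip (hF.toLp (F : L2 d)), fun V hV => ?_⟩
  obtain ⟨Q, hQ, hT⟩ := exists_toeplitz hV F
  rw [hT]
  change szego d ((mulE d).holder 2 V (hF.toLp (F : L2 d))) = _
  congr 1
  refine Lp.ext ?_
  filter_upwards [(mulE d).coeFn_holder (r := 2) V (hF.toLp (F : L2 d)), hF.coeFn_toLp, hQ]
    with θ a b c
  rw [a, b, c]

lemma symb_sub (V W : L2 d) : symb (V - W) = symb V - symb W := by
  ext1 k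
  have h : coeff (V - W) k = coeff V k - coeff W k := map_sub (coeffL d k) V W
  simp only [symb, Pi.sub_apply, h, map_sub]

/-- Here the equation enters: Sobolev embedding gives the continuous curve of symbols, the
Grassmannian condition gives symmetry and `u² = 1`, and the product formula turns the commutator
into convolutions. -/
lemma IsSolution.isFlow {k : ℕ} {p s : ℝ} (hp : 1 ≤ p) (hs : p + 1 / 2 < s) {I : Set ℝ}
    {U : ℝ → L2 d} (hU : IsSolution k s I U) : IsFlow p I fun t => symb (U t) := by
  have hp0 : 0 ≤ p := zero_le_one.trans hp
  obtain ⟨C, hC⟩ := exists_wiener_le (d := d) hp0 hs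
  have hsum : ∀ t ∈ I, Summable fun k => om p k * ‖coeff (U t) k‖ := fun t ht =>
    (hC _ (hU.memHs t ht)).1
  have hsum1 : ∀ t ∈ I, Summable fun k => om 1 k * ‖coeff (U t) k‖ := fun t ht => by
    obtain ⟨C', hC'⟩ := exists_wiener_le (d := d) (p := 1) zero_le_one (by linarith : 1 + 1 / 2 < s)
    exact (hC' _ (hU.memHs t ht)).1
  refine ⟨⟨fun t ht => wfin_symb (hsum t ht), fun t₀ ht₀ => ?_, fun t ht => isSymm_symb ?_⟩,
    fun t ht => hasSum_symb_sq (summable_coeff_of_om hp0 (hsum t ht)) ?_, fun t ht => ?_⟩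
  · have h0 := hU.continuous_hs t₀ ht₀
    have h1 : Tendsto (fun t => ‖mulE d‖ * (C * (hsNorm s (U t - U t₀)).toReal)) (𝓝[I] t₀) (𝓝 0) := by
      have := (((ENNReal.tendsto_toReal ENNReal.zero_ne_top).comp h0).const_mul C).const_mul ‖mulE d‖
      simpa using this
    refine squeeze_zero' (Eventually.of_forall fun t => tsum_nonneg fun k =>
      mul_nonneg (om_pos p k).le (norm_nonneg _)) ?_ h1
    -- The norm of the difference tends to `0`, so it is finite near `t₀` and the embedding applies
    -- to the difference.
    filter_upwards [h0.eventually (gt_mem_nhds ENNReal.zero_lt_top)] with t ht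
    rw [← symb_sub]
    obtain ⟨h2, h3⟩ := hC (U t - U t₀) ht
    refine le_trans ?_ (mul_le_mul_of_nonneg_left h3 (mulE d).opNorm_nonneg)
    rw [← tsum_mul_left]
    refine (wfin_symb h2).tsum_le_tsum (fun k => ?_) (h2.mul_left _)
    rw [← mul_assoc, mul_comm ‖mulE d‖, mul_assoc]
    exact mul_le_mul_of_nonneg_left ((mulE d).le_opNorm _) (om_pos p k).le
  · filter_upwards [hU.mem_gr t ht] with θ hθ using hθ.1
  · filter_upwards [hU.mem_gr t ht] with θ hθ using hθ.2.1
  · obtain ⟨V, hV, hder⟩ := hU.equation t ht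
    have hV' : ∀ᵐ θ ∂circMeasure, V θ = (-(Complex.I / 2)) •
        (mulE d (U t θ) (absD (U t) θ) - mulE d (absD (U t) θ) (U t θ)) := by
      filter_upwards [hV] with θ hθ
      exact toMat_injective hθ
    have hVtop := memLp_top_comm (hsum1 t ht) hV'
    refine ⟨symb V, fourConj (toeplitz V), hasSum_symb_comm (hsum1 t ht) hV', fun n m e => ?_,
      fun g => ?_⟩
    · rw [fourConj_apply, four_symm_sgl, four_toeplitz_mono hVtop]
    -- The time derivative of `U` is known only in `L²`. For a fixed bounded `F` the map `V ↦ T_V F`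
    -- is continuous on `L²`, which is why differentiability is asked on the domain only.
    · obtain ⟨M, hM⟩ := exists_toeplitz_flip
        (memLp_top_of_iw ((four d).apply_symm_apply (iw 1 g)))
      have h1 := ((((four d).toContinuousLinearEquiv.toContinuousLinearMap ∘L M).restrictScalars
        ℝ).hasFDerivAt).comp_hasDerivWithinAt t hder
      have h2 : ∀ τ ∈ I, toep (symb (U τ)) (iw 1 g) = four d (M (U τ)) := fun τ hτ => by
        rw [hM _ (memLp_top_of_summable (summable_coeff_of_om hp0 (hsum τ hτ))),
          four_toeplitz hp0 (hsum τ hτ), LinearIsometryEquiv.apply_symm_apply]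
      rw [fourConj_apply, ← hM V hVtop]
      exact h1.congr h2 (h2 t ht)

end HalfWaveMaps

section ExplicitFormula

variable {d : ℕ}

/-! ### The explicit formula -/

lemma map_opExp_apply {H K : Type*} [NormedAddCommGroup H] [NormedSpace ℂ H] [CompleteSpace H]
    [NormedAddCommGroup K] [NormedSpace ℂ K] [CompleteSpace K] {A : H →L[ℂ] H} {B : K →L[ℂ] K}
    (J : H →L[ℂ] K) (h : ∀ f, J (A f) = B (J f)) (f : H) : J (opExp A f) = opExp B (J f) := by
  have hp : ∀ (n : ℕ) (f : H), J ((A ^ n) f) = (B ^ n) (J f) := fun n => by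
    induction n with
    | zero => exact fun f => rfl
    | succ n ih =>
      intro f
      rw [pow_succ, pow_succ]
      change J ((A ^ n) (A f)) = (B ^ n) (B (J f))
      rw [ih, h]
  have h1 := ((NormedSpace.exp_series_hasSum_exp' (𝕂 := ℂ) A).mapL
    (ContinuousLinearMap.apply ℂ H f)).mapL J
  have h2 := (NormedSpace.exp_series_hasSum_exp' (𝕂 := ℂ) B).mapL (ContinuousLinearMap.apply ℂ K (J f))
  refine h1.unique (h2.congr_fun fun n => ?_)
  simp only [ContinuousLinearMap.apply_apply, map_smul, hp]

/-- Transport of an operator from the Fourier side to `L²_+`. -/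
def fourPull (A : Seq (MatE d) →L[ℂ] Seq (MatE d)) : hardy d →L[ℂ] hardy d :=
  (four d).symm.toContinuousLinearEquiv.toContinuousLinearMap ∘L A ∘L
    (four d).toContinuousLinearEquiv.toContinuousLinearMap

lemma fourPull_apply (A : Seq (MatE d) →L[ℂ] Seq (MatE d)) (F : hardy d) :
    fourPull A F = (four d).symm (A (four d F)) := rfl

lemma four_fourPull (A : Seq (MatE d) →L[ℂ] Seq (MatE d)) (F : hardy d) :
    four d (fourPull A F) = A (four d F) := by
  rw [fourPull_apply, LinearIsometryEquiv.apply_symm_apply]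

lemma IsEvol.isPropagator {p : ℝ} (hp : 1 ≤ p) {I : Set ℝ} {U : ℝ → L2 d}
    (h : ∀ t ∈ I, Summable fun k => om p k * ‖coeff (U t) k‖)
    {P : ℝ → Seq (MatE d) →L[ℂ] Seq (MatE d)} (hP : IsEvol I (fun t => symb (U t)) P) :
    IsPropagator I U fun t => fourPull (P t) where
  initial := by
    ext1 F
    rw [fourPull_apply, hP.init]
    exact (four d).symm_apply_apply F
  strongly_continuous F := (four d).symm.continuous.comp_continuousOn (hP.cont (four d F))
  preserves_domain t ht F hF := by
    obtain ⟨g, hg⟩ := memHs_one_iff.1 hF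
    obtain ⟨f, hf, -⟩ := hP.deriv t ht g
    exact memHs_one_iff.2 ⟨f, by rw [four_fourPull, hg, hf]⟩
  equation t ht F hF := by
    obtain ⟨g, hg⟩ := memHs_one_iff.1 hF
    obtain ⟨f, hf, hder⟩ := hP.deriv t ht g
    have h1 := (((four d).symm.toContinuousLinearEquiv.toContinuousLinearMap.restrictScalars
      ℝ).hasFDerivAt).comp_hasDerivWithinAt t hder
    rw [← hg] at h1
    refine h1.congr_deriv ?_
    change (four d).symm (laxS (symb (U t)) f) = _
    rw [← four_laxB hp (h t ht) (F := fourPull (P t) F) (by rw [four_fourPull, hg, hf]),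
      LinearIsometryEquiv.symm_apply_apply]

lemma IsPropagator.isEvol {p : ℝ} (hp : 1 ≤ p) {I : Set ℝ} {U : ℝ → L2 d}
    (h : ∀ t ∈ I, Summable fun k => om p k * ‖coeff (U t) k‖)
    {Q : ℝ → hardy d →L[ℂ] hardy d} (hQ : IsPropagator I U Q) :
    IsEvol I (fun t => symb (U t)) fun t => fourConj (Q t) where
  init := by
    ext1 f
    rw [fourConj_apply, hQ.initial]
    exact (four d).apply_symm_apply f
  cont f := (four d).continuous.comp_continuousOn (hQ.strongly_continuous ((four d).symm f))
  deriv t ht g := by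
    have hF : MemHs 1 ((four d).symm (iw 1 g) : L2 d) :=
      memHs_one_iff.2 ⟨g, (four d).apply_symm_apply _⟩
    obtain ⟨f, hf⟩ := memHs_one_iff.1 (hQ.preserves_domain t ht _ hF)
    refine ⟨f, hf, ?_⟩
    have h1 := (((four d).toContinuousLinearEquiv.toContinuousLinearMap.restrictScalars
      ℝ).hasFDerivAt).comp_hasDerivWithinAt t (hQ.equation t ht _ hF)
    exact h1.congr_deriv (four_laxB hp (h t ht) hf)

lemma fourPull_mem_unitary {A : Seq (MatE d) →L[ℂ] Seq (MatE d)}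
    (hA : A ∈ unitary (Seq (MatE d) →L[ℂ] Seq (MatE d))) :
    fourPull A ∈ unitary (hardy d →L[ℂ] hardy d) := by
  refine mem_unitary_of_isometry (fun F => ?_) (Function.Surjective.denseRange fun F => ?_)
  · rw [fourPull_apply, LinearIsometryEquiv.norm_map, norm_eq_of_mem_unitary hA,
      LinearIsometryEquiv.norm_map]
  · refine ⟨(four d).symm (star A (four d F)), ?_⟩
    have h : A (star A (four d F)) = four d F := congrArg (· (four d F)) (Unitary.mem_iff.1 hA).2
    rw [fourPull_apply, LinearIsometryEquiv.apply_symm_apply, h, LinearIsometryEquiv.symm_apply_apply]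

/-- The Neumann series of the resolvent of a contraction. -/
lemma hasSum_inverse_one_sub_smul {H : Type*} [NormedAddCommGroup H] [NormedSpace ℂ H]
    [CompleteSpace H] {A : H →L[ℂ] H} (hA : ∀ f, ‖A f‖ ≤ ‖f‖) {z : ℂ} (hz : ‖z‖ < 1) :
    IsUnit (1 - z • A) ∧
      ∀ f, HasSum (fun n : ℕ => z ^ n • (A ^ n) f) (Ring.inverse (1 - z • A) f) := by
  have h : ‖A‖ ≤ 1 := A.opNorm_le_bound zero_le_one fun f => by rw [one_mul]; exact hA f
  have hlt : ‖z • A‖ < 1 := by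
    rw [norm_smul]
    exact (mul_le_of_le_one_right (norm_nonneg z) h).trans_lt hz
  refine ⟨(Units.oneSub _ hlt).isUnit, fun f => ?_⟩
  have h1 : HasSum (fun n : ℕ => (z • A) ^ n) (Ring.inverse (1 - z • A)) := by
    rw [NormedRing.inverse_one_sub _ hlt]
    exact (summable_geometric_of_norm_lt_one hlt).hasSum
  refine (h1.mapL (ContinuousLinearMap.apply ℂ H f)).congr_fun fun n => ?_
  rw [smul_pow]
  rfl

/-- The mean is continuous, so it may be applied term by term to the Neumann series. -/
lemma evalDisk_eq_mean_inverse {A : hardy d →L[ℂ] hardy d} (hA : ∀ F, ‖A F‖ ≤ ‖F‖) {z : ℂ}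
    (hz : ‖z‖ < 1) {F G : hardy d} (h : ∀ n : ℕ, coeff (G : L2 d) n = mean ((A ^ n) F)) :
    evalDisk G z = mean (Ring.inverse (1 - z • A) F) := by
  have h2 := ((hasSum_inverse_one_sub_smul hA hz).2 F).mapL (coeffL d 0 ∘L (hardy d).subtypeL)
  refine Eq.trans (tsum_congr fun n => ?_) h2.tsum_eq
  rw [h]
  exact (map_smul (coeffL d 0 ∘L (hardy d).subtypeL) (z ^ n) ((A ^ n) F)).symm

/-- The operator `e^{-itT_V} S^*`. -/
def twistShift (V : L2 d) (t : ℝ) : hardy d →L[ℂ] hardy d :=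
  opExp ((-(Complex.I * (t : ℂ))) • toeplitz V) * backShift d

lemma four_twistShift {p : ℝ} (hp : 0 ≤ p) {V : L2 d}
    (h : Summable fun k => om p k * ‖coeff V k‖) (t : ℝ) (F : hardy d) :
    four d (twistShift V t F) = expI (toep (symb V)) t (bshift (four d F)) := by
  have h1 := map_opExp_apply (A := (-(Complex.I * (t : ℂ))) • toeplitz V)
    (B := (-(Complex.I * (t : ℂ))) • toep (symb V))
    (four d).toContinuousLinearEquiv.toContinuousLinearMap (fun F => by
      change four d ((-(Complex.I * (t : ℂ))) • toeplitz V F) = _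
      rw [LinearIsometryEquiv.map_smul, four_toeplitz hp h]
      rfl) (backShift d F)
  refine h1.trans ?_
  change opExp _ (four d (backShift d F)) = opExp _ (bshift (four d F))
  rw [four_backShift]

lemma four_twistShift_pow {p : ℝ} (hp : 0 ≤ p) {V : L2 d}
    (h : Summable fun k => om p k * ‖coeff V k‖) (t : ℝ) (n : ℕ) :
    ∀ F : hardy d, four d ((twistShift V t ^ n) F)
      = ((expI (toep (symb V)) t * bshift : Seq (MatE d) →L[ℂ] Seq (MatE d)) ^ n) (four d F) := by
  induction n with
  | zero => exact fun F => rfl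
  | succ n ih =>
    intro F
    rw [pow_succ, pow_succ]
    change four d ((twistShift V t ^ n) (twistShift V t F)) = _
    rw [ih, four_twistShift hp h]
    rfl

/-- The exponential is isometric because the symbol is self-adjoint, and the backward shift is a
contraction. This is what makes the resolvent exist for every `|z| < 1`. -/
lemma norm_twistShift_le {p : ℝ} (hp : 0 ≤ p) {V : L2 d}
    (h : Summable fun k => om p k * ‖coeff V k‖) (hs : IsSymm (symb V)) (t : ℝ) (F : hardy d) :
    ‖twistShift V t F‖ ≤ ‖F‖ := by
  have h1 := norm_expI (A := toep (symb V)) (re_inner_neg_I_toep hp (wfin_symb h) hs) t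
    (bshift (four d F))
  have h2 := norm_bshift_le (four d F)
  rwa [← h1, ← four_twistShift hp h, LinearIsometryEquiv.norm_map,
    LinearIsometryEquiv.norm_map] at h2

/-- This is `ΠV = T_V 1`, with `1` the constant identity matrix; it brings the solution itself into
the reach of the propagator formula. -/
lemma four_szego_eq {p : ℝ} (hp : 0 ≤ p) {V : L2 d}
    (h : Summable fun k => om p k * ‖coeff V k‖) :
    four d (szego d V) = toep (symb V) (sgl 0 (ofMat 1)) := by
  ext n : 2
  rw [toep_sgl hp (wfin_symb h), four_szego_apply]
  rw [Nat.cast_zero, sub_zero, symb]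
  generalize coeff V (n : ℤ) = A
  refine toMat_injective ?_
  rw [toMat_mulE]
  exact (mul_one (toMat A)).symm

end ExplicitFormula

end HWM

end

theorem theorem5p6 (d k : ℕ) (hd : 2 ≤ d) (hk : k ≤ d) (s : ℝ) (hs : 3 / 2 < s)
    (I : Set ℝ) (hI : I.OrdConnected) (h0 : (0 : ℝ) ∈ I)
    (U : ℝ → HWM.L2 d) (hU : HWM.IsSolution k s I U) :
    -- the propagator exists, is unique, and is unitary
    ∃ P : ℝ → HWM.hardy d →L[ℂ] HWM.hardy d,
      HWM.IsPropagator I U P ∧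
      (∀ Q : ℝ → HWM.hardy d →L[ℂ] HWM.hardy d,
        HWM.IsPropagator I U Q → ∀ t ∈ I, Q t = P t) ∧
      (∀ t ∈ I, P t ∈ unitary (HWM.hardy d →L[ℂ] HWM.hardy d)) ∧
      -- the operators in the formula are invertible
      (∀ t ∈ I, ∀ z : ℂ, ‖z‖ < 1 → IsUnit (HWM.resolventArg (U 0) t z)) ∧
      -- the explicit formula for the propagator
      (∀ t ∈ I, ∀ z : ℂ, ‖z‖ < 1 → ∀ F : HWM.hardy d,
        HWM.evalDisk (P t F) z = HWM.mean (Ring.inverse (HWM.resolventArg (U 0) t z) F)) ∧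
      -- the explicit formula for the solution
      (∀ t ∈ I, ∀ z : ℂ, ‖z‖ < 1 →
        HWM.evalDisk (HWM.szego d (U t)) z =
          HWM.mean (Ring.inverse (HWM.resolventArg (U 0) t z) (HWM.szego d (U 0)))) := by
  obtain ⟨p, hp1, hp2, hps⟩ : ∃ p : ℝ, 1 < p ∧ p ≤ 2 ∧ p + 1 / 2 < s :=
    -- The second entry is the midpoint of `1` and `s - 1/2`; the cap at `2` is the range of the
    -- commutator estimate.
    ⟨min 2 ((s + 1 / 2) / 2), lt_min one_lt_two (by linarith), min_le_left _ _, by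
      have := min_le_right 2 ((s + 1 / 2) / 2)
      linarith⟩
  have hp : 1 ≤ p := hp1.le
  have hp0 : 0 ≤ p := zero_le_one.trans hp
  have hflow := hU.isFlow hp hps
  have hsum : ∀ t ∈ I, Summable fun k => HWM.om p k * ‖HWM.coeff (U t) k‖ := fun t ht => by
    obtain ⟨C, hC⟩ := HWM.exists_wiener_le (d := d) hp0 hps
    exact (hC _ (hU.memHs t ht)).1
  obtain ⟨P, hP, hPu⟩ := HWM.exists_evol hp1 hp2 hI h0 hflow.toSymCurveOn
  have hle : ∀ (t : ℝ) (F : HWM.hardy d), ‖HWM.twistShift (U 0) t F‖ ≤ ‖F‖ := fun t =>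
    HWM.norm_twistShift_le hp0 (hsum 0 h0) (hflow.symm 0 h0) t
  have hformula : ∀ t ∈ I, ∀ z : ℂ, ‖z‖ < 1 → ∀ F : HWM.hardy d,
      HWM.evalDisk (HWM.fourPull (P t) F) z =
        HWM.mean (Ring.inverse (HWM.resolventArg (U 0) t z) F) := fun t ht z hz F => by
    refine HWM.evalDisk_eq_mean_inverse (hle t) hz fun n => ?_
    rw [← HWM.four_apply, HWM.four_fourPull, hflow.coeff_formula hp hI h0 hP hPu ht,
      ← HWM.four_twistShift_pow hp0 (hsum 0 h0), HWM.four_apply]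
    rfl
  refine ⟨fun t => HWM.fourPull (P t), hP.isPropagator hp hsum, fun Q hQ t ht => ?_,
    fun t ht => HWM.fourPull_mem_unitary (hPu t ht), fun t _ z hz => ?_, hformula,
    fun t ht z hz => ?_⟩
  · ext1 F
    have h1 := (hQ.isEvol hp hsum).unique hp0 hI h0 hflow.toSymCurveOn hP ht
    rw [HWM.fourPull_apply, ← h1, HWM.fourConj_apply]
    simp only [LinearIsometryEquiv.symm_apply_apply]
  · exact (HWM.hasSum_inverse_one_sub_smul (hle t) hz).1
  · rw [← hformula t ht z hz]
    congr 1
    -- It remains to see that `ΠU(t) = P(t) ΠU_0`: write both projections as Toeplitz operators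
    -- applied to `1`, then use the intertwining relation and `P(t) 1 = 1`.
    refine (HWM.four d).injective ?_
    rw [HWM.four_fourPull, HWM.four_szego_eq hp0 (hsum t ht), HWM.four_szego_eq hp0 (hsum 0 h0),
      ← hflow.toep_comm hp hI h0 hP ht, hP.apply_const hp0 hI h0 hflow.toSymCurveOn ht]
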